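/- Let $M$ be a smooth finite-dimensional manifold without boundary and $F\colon TM\to[0,\infty)$ a Finsler metric: $F$ is continuous, smooth off the zero section, positively homogeneous of degree one, and for every $v\in TM\setminus 0$ the fundamental tensor $g_v(u,w)=\frac12\frac{\partial^2}{\partial t\,\partial s}F^2(v+tu+sw)|_{t=s=0}$ is positive definite. Let $C_v(u_1,u_2,u_3)=\frac14\frac{\partial^3}{\partial s_3\partial s_2\partial s_1}F^2(v+\sum_i s_iu_i)|_{s=0}$ be the Cartan tensor. For a nowhere vanishing local vector field $V$ let $\nabla^V$ be the (Chern) connection determined by $\nabla^V_XY-\nabla^V_YX=[X,Y]$ and $X(g_V(Y,Z))=g_V(\nabla^V_XY,Z)+g_V(Y,\nabla^V_XZ)+2C_V(\nabla^V_XV,Y,Z)$, with curvature $R^V(X,Y)Z=\nabla^V_X\nabla^V_YZ-\nabla^V_Y\nabla^V_XZ-\nabla^V_{[X,Y]}Z$. Let $c\colon\mathbb R/\mathbb Z\to M$ be a closed geodesic, i.e. a smooth closed curve with $T=\dot c\neq0$ everywhere and $D_c^TT=0$, where $D_c^T$ is the covariant derivative along $c$ induced by the connection with reference vector $T$; write $V'=D_c^TV$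 and $p=c(0)=c(1)$. The curvature term $R^T(T,V)T$ along $c$ is evaluated, at each point of $c$, by means of a local extension of $T$ with vanishing covariant derivative at that point. On the space $T_c\Lambda M$ of $H^1$ vector fields $V$ along $c$ with $V(0)=V(1)$ consider the index form $$I_c(V,W)=\int_0^1\big(g_T(V',W')+g_T(R^T(T,V)T,W)\big)\,ds .$$ The index $n_-$ of a form is the supremum of the dimensions of the subspaces on which it is negative definite. Let $\tilde\lambda(c)$ be the index of $I_c$ on $T_c\Lambda M$, let $\lambda(c)$ be its index on $T_c\Omega_pM=\{V\in T_c\Lambda M: V(0)=V(1)=0\}$, and let $\mathrm{con}(c)=\tilde\lambda(c)-\lambda(c)$ be the concavity index. Let $\mathbb J(c)$ be the space of Jacobi fields along $c$, i.e. of the smooth solutions of $J''=R^T(T,J)T$ (on $[0,1]$, or equivalently on the universal cover $\mathbb R$ of $\mathbb R/\mathbb Z$), and $$\mathbb J^{cl}(c)=\{J\in\mathbb J(c): J(0)=J(1)\},\quad \mathbb J^{p}(c)=\{J\in\mathbb J^{cl}(c): J'(0)=J'(1)\},\quad \mathbb J^{0}(c)=\{J\in\mathbb J(c): J(0)=J(1)=0\}.$$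 Define $b$ on $\mathbb J^{cl}(c)$ by $b(J_1,J_2)=g_T(J_1'(1)-J_1'(0),J_2(0))$. Then $\mathbb J(c)$ is finite dimensional, the indices $\tilde\lambda(c)$, $\lambda(c)$ and $n_-(b)$ are finite, and $$\tilde\lambda(c)=\lambda(c)+\dim\mathbb J^0(c)-\dim\big(\mathbb J^0(c)\cap\mathbb J^p(c)\big)+n_-(b).$$ Consequently $0\le\mathrm{con}(c)\le 2\dim M$. -/

import Mathlib

open scoped Manifold ContDiff Topology

noncomputable section

namespace FinslerIndex

/-! ### Fundamental tensor, Cartan tensor and Chern connection in linear coordinates -/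

section Coordinates

/-- The fundamental tensor `g_v(u,w) = ½ ∂²/∂t∂s Q(v + t u + s w)` at `t = s = 0`
of a function `Q` (the square of the Finsler norm) on a real vector space. -/
def fundTensor {W : Type*} [AddCommGroup W] [Module ℝ W] (Q : W → ℝ) (v u w : W) : ℝ :=
  (1 / 2 : ℝ) * deriv (fun t : ℝ => deriv (fun s : ℝ => Q (v + t • u + s • w)) 0) 0

/-- The Cartan tensor `C_v(u₁,u₂,u₃) = ¼ ∂³/∂s₃∂s₂∂s₁ Q(v + ∑ sᵢ uᵢ)` at `0`. -/
def cartanTensor {W : Type*} [AddCommGroup W] [Module ℝ W] (Q : W → ℝ)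
    (v u₁ u₂ u₃ : W) : ℝ :=
  (1 / 4 : ℝ) * deriv (fun s₃ : ℝ => deriv (fun s₂ : ℝ => deriv (fun s₁ : ℝ =>
    Q (v + s₁ • u₁ + s₂ • u₂ + s₃ • u₃)) 0) 0) 0

variable {E : Type*} [NormedAddCommGroup E] [NormedSpace ℝ E]

/-- `Q x y` is the coordinate expression of `F²`: `x` is the base point, `y` the tangent vector.
`Γ` is the Christoffel symbol at the point `x`, in the direction `v`, of the connection
characterized by
* `∇^V_X Y - ∇^V_Y X = [X,Y]`,
* `X(g_V(Y,Z)) = g_V(∇^V_X Y, Z) + g_V(Y, ∇^V_X Z) + 2 C_V(∇^V_X V, Y, Z)`.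

These are written for constant coordinate fields `X = u`, `Y = w`, `Z = z` and for a field `V`
with `V(x) = v`, for which `∇^V_X Y = Γ u w` and `∇^V_X V = DV(u) + Γ u v`. In the second
identity, the contributions `2 C_v(DV(u), w, z)` of the derivative of `V` to both sides cancel. -/
structure IsChernChristoffel (Q : E → E → ℝ) (x v : E) (Γ : E →L[ℝ] E →L[ℝ] E) : Prop where
  torsion_free : ∀ u w, Γ u w = Γ w u
  almost_metric : ∀ u w z,
    deriv (fun s : ℝ => fundTensor (Q (x + s • u)) v w z) 0 =
      fundTensor (Q x) v (Γ u w) z + fundTensor (Q x) v w (Γ u z)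
        + 2 * cartanTensor (Q x) v (Γ u v) w z

/-- The Christoffel symbols of the Chern connection: the (unique, for a Finsler metric and
`v ≠ 0`) solution of the equations in `IsChernChristoffel`. -/
def christoffel (Q : E → E → ℝ) (x v : E) : E →L[ℝ] E →L[ℝ] E :=
  Classical.epsilon (IsChernChristoffel Q x v)

/-- The derivative at `x`, in the direction `u`, of the Christoffel symbols
`x' ↦ Γ(x', V(x'))`, where `V` is a vector field with `V(x) = v` and `∇^V V = 0` at `x`,
that is, `DV(u) = - Γ u v`. -/
def horizontalDeriv (Q : E → E → ℝ) (x v u : E) : E →L[ℝ] E →L[ℝ] E :=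
  fderiv ℝ (fun x' => christoffel Q x' v) x u
    - fderiv ℝ (fun v' => christoffel Q x v') v (christoffel Q x v u v)

/-- The curvature `R^V(X,Y)Z = ∇^V_X ∇^V_Y Z - ∇^V_Y ∇^V_X Z - ∇^V_{[X,Y]} Z` at `x`, for a
field `V` with `V(x) = v` and `∇^V V = 0` at `x`, evaluated at `X = u`, `Y = w`, `Z = z`.
At every point of a geodesic, the velocity field extends to such a `V`. -/
def curvature (Q : E → E → ℝ) (x v u w z : E) : E :=
  horizontalDeriv Q x v u w z - horizontalDeriv Q x v w u z
    + christoffel Q x v u (christoffel Q x v w z) - christoffel Q x v w (christoffel Q x v u z)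

theorem curvature_add (Q : E → E → ℝ) (x v u w w' z : E) :
    curvature Q x v u (w + w') z = curvature Q x v u w z + curvature Q x v u w' z := by
  simp only [curvature, horizontalDeriv, map_add, add_apply,
    sub_apply]
  abel

theorem curvature_smul (Q : E → E → ℝ) (x v u w z : E) (r : ℝ) :
    curvature Q x v u (r • w) z = r • curvature Q x v u w z := by
  simp only [curvature, horizontalDeriv, map_smul, smul_apply,
    sub_apply, smul_sub, smul_add]

end Coordinates

/-! ### Index of a form -/

/-- The index `n₋(B)` of `B` on the subspace `S`: the supremum of the dimensions of the
(finite dimensional) subspaces of `S` on which `B` is negative definite. -/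
def negIndex {W : Type*} [AddCommGroup W] [Module ℝ W] (S : Submodule ℝ W)
    (B : W → W → ℝ) : ℕ∞ :=
  ⨆ (N : Submodule ℝ W) (_ : N ≤ S ∧ FiniteDimensional ℝ N ∧ ∀ v ∈ N, v ≠ 0 → B v v < 0),
    (Module.finrank ℝ N : ℕ∞)

/-! ### Finsler metrics on manifolds -/

section Manifold

variable {E : Type*} [NormedAddCommGroup E] [NormedSpace ℝ E]
  {M : Type*} [TopologicalSpace M] [ChartedSpace E M] [IsManifold 𝓘(ℝ, E) ∞ M]

/-- Finsler metrics `F : TM → [0,∞)`. -/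
structure IsFinslerMetric (F : TangentBundle 𝓘(ℝ, E) M → ℝ) : Prop where
  nonneg : ∀ v, 0 ≤ F v
  continuous : Continuous F
  smooth : ContMDiffOn (𝓘(ℝ, E).tangent) 𝓘(ℝ, ℝ) ∞ F {v | v.2 ≠ 0}
  homogeneous : ∀ (x : M) (v : TangentSpace 𝓘(ℝ, E) x) (r : ℝ), 0 < r →
    F ⟨x, r • v⟩ = r * F ⟨x, v⟩
  strongly_convex : ∀ (x : M) (v u : TangentSpace 𝓘(ℝ, E) x), v ≠ 0 → u ≠ 0 →
    0 < fundTensor (fun y : TangentSpace 𝓘(ℝ, E) x => F ⟨x, y⟩ ^ 2) v u u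

/-- The function `F²` in the coordinates `(x, y)` of `TM` given by the chart at `x₀`. -/
def coordSq (F : TangentBundle 𝓘(ℝ, E) M → ℝ) (x₀ : M) (x y : E) : ℝ :=
  F ⟨(extChartAt 𝓘(ℝ, E) x₀).symm x,
    tangentCoordChange 𝓘(ℝ, E) x₀ ((extChartAt 𝓘(ℝ, E) x₀).symm x)
      ((extChartAt 𝓘(ℝ, E) x₀).symm x) y⟩ ^ 2

/-- Vector fields along a curve `c`. -/
abbrev FieldAlong (c : ℝ → M) : Type _ := (t : ℝ) → TangentSpace 𝓘(ℝ, E) (c t)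

/-- The components of a tangent vector at `x` in the chart at `x`, which is how Mathlib
represents tangent vectors. When `x = y`, two vectors `v ∈ T_x M`, `w ∈ T_y M` are the same
vector if and only if `components v = components w`. -/
def components {x : M} (v : TangentSpace 𝓘(ℝ, E) x) : E := v

/-- The coordinate expression `φ ∘ c` of a curve in the chart `φ` at `c t₀`; it is meaningful
near `t₀`. -/
def coordCurve (c : ℝ → M) (t₀ s : ℝ) : E := extChartAt 𝓘(ℝ, E) (c t₀) (c s)

/-- The components of a field along `c` in the chart at `c t₀`; meaningful near `t₀`. -/
def coordField (c : ℝ → M) (V : FieldAlong (E := E) c) (t₀ s : ℝ) : E :=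
  tangentCoordChange 𝓘(ℝ, E) (c s) (c t₀) (c s) (V s)

/-- The velocity field `T = ċ`. -/
def velocity (c : ℝ → M) : FieldAlong (E := E) c :=
  fun t => mfderiv 𝓘(ℝ, ℝ) 𝓘(ℝ, E) c t (1 : ℝ)

/-- The covariant derivative `V' = D_c^T V` with reference vector `T = ċ`, computed at each time
`t` in the chart at `c t`: it is `V̇ + Γ(c, T)(ċ, V)`. -/
def covDeriv (F : TangentBundle 𝓘(ℝ, E) M → ℝ) (c : ℝ → M) (V : FieldAlong (E := E) c) :
    FieldAlong (E := E) c :=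
  fun t => deriv (coordField c V t) t +
    christoffel (coordSq F (c t)) (coordCurve c t t) (coordField c (velocity c) t t)
      (coordField c (velocity c) t t) (coordField c V t t)

/-- `R^T(T,V)T` along `c`, computed at each time `t` in the chart at `c t`. -/
def curvatureAlong (F : TangentBundle 𝓘(ℝ, E) M → ℝ) (c : ℝ → M) (V : FieldAlong (E := E) c) :
    FieldAlong (E := E) c :=
  fun t => curvature (E := E) (coordSq F (c t)) (coordCurve c t t) (coordField c (velocity c) t t)
    (coordField c (velocity c) t t) (coordField c V t t) (coordField c (velocity c) t t)

/-- The inner product `g_T` on `T_{c t} M`, where `T = ċ(t)`. -/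
def gT (F : TangentBundle 𝓘(ℝ, E) M → ℝ) (c : ℝ → M) (t : ℝ)
    (u w : TangentSpace 𝓘(ℝ, E) (c t)) : ℝ :=
  fundTensor (fun y : TangentSpace 𝓘(ℝ, E) (c t) => F ⟨c t, y⟩ ^ 2) (velocity c t) u w

/-- Closed geodesics, as 1-periodic curves on the line (that is, curves on `S¹ = ℝ/ℤ`):
smooth closed regular curves with `D_c^T T = 0`. -/
structure IsClosedGeodesic (F : TangentBundle 𝓘(ℝ, E) M → ℝ) (c : ℝ → M) : Prop where
  smooth : ContMDiff 𝓘(ℝ, ℝ) 𝓘(ℝ, E) ∞ c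
  periodic : ∀ t, c (t + 1) = c t
  regular : ∀ t, velocity (E := E) c t ≠ 0
  geodesic : ∀ t, covDeriv F c (velocity c) t = 0

/-- Smooth vector fields along `c`. -/
def IsSmoothAlong (c : ℝ → M) (V : FieldAlong (E := E) c) : Prop :=
  ∀ t₀ : ℝ, ContDiffAt ℝ ∞ (coordField c V t₀) t₀

/-- Vector fields along `c` which are locally of Sobolev class `H¹ = W^{1,2}`: near every time,
the components in a chart are primitives of square integrable functions. -/
def IsH1Along (c : ℝ → M) (V : FieldAlong (E := E) c) : Prop :=
  ∀ t₀ : ℝ, ∃ δ > 0, ∃ f : ℝ → E,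
    MeasureTheory.MemLp f 2 (MeasureTheory.volume.restrict (Set.Icc (t₀ - δ) (t₀ + δ))) ∧
    ∀ s ∈ Set.Icc (t₀ - δ) (t₀ + δ),
      coordField c V t₀ s = coordField c V t₀ t₀ + ∫ r in t₀..s, f r

/-! Linearity facts, needed to see that the spaces of fields below are vector spaces. -/

theorem coordField_zero (c : ℝ → M) (t₀ : ℝ) :
    coordField c (0 : FieldAlong (E := E) c) t₀ = fun _ => 0 :=
  funext fun s => (tangentCoordChange 𝓘(ℝ, E) (c s) (c t₀) (c s)).map_zero

theorem coordField_add (c : ℝ → M) (V W : FieldAlong (E := E) c) (t₀ : ℝ) :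
    coordField c (V + W) t₀ = fun s => coordField c V t₀ s + coordField c W t₀ s :=
  funext fun s => (tangentCoordChange 𝓘(ℝ, E) (c s) (c t₀) (c s)).map_add (V s) (W s)

theorem coordField_smul (c : ℝ → M) (r : ℝ) (V : FieldAlong (E := E) c) (t₀ : ℝ) :
    coordField c (r • V) t₀ = fun s => r • coordField c V t₀ s :=
  funext fun s => (tangentCoordChange 𝓘(ℝ, E) (c s) (c t₀) (c s)).map_smul r (V s)

theorem IsSmoothAlong.zero (c : ℝ → M) : IsSmoothAlong c (0 : FieldAlong (E := E) c) := by
  intro t₀; rw [coordField_zero]; exact contDiffAt_const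

theorem IsSmoothAlong.add {c : ℝ → M} {V W : FieldAlong (E := E) c}
    (hV : IsSmoothAlong c V) (hW : IsSmoothAlong c W) : IsSmoothAlong c (V + W) := by
  intro t₀; rw [coordField_add]; exact (hV t₀).add (hW t₀)

theorem IsSmoothAlong.smul {c : ℝ → M} {V : FieldAlong (E := E) c}
    (hV : IsSmoothAlong c V) (r : ℝ) : IsSmoothAlong c (r • V) := by
  intro t₀; rw [coordField_smul]; exact contDiffAt_const.smul (hV t₀)

theorem IsSmoothAlong.differentiableAt {c : ℝ → M} {V : FieldAlong (E := E) c}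
    (hV : IsSmoothAlong c V) (t : ℝ) : DifferentiableAt ℝ (coordField c V t) t :=
  (hV t).differentiableAt (by simp)

theorem IsH1Along.zero (c : ℝ → M) : IsH1Along c (0 : FieldAlong (E := E) c) := by
  intro t₀
  refine ⟨1, one_pos, fun _ => 0, MeasureTheory.MemLp.zero', fun s _ => ?_⟩
  rw [coordField_zero]; simp

theorem IsH1Along.smul {c : ℝ → M} {V : FieldAlong (E := E) c}
    (hV : IsH1Along c V) (r : ℝ) : IsH1Along c (r • V) := by
  intro t₀
  obtain ⟨δ, hδ, f, hf, h⟩ := hV t₀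
  refine ⟨δ, hδ, fun s => r • f s, hf.const_smul r, fun s hs => ?_⟩
  rw [coordField_smul]
  simp only [h s hs, smul_add, intervalIntegral.integral_smul]

theorem IsH1Along.add {c : ℝ → M} {V W : FieldAlong (E := E) c}
    (hV : IsH1Along c V) (hW : IsH1Along c W) : IsH1Along c (V + W) := by
  intro t₀
  obtain ⟨δ, hδ, f, hf, h⟩ := hV t₀
  obtain ⟨δ', hδ', f', hf', h'⟩ := hW t₀
  have hi : ∀ {η : ℝ} {k : ℝ → E}, MeasureTheory.MemLp k 2
      (MeasureTheory.volume.restrict (Set.Icc (t₀ - η) (t₀ + η))) → 0 < η →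
      ∀ s ∈ Set.Icc (t₀ - η) (t₀ + η),
        IntervalIntegrable k MeasureTheory.volume t₀ s := by
    intro η k hk hη s hs
    have h1 : MeasureTheory.IntegrableOn k (Set.Icc (t₀ - η) (t₀ + η)) :=
      hk.integrable (by norm_num)
    have h2 : Set.uIcc t₀ s ⊆ Set.Icc (t₀ - η) (t₀ + η) :=
      Set.uIcc_subset_Icc ⟨by linarith, by linarith⟩ hs
    exact (h1.mono_set h2).intervalIntegrable
  have hl : Set.Icc (t₀ - min δ δ') (t₀ + min δ δ') ⊆ Set.Icc (t₀ - δ) (t₀ + δ) :=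
    Set.Icc_subset_Icc (by linarith [min_le_left δ δ']) (by linarith [min_le_left δ δ'])
  have hr : Set.Icc (t₀ - min δ δ') (t₀ + min δ δ') ⊆ Set.Icc (t₀ - δ') (t₀ + δ') :=
    Set.Icc_subset_Icc (by linarith [min_le_right δ δ']) (by linarith [min_le_right δ δ'])
  refine ⟨min δ δ', lt_min hδ hδ', fun s => f s + f' s,
    (hf.mono_measure (MeasureTheory.Measure.restrict_mono hl le_rfl)).add
      (hf'.mono_measure (MeasureTheory.Measure.restrict_mono hr le_rfl)), fun s hs => ?_⟩
  rw [coordField_add,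
    intervalIntegral.integral_add (hi hf hδ s (hl hs)) (hi hf' hδ' s (hr hs))]
  simp only [h s (hl hs), h' s (hr hs)]
  abel

theorem covDeriv_zero (F : TangentBundle 𝓘(ℝ, E) M → ℝ) (c : ℝ → M) :
    covDeriv F c 0 = 0 := by
  funext t
  simp only [covDeriv, coordField_zero, deriv_const, map_zero, add_zero]
  rfl

theorem covDeriv_add {F : TangentBundle 𝓘(ℝ, E) M → ℝ} {c : ℝ → M}
    {V W : FieldAlong (E := E) c} (hV : IsSmoothAlong c V) (hW : IsSmoothAlong c W) :
    covDeriv F c (V + W) = covDeriv F c V + covDeriv F c W := by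
  funext t
  simp only [covDeriv, coordField_add, Pi.add_apply, map_add,
    deriv_fun_add (hV.differentiableAt t) (hW.differentiableAt t)]
  exact add_add_add_comm (G := E) _ _ _ _

theorem covDeriv_smul {F : TangentBundle 𝓘(ℝ, E) M → ℝ} {c : ℝ → M}
    {V : FieldAlong (E := E) c} (hV : IsSmoothAlong c V) (r : ℝ) :
    covDeriv F c (r • V) = r • covDeriv F c V := by
  funext t
  simp only [covDeriv, coordField_smul, Pi.smul_apply, map_smul,
    deriv_fun_const_smul r (hV.differentiableAt t)]
  exact (smul_add (A := E) r _ _).symm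

theorem curvatureAlong_zero (F : TangentBundle 𝓘(ℝ, E) M → ℝ) (c : ℝ → M) :
    curvatureAlong F c 0 = 0 := by
  funext t
  simp only [curvatureAlong, coordField_zero]
  have h := curvature_smul (coordSq F (c t)) (coordCurve c t t) (coordField c (velocity c) t t)
    (coordField c (velocity c) t t) 0 (coordField c (velocity c) t t) 0
  rw [zero_smul, zero_smul] at h
  exact h

theorem curvatureAlong_add (F : TangentBundle 𝓘(ℝ, E) M → ℝ) (c : ℝ → M)
    (V W : FieldAlong (E := E) c) :
    curvatureAlong F c (V + W) = curvatureAlong F c V + curvatureAlong F c W := by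
  funext t
  simp only [curvatureAlong, coordField_add]
  exact curvature_add (E := E) _ _ _ _ _ _ _

theorem curvatureAlong_smul (F : TangentBundle 𝓘(ℝ, E) M → ℝ) (c : ℝ → M) (r : ℝ)
    (V : FieldAlong (E := E) c) :
    curvatureAlong F c (r • V) = r • curvatureAlong F c V := by
  funext t
  simp only [curvatureAlong, coordField_smul]
  exact curvature_smul (E := E) _ _ _ _ _ _ _

/-- The tangent space `T_c ΛM`: the 1-periodic `H¹` vector fields along `c`, that is, the `H¹`
vector fields along the closed curve `c : ℝ/ℤ → M`. -/
def tangentLoop (c : ℝ → M) : Submodule ℝ (FieldAlong (E := E) c) where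
  carrier := {V | IsH1Along c V ∧ ∀ t, components (V (t + 1)) = components (V t)}
  zero_mem' := ⟨IsH1Along.zero c, fun _ => rfl⟩
  add_mem' := fun hV hW => ⟨hV.1.add hW.1, fun t =>
    congrArg₂ (fun a b : E => a + b) (hV.2 t) (hW.2 t)⟩
  smul_mem' := fun r _ hV => ⟨hV.1.smul r, fun t => congrArg (fun a : E => r • a) (hV.2 t)⟩

/-- The tangent space `T_c Ω_p M`, with `p = c 0 = c 1`: the fields in `T_c ΛM` which vanish at
the time `0` (hence at the time `1`). -/
def tangentBased (c : ℝ → M) : Submodule ℝ (FieldAlong (E := E) c) where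
  carrier := {V | V ∈ tangentLoop c ∧ V 0 = 0}
  zero_mem' := ⟨zero_mem _, rfl⟩
  add_mem' := fun hV hW => ⟨add_mem hV.1 hW.1, by
    rw [Pi.add_apply, hV.2, hW.2, add_zero]⟩
  smul_mem' := fun r _ hV => ⟨(tangentLoop c).smul_mem r hV.1, by
    rw [Pi.smul_apply, hV.2, smul_zero]⟩

/-- The index form `I_c(V,W) = ∫₀¹ g_T(V',W') + g_T(R^T(T,V)T, W)`. -/
def indexForm (F : TangentBundle 𝓘(ℝ, E) M → ℝ) (c : ℝ → M)
    (V W : FieldAlong (E := E) c) : ℝ :=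
  ∫ t in (0 : ℝ)..1, (gT F c t (covDeriv F c V t) (covDeriv F c W t)
    + gT F c t (curvatureAlong F c V t) (W t))

/-- The index `λ̃(c)` of `I_c` on `T_c ΛM`. -/
def loopIndex (F : TangentBundle 𝓘(ℝ, E) M → ℝ) (c : ℝ → M) : ℕ∞ :=
  negIndex (tangentLoop c) (indexForm F c)

/-- The index `λ(c)` of `I_c` on `T_c Ω_p M`, `p = c 0`. -/
def basedIndex (F : TangentBundle 𝓘(ℝ, E) M → ℝ) (c : ℝ → M) : ℕ∞ :=
  negIndex (tangentBased c) (indexForm F c)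

/-- The concavity index `con(c) = λ̃(c) - λ(c)` (for finite indices). -/
def concavityIndex (F : TangentBundle 𝓘(ℝ, E) M → ℝ) (c : ℝ → M) : ℤ :=
  ((loopIndex F c).toNat : ℤ) - ((basedIndex F c).toNat : ℤ)

/-- The space of Jacobi fields along `c`: the smooth solutions of `J'' = R^T(T,J)T`.
For a smooth `J` the field `J'` is again smooth; this is recorded as part of the definition
so that linearity is immediate. -/
def jacobi (F : TangentBundle 𝓘(ℝ, E) M → ℝ) (c : ℝ → M) :
    Submodule ℝ (FieldAlong (E := E) c) where
  carrier := {J | IsSmoothAlong c J ∧ IsSmoothAlong c (covDeriv F c J) ∧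
    ∀ t, covDeriv F c (covDeriv F c J) t = curvatureAlong F c J t}
  zero_mem' := by
    refine ⟨IsSmoothAlong.zero c, ?_, ?_⟩
    · rw [covDeriv_zero]; exact IsSmoothAlong.zero c
    · intro t; rw [covDeriv_zero, covDeriv_zero, curvatureAlong_zero]
  add_mem' := fun hV hW => by
    refine ⟨hV.1.add hW.1, ?_, ?_⟩
    · rw [covDeriv_add hV.1 hW.1]; exact hV.2.1.add hW.2.1
    · intro t
      rw [covDeriv_add hV.1 hW.1, covDeriv_add hV.2.1 hW.2.1, curvatureAlong_add,
        Pi.add_apply, Pi.add_apply, hV.2.2 t, hW.2.2 t]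
  smul_mem' := fun r _ hV => by
    refine ⟨hV.1.smul r, ?_, ?_⟩
    · rw [covDeriv_smul hV.1]; exact hV.2.1.smul r
    · intro t
      rw [covDeriv_smul hV.1, covDeriv_smul hV.2.1, curvatureAlong_smul,
        Pi.smul_apply, Pi.smul_apply, hV.2.2 t]

/-- `J^cl(c)`: the Jacobi fields with `J(0) = J(1)`. -/
def jacobiClosed (F : TangentBundle 𝓘(ℝ, E) M → ℝ) (c : ℝ → M) :
    Submodule ℝ (FieldAlong (E := E) c) where
  carrier := {J | J ∈ jacobi F c ∧ components (J 0) = components (J 1)}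
  zero_mem' := ⟨zero_mem _, rfl⟩
  add_mem' := fun hV hW =>
    ⟨add_mem hV.1 hW.1, congrArg₂ (fun a b : E => a + b) hV.2 hW.2⟩
  smul_mem' := fun r _ hV =>
    ⟨(jacobi F c).smul_mem r hV.1, congrArg (fun a : E => r • a) hV.2⟩

/-- `J^p(c)`: the Jacobi fields with `J(0) = J(1)` and `J'(0) = J'(1)`. -/
def jacobiPeriodic (F : TangentBundle 𝓘(ℝ, E) M → ℝ) (c : ℝ → M) :
    Submodule ℝ (FieldAlong (E := E) c) where
  carrier := {J | J ∈ jacobi F c ∧ components (J 0) = components (J 1) ∧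
    components (covDeriv F c J 0) = components (covDeriv F c J 1)}
  zero_mem' := ⟨zero_mem _, rfl, by rw [covDeriv_zero]; rfl⟩
  add_mem' := fun hV hW => by
    refine ⟨add_mem hV.1 hW.1, congrArg₂ (fun a b : E => a + b) hV.2.1 hW.2.1, ?_⟩
    rw [covDeriv_add hV.1.1 hW.1.1]
    exact congrArg₂ (fun a b : E => a + b) hV.2.2 hW.2.2
  smul_mem' := fun r _ hV => by
    refine ⟨(jacobi F c).smul_mem r hV.1, congrArg (fun a : E => r • a) hV.2.1, ?_⟩
    rw [covDeriv_smul hV.1.1]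
    exact congrArg (fun a : E => r • a) hV.2.2

/-- `J^0(c)`: the Jacobi fields with `J(0) = J(1) = 0`. -/
def jacobiZero (F : TangentBundle 𝓘(ℝ, E) M → ℝ) (c : ℝ → M) :
    Submodule ℝ (FieldAlong (E := E) c) where
  carrier := {J | J ∈ jacobi F c ∧ J 0 = 0 ∧ J 1 = 0}
  zero_mem' := ⟨zero_mem _, rfl, rfl⟩
  add_mem' := fun hV hW => ⟨add_mem hV.1 hW.1, by
    rw [Pi.add_apply, hV.2.1, hW.2.1, add_zero], by
    rw [Pi.add_apply, hV.2.2, hW.2.2, add_zero]⟩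
  smul_mem' := fun r _ hV => ⟨(jacobi F c).smul_mem r hV.1, by
    rw [Pi.smul_apply, hV.2.1, smul_zero], by
    rw [Pi.smul_apply, hV.2.2, smul_zero]⟩

/-- The form `b(J₁,J₂) = g_T(J₁'(1) - J₁'(0), J₂(0))`; the difference is taken in
`T_{c 0} M = T_{c 1} M`. -/
def closingForm (F : TangentBundle 𝓘(ℝ, E) M → ℝ) (c : ℝ → M)
    (J₁ J₂ : FieldAlong (E := E) c) : ℝ :=
  gT F c 0 (components (covDeriv F c J₁ 1) - components (covDeriv F c J₁ 0)) (J₂ 0)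

/-- The index `n₋(b)` of `b` on `J^cl(c)`. -/
def closingIndex (F : TangentBundle 𝓘(ℝ, E) M → ℝ) (c : ℝ → M) : ℕ∞ :=
  negIndex (jacobiClosed F c) (closingForm F c)

end Manifold

end FinslerIndex

end

open FinslerIndex

/-! The geometry is reduced to a Sturm–Liouville problem in a fixed Euclidean space, and the formula
is then linear algebra of one symmetric form.

Reduction. Along a geodesic the curve `(c, T)` in the tangent bundle is horizontal, so the Cartan
term drops out of the metric equation and `D_c^T` preserves `g_T` (`hasDerivAt_gT`). Hence there is
a parallel `g_T`-orthonormal frame (`exists_parallelFrame`), and going once around `c` changes it by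
an isometry `A` (`exists_holonomy`). Components in the frame turn loop fields into `H¹` functions
with `f (t + 1) = A (f t)`, the index form into `∫₀¹ ⟨f', h'⟩ + ⟨R f, h⟩` and Jacobi fields into
solutions of `J'' = R J`. The operator `R` is smooth, and symmetric because `R^T(T,·)T` is
self-adjoint for `g_T` (`chernCurv_symm`). Existence and smoothness of the Chern symbols come from a
linear Koszul system with injective operator; its naturality under coordinate changes makes all
chartwise definitions agree.

Linear algebra. Let `H` be the space of twisted `H¹` functions, `B` the index form and `S` the
functions vanishing at `0`. Weak solutions are solutions (`exists_modelJacobi_of_weak`), so the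
`B`-orthogonal of `S` consists of the closed Jacobi fields, twisted periodically from `[0,1)`;
integration by parts shows that `B` restricts there to the closing form `b`. The intersection of `S`
with its orthogonal is `J^0`, and the part of `S` in the radical of `B` is `J^0 ∩ J^p`. For any
symmetric form of finite index, `n₋(H) = n₋(S) + n₋(S^⊥) + dim (S ∩ S^⊥) - dim (S ∩ H^⊥)`, provided
that whatever is orthogonal to `S ∩ S^⊥` lies in `S + S^⊥` (`negIndex_top_add_finrank`). Here this
proviso is the Fredholm alternative for the boundary value problem (`exists_modelJacobi_boundary`).

Finiteness and bounds. By a Poincaré inequality `B` is nonnegative on functions vanishing on a fine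
enough finite mesh, so the index is finite. A field in `J^0` is determined by `J'(0)`, and `b`
vanishes on fields with `J(0) = 0`; so `dim J^0` and `n₋(b)` are at most `dim M`, which bounds the
concavity index above. It is nonnegative because the index is monotone in the subspace. -/

namespace FinslerIndex

/-! ### Linear algebra of the index -/

section LinearAlgebra

open Module LinearMap

variable {V : Type*} [AddCommGroup V] [Module ℝ V]

/-- `B` is negative definite on `N`. -/
def NegDefOn (B : V → V → ℝ) (N : Submodule ℝ V) : Prop :=
  ∀ v ∈ N, v ≠ 0 → B v v < 0

theorem le_negIndex {S N : Submodule ℝ V} {B : V → V → ℝ} (hN : N ≤ S)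
    [FiniteDimensional ℝ N] (h : NegDefOn B N) : (finrank ℝ N : ℕ∞) ≤ negIndex S B :=
  le_iSup₂_of_le N ⟨hN, inferInstance, h⟩ le_rfl

theorem negIndex_le {S : Submodule ℝ V} {B : V → V → ℝ} {k : ℕ∞}
    (h : ∀ N ≤ S, FiniteDimensional ℝ N → NegDefOn B N → (finrank ℝ N : ℕ∞) ≤ k) :
    negIndex S B ≤ k :=
  iSup₂_le fun N hN => h N hN.1 hN.2.1 hN.2.2

theorem negIndex_mono {S T : Submodule ℝ V} {B : V → V → ℝ} (h : S ≤ T) :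
    negIndex S B ≤ negIndex T B :=
  negIndex_le fun _ hN _ hd => le_negIndex (hN.trans h) hd

theorem negIndex_map {W : Type*} [AddCommGroup W] [Module ℝ W] (f : V →ₗ[ℝ] W)
    {S : Submodule ℝ V} {B : V → V → ℝ} {B' : W → W → ℝ}
    (hf : ∀ x ∈ S, f x = 0 → x = 0) (hB : ∀ x ∈ S, B' (f x) (f x) = B x x) :
    negIndex (S.map f) B' = negIndex S B := by
  have inj : ∀ N : Submodule ℝ V, N ≤ S → Function.Injective (f.domRestrict N) := by
    intro N hN
    rw [← LinearMap.ker_eq_bot, LinearMap.ker_eq_bot']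
    rintro ⟨x, hx⟩ h
    exact Subtype.ext (hf x (hN hx) h)
  have rk : ∀ N : Submodule ℝ V, N ≤ S → finrank ℝ (N.map f) = finrank ℝ N := by
    intro N hN
    rw [← LinearMap.finrank_range_of_inj (inj N hN), LinearMap.range_domRestrict]
  apply le_antisymm
  · refine negIndex_le fun N hN hfd hneg => ?_
    -- Injectivity is known on `S` only, so the preimage of `N` must be cut down to `S` to stay
    -- finite dimensional and to map isomorphically onto `N`.
    have hS : N.comap f ⊓ S ≤ S := inf_le_right
    have hmap : (N.comap f ⊓ S).map f = N := by
      apply le_antisymm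
      · rintro _ ⟨x, hx, rfl⟩
        exact hx.1
      · intro y hy
        obtain ⟨x, hx, rfl⟩ := hN hy
        exact ⟨x, ⟨hy, hx⟩, rfl⟩
    have hfd' : FiniteDimensional ℝ (N.comap f ⊓ S : Submodule ℝ V) := by
      let g : (N.comap f ⊓ S : Submodule ℝ V) →ₗ[ℝ] N :=
        (f.domRestrict _).codRestrict N fun x => x.2.1
      refine Module.Finite.of_injective g fun x y hxy => inj _ hS ?_
      exact congrArg Subtype.val hxy
    rw [← hmap, rk _ hS]
    refine le_negIndex hS fun v hv h0 => ?_
    rw [← hB v hv.2]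
    exact hneg _ hv.1 fun h => h0 (hf v hv.2 h)
  · refine negIndex_le fun N hN hfd hneg => ?_
    rw [← rk N hN]
    refine le_negIndex (Submodule.map_mono hN) ?_
    rintro _ ⟨x, hx, rfl⟩ h0
    rw [hB x (hN hx)]
    exact hneg x hx fun h => h0 (by rw [h, map_zero])

/-- A negative definite subspace meets the kernel of `ev` only in `0`, so `ev` embeds it into `K`.
This gives both the finiteness of the loop index and the bound on `n₋(b)`. -/
theorem negIndex_le_of_nonneg_on_ker {K : Type*} [AddCommGroup K] [Module ℝ K]
    [FiniteDimensional ℝ K] {S : Submodule ℝ V} {B : V → V → ℝ} (ev : V →ₗ[ℝ] K)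
    (h : ∀ x ∈ S, ev x = 0 → 0 ≤ B x x) : negIndex S B ≤ finrank ℝ K := by
  refine negIndex_le fun N hN hfd hneg => ?_
  have : Function.Injective (ev.domRestrict N) := by
    rw [← LinearMap.ker_eq_bot, LinearMap.ker_eq_bot']
    rintro ⟨x, hx⟩ h0
    by_contra hne
    have h1 := hneg x hx fun h => hne (Subtype.ext h)
    linarith [h x (hN hx) h0]
  exact_mod_cast LinearMap.finrank_le_finrank_of_injective this

/-- A negative definite `M ≤ S` meets `C` only in `0`, so it embeds into the quotient by `C`; there
it lands in the image of `N`, because `S ≤ N ⊔ C`. -/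
theorem negIndex_eq_finrank {S N C : Submodule ℝ V} {B : V → V → ℝ} (hN : N ≤ S)
    [FiniteDimensional ℝ N] (hneg : NegDefOn B N) (hC : ∀ x ∈ C, 0 ≤ B x x) (hS : S ≤ N ⊔ C) :
    negIndex S B = finrank ℝ N := by
  refine le_antisymm (negIndex_le fun M hM hfd hM' => ?_) (le_negIndex hN hneg)
  have inj : Function.Injective (C.mkQ.domRestrict M) := by
    rw [← LinearMap.ker_eq_bot, LinearMap.ker_eq_bot']
    rintro ⟨x, hx⟩ h0
    by_contra hne
    have h1 := hM' x hx fun h => hne (Subtype.ext h)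
    have h2 : x ∈ C := by simpa using h0
    linarith [hC x h2]
  have hr : LinearMap.range (C.mkQ.domRestrict M) ≤ N.map C.mkQ := by
    rw [LinearMap.range_domRestrict]
    refine (Submodule.map_mono (hM.trans hS)).trans ?_
    rw [Submodule.map_sup, Submodule.mkQ_map_self, sup_bot_eq]
  have h1 := LinearMap.finrank_range_of_inj inj
  have h2 := Submodule.finrank_mono hr
  have h3 := Submodule.finrank_map_le C.mkQ N
  exact_mod_cast h1 ▸ h2.trans h3

variable {B : LinearMap.BilinForm ℝ V}

/-- A form that is definite on a finite dimensional `N` identifies `N` with its dual; the functional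
`B(·, x)` on `N` is therefore represented by some `n ∈ N`, the orthogonal projection of `x`. -/
theorem exists_sub_orthogonal_of_negDefOn {N : Submodule ℝ V} [FiniteDimensional ℝ N]
    (hneg : NegDefOn (fun v w => B v w) N) (x : V) :
    ∃ n ∈ N, ∀ m ∈ N, B m (x - n) = 0 := by
  let θ : N →ₗ[ℝ] Dual ℝ N := (B.flip.domRestrict₁₂ N N)
  have hθ : Function.Injective θ := by
    rw [← LinearMap.ker_eq_bot, LinearMap.ker_eq_bot']
    rintro ⟨y, hy⟩ h0
    by_contra hne
    have h1 := hneg y hy fun h => hne (Subtype.ext h)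
    have h2 : B y y = 0 := LinearMap.congr_fun h0 ⟨y, hy⟩
    exact absurd h1 (by simp [h2])
  have hs : Function.Surjective θ :=
    (LinearMap.injective_iff_surjective_of_finrank_eq_finrank
      (Subspace.dual_finrank_eq (K := ℝ) (V := N)).symm).1 hθ
  obtain ⟨n, hn⟩ := hs ((B.flip x).domRestrict N)
  refine ⟨n, n.2, fun m hm => ?_⟩
  have : B m n = B m x := LinearMap.congr_fun hn ⟨m, hm⟩
  rw [map_sub, this, sub_self]

theorem bilin_add_self (hs : ∀ x y, B x y = B y x) (x y : V) :
    B (x + y) (x + y) = B x x + 2 * B x y + B y y := by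
  simp only [map_add, LinearMap.add_apply]
  rw [hs y x]
  ring

theorem negDefOn_sup (hs : ∀ x y, B x y = B y x) {N₁ N₂ : Submodule ℝ V}
    [FiniteDimensional ℝ N₁] [FiniteDimensional ℝ N₂]
    (h₁ : NegDefOn (fun v w => B v w) N₁) (h₂ : NegDefOn (fun v w => B v w) N₂)
    (ho : ∀ x ∈ N₁, ∀ y ∈ N₂, B x y = 0) :
    NegDefOn (fun v w => B v w) (N₁ ⊔ N₂) ∧
      finrank ℝ (N₁ ⊔ N₂ : Submodule ℝ V) = finrank ℝ N₁ + finrank ℝ N₂ := by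
  have nonpos : ∀ {N : Submodule ℝ V}, NegDefOn (fun v w => B v w) N → ∀ x ∈ N, B x x ≤ 0 := by
    intro N h x hx
    rcases eq_or_ne x 0 with rfl | h0
    · simp
    · exact (h x hx h0).le
  constructor
  · intro v hv h0
    obtain ⟨x, hx, y, hy, rfl⟩ := Submodule.mem_sup.1 hv
    change B (x + y) (x + y) < 0
    rw [bilin_add_self hs, ho x hx y hy]
    rcases eq_or_ne x 0 with rfl | hx0
    · have := h₂ y hy (by simpa using h0)
      simpa using this
    · have := h₁ x hx hx0
      have := nonpos h₂ y hy
      simp only at *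
      linarith
  · have hd : N₁ ⊓ N₂ = ⊥ := by
      rw [eq_bot_iff]
      rintro x ⟨hx₁, hx₂⟩
      by_contra h0
      have h1 := h₁ x hx₁ h0
      simp only [ho x hx₁ x hx₂, lt_irrefl] at h1
    have := Submodule.finrank_sup_add_finrank_inf_eq N₁ N₂
    rwa [hd, finrank_bot, add_zero] at this

/-- Take `N` of maximal dimension among the negative definite subspaces: a vector of negative square
orthogonal to `N` would enlarge it, and projection onto `N` splits `S`. -/
theorem exists_negDefOn_of_negIndex_ne_top (hs : ∀ x y, B x y = B y x) {S : Submodule ℝ V}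
    (h : negIndex S (fun v w => B v w) ≠ ⊤) :
    ∃ N ≤ S, FiniteDimensional ℝ N ∧ NegDefOn (fun v w => B v w) N ∧
      (∀ x ∈ S ⊓ B.orthogonal N, 0 ≤ B x x) ∧ S ≤ N ⊔ (S ⊓ B.orthogonal N) := by
  let P : ℕ → Prop := fun k => ∃ N ≤ S, FiniteDimensional ℝ N ∧
    NegDefOn (fun v w => B v w) N ∧ finrank ℝ N = k
  obtain ⟨K, hK⟩ := ENat.ne_top_iff_exists.1 h
  have bound : ∀ k, P k → k ≤ K := by
    rintro k ⟨N, hN, hfd, hneg, rfl⟩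
    have := le_negIndex (B := fun v w => B v w) hN hneg
    rw [← hK] at this
    exact_mod_cast this
  have hP : ∃ k, P k := ⟨0, ⊥, bot_le, inferInstance, fun v hv h0 => absurd (by simpa using hv) h0,
    finrank_bot ℝ V⟩
  obtain ⟨k, hk, hmax⟩ : ∃ k, P k ∧ ∀ j, P j → j ≤ k := by
    classical
    obtain ⟨k₀, hk₀⟩ := hP
    exact ⟨Nat.findGreatest P K, Nat.findGreatest_spec (bound k₀ hk₀) hk₀,
      fun j hj => Nat.le_findGreatest (bound j hj) hj⟩
  obtain ⟨N, hN, hfd, hneg, hrk⟩ := hk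
  refine ⟨N, hN, hfd, hneg, fun x hx => ?_, fun x hx => ?_⟩
  · by_contra hlt
    push Not at hlt
    have hx0 : x ≠ 0 := by rintro rfl; simp at hlt
    have hspan : NegDefOn (fun v w => B v w) (ℝ ∙ x) := by
      intro v hv hv0
      obtain ⟨r, rfl⟩ := Submodule.mem_span_singleton.1 hv
      have hr : r ≠ 0 := by rintro rfl; simp at hv0
      simp only [map_smul, LinearMap.smul_apply, smul_eq_mul]
      have : 0 < r * r := mul_self_pos.2 hr
      nlinarith
    have ho : ∀ y ∈ N, ∀ z ∈ (ℝ ∙ x), B y z = 0 := by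
      intro y hy z hz
      obtain ⟨r, rfl⟩ := Submodule.mem_span_singleton.1 hz
      rw [map_smul, LinearMap.BilinForm.mem_orthogonal_iff.1 hx.2 y hy, smul_zero]
    obtain ⟨h1, h2⟩ := negDefOn_sup hs hneg hspan ho
    have := hmax _ ⟨N ⊔ ℝ ∙ x, sup_le hN (by simpa using hx.1), inferInstance, h1, rfl⟩
    rw [h2, finrank_span_singleton hx0] at this
    omega
  · obtain ⟨n, hn, hno⟩ := exists_sub_orthogonal_of_negDefOn hneg x
    rw [← add_sub_cancel n x]
    exact Submodule.add_mem_sup hn ⟨sub_mem hx (hN hn), LinearMap.BilinForm.mem_orthogonal_iff.2 hno⟩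

/-- A totally isotropic space `Z` on which no element is orthogonal to `Y` spans, together with
suitable elements of `Y`, a space containing a negative definite subspace of dimension `dim Z`. -/
theorem exists_negDefOn_of_isotropic (hs : ∀ x y, B x y = B y x) {Y Z : Submodule ℝ V}
    [FiniteDimensional ℝ Z] (hZ : ∀ x ∈ Z, ∀ y ∈ Z, B x y = 0)
    (hY : ∀ z ∈ Z, (∀ y ∈ Y, B z y = 0) → z = 0) :
    ∃ U ≤ Y ⊔ Z, FiniteDimensional ℝ U ∧ NegDefOn (fun v w => B v w) U ∧
      finrank ℝ U = finrank ℝ Z ∧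
      ∀ x, ∃ w ∈ U ⊔ Z, ∀ z ∈ Z, B z (x - w) = 0 := by
  classical
  let b := finBasis ℝ Z
  set k := finrank ℝ Z
  let β : Y →ₗ[ℝ] Dual ℝ Z := (B.flip.domRestrict₁₂ Y Z)
  -- As `Z` is finite dimensional, surjectivity onto its dual is equivalent to injectivity of the
  -- flipped map, which is `hY`.
  have hβ : Function.Surjective β := by
    rw [← LinearMap.flip_injective_iff₂, ← LinearMap.ker_eq_bot, LinearMap.ker_eq_bot']
    rintro ⟨z, hz⟩ h0
    refine Subtype.ext (hY z hz fun y hy => ?_)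
    exact LinearMap.congr_fun h0 ⟨y, hy⟩
  choose w hw using fun i => hβ (b.coord i)
  have hzw : ∀ i j, B (b i) (w j) = if i = j then 1 else 0 := by
    intro i j
    have : B (b i) (w j) = b.coord j (b i) := LinearMap.congr_fun (hw j) (b i)
    simpa [Finsupp.single_apply] using this
  have hwz : ∀ i j, B (w j) (b i) = if i = j then 1 else 0 := fun i j => by rw [hs, hzw]
  have hzz : ∀ i j, B (b i) (b j) = 0 := fun i j => hZ _ (b i).2 _ (b j).2
  -- Half of the Gram matrix is subtracted to make the `w j` mutually isotropic without changing
  -- their pairing with `b`; in the resulting hyperbolic planes the vectors `w - b` are orthogonal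
  -- with square `-2`.
  let u : Fin k → V := fun j =>
    (w j : V) - (1 / 2 : ℝ) • ∑ i, B (w i) (w j) • (b i : V) - (b j : V)
  have huu : ∀ i j, B (u i) (u j) = if i = j then -2 else 0 := by
    intro i j
    simp only [u, map_sub, LinearMap.sub_apply, map_smul, LinearMap.smul_apply, map_sum,
      LinearMap.sum_apply, smul_eq_mul, hzw, hwz, hzz, sub_zero, mul_ite, mul_one, mul_zero,
      Finset.sum_ite_eq', Finset.mem_univ, if_true, Finset.sum_const_zero]
    rw [hs (w j) (w i)]
    rcases eq_or_ne i j with rfl | hij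
    · simp; ring
    · simp only [hij, hij.symm, if_false]
      ring
  have hquad : ∀ a : Fin k → ℝ, B (∑ i, a i • u i) (∑ i, a i • u i) = -2 * ∑ i, a i ^ 2 := by
    intro a
    simp only [map_sum, LinearMap.sum_apply, map_smul, LinearMap.smul_apply, huu, smul_eq_mul,
      mul_ite, mul_zero, Finset.sum_ite_eq', Finset.mem_univ, if_true,
      Finset.mul_sum]
    exact Finset.sum_congr rfl fun i _ => by ring
  have hneg : ∀ a : Fin k → ℝ, a ≠ 0 → B (∑ i, a i • u i) (∑ i, a i • u i) < 0 := by
    intro a ha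
    rw [hquad]
    have : 0 < ∑ i, a i ^ 2 := by
      obtain ⟨i, hi⟩ := Function.ne_iff.1 ha
      exact Finset.sum_pos' (fun i _ => sq_nonneg _) ⟨i, Finset.mem_univ i, sq_pos_of_ne_zero hi⟩
    linarith
  have hli : LinearIndependent ℝ u := by
    rw [Fintype.linearIndependent_iff]
    intro a ha i
    by_contra hi
    have := hneg a fun h => hi (congrFun h i)
    simp [ha] at this
  have hsumZ : ∀ c : Fin k → ℝ, ∑ i, c i • (b i : V) ∈ Z :=
    fun c => Submodule.sum_mem _ fun i _ => Submodule.smul_mem _ _ (b i).2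
  refine ⟨Submodule.span ℝ (Set.range u), ?_,
    FiniteDimensional.span_of_finite ℝ (Set.finite_range u), ?_, ?_, fun x => ?_⟩
  · rw [Submodule.span_le]
    rintro _ ⟨j, rfl⟩
    refine Submodule.sub_mem _ (Submodule.sub_mem _ (Submodule.mem_sup_left (w j).2) ?_)
      (Submodule.mem_sup_right (b j).2)
    exact Submodule.smul_mem _ _ (Submodule.mem_sup_right (hsumZ fun i => B (w i) (w j)))
  · intro v hv h0
    obtain ⟨a, rfl⟩ := (Submodule.mem_span_range_iff_exists_fun ℝ).1 hv
    exact hneg a fun h => h0 (by simp [h])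
  · rw [finrank_span_eq_card hli, Fintype.card_fin]
  · have hwU : ∀ j, (w j : V) ∈ Submodule.span ℝ (Set.range u) ⊔ Z := by
      intro j
      have : (w j : V) = u j + ((1 / 2 : ℝ) • ∑ i, B (w i) (w j) • (b i : V) + (b j : V)) := by
        simp only [u]; abel
      rw [this]
      refine Submodule.add_mem_sup (Submodule.subset_span ⟨j, rfl⟩) (add_mem ?_ (b j).2)
      exact Submodule.smul_mem _ _ (hsumZ fun i => B (w i) (w j))
    -- Since `w` is dual to `b`, this vector has the same pairings with `Z` as `x`.
    refine ⟨∑ j, B (b j) x • (w j : V), Submodule.sum_mem _ fun j _ =>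
      Submodule.smul_mem _ _ (hwU j), fun z hz => ?_⟩
    have hb : ∀ i, B (b i) (x - ∑ j, B (b j) x • (w j : V)) = 0 := by
      intro i
      simp [hzw]
    have hz' : z = ∑ i, b.repr ⟨z, hz⟩ i • (b i : V) := by
      have := congrArg Subtype.val (b.sum_repr ⟨z, hz⟩)
      simpa only [AddSubmonoidClass.coe_finsetSum, SetLike.val_smul] using this.symm
    rw [hz', map_sum, LinearMap.sum_apply]
    exact Finset.sum_eq_zero fun i _ => by rw [map_smul, LinearMap.smul_apply, hb, smul_zero]

/-- The index of a symmetric form in terms of its restrictions to `S` and to `S^⊥`. -/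
theorem negIndex_top_add_finrank (hs : ∀ x y, B x y = B y x) (S : Submodule ℝ V)
    (hfin : negIndex ⊤ (fun v w => B v w) ≠ ⊤)
    [FiniteDimensional ℝ (S ⊓ B.orthogonal S : Submodule ℝ V)]
    (hZ : B.orthogonal (S ⊓ B.orthogonal S) ≤ S ⊔ B.orthogonal S) :
    negIndex ⊤ (fun v w => B v w) + finrank ℝ (S ⊓ B.orthogonal ⊤ : Submodule ℝ V) =
      negIndex S (fun v w => B v w) + negIndex (B.orthogonal S) (fun v w => B v w)
        + finrank ℝ (S ⊓ B.orthogonal S : Submodule ℝ V) := by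
  set T := B.orthogonal S with hT
  set Z := S ⊓ T with hZdef
  set Z₀ := S ⊓ B.orthogonal ⊤ with hZ₀
  have hST : ∀ x ∈ S, ∀ y ∈ T, B x y = 0 := fun x hx y hy =>
    LinearMap.BilinForm.mem_orthogonal_iff.1 hy x hx
  have hZ₀Z : Z₀ ≤ Z := fun x hx =>
    ⟨hx.1, LinearMap.BilinForm.mem_orthogonal_iff.2 fun y _ =>
      LinearMap.BilinForm.mem_orthogonal_iff.1 hx.2 y trivial⟩
  obtain ⟨N, hNS, hNfd, hN, hC, hSN⟩ := exists_negDefOn_of_negIndex_ne_top hs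
    (ne_top_of_le_ne_top hfin (negIndex_mono (le_top : S ≤ ⊤)))
  obtain ⟨N', hNT, hNfd', hN', hC', hTN⟩ := exists_negDefOn_of_negIndex_ne_top hs
    (ne_top_of_le_ne_top hfin (negIndex_mono (le_top : T ≤ ⊤)))
  set C := S ⊓ B.orthogonal N
  set C' := T ⊓ B.orthogonal N'
  obtain ⟨hNN, hNNr⟩ := negDefOn_sup hs hN hN' fun x hx y hy => hST x (hNS hx) y (hNT hy)
  -- `Z₁` is a complement in `Z` of its part `Z₀` in the radical of `B`. Each dimension of `Z₁` will
  -- contribute one further negative direction, lying outside `S ⊔ T`.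
  obtain ⟨Z₁', hZ₁'⟩ := Submodule.exists_isCompl (Z₀.submoduleOf Z)
  set Z₁ := Z₁'.map Z.subtype
  have hZ₁Z : Z₁ ≤ Z := Submodule.map_subtype_le _ _
  have hsup : Z ≤ Z₀ ⊔ Z₁ := by
    have := congrArg (Submodule.map Z.subtype) hZ₁'.sup_eq_top
    rw [Submodule.map_sup, Submodule.map_top, Submodule.range_subtype, Submodule.submoduleOf,
      Submodule.map_comap_subtype, inf_eq_right.2 hZ₀Z] at this
    exact this.ge
  have hinf : Z₀ ⊓ Z₁ = ⊥ := by
    rw [eq_bot_iff]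
    rintro _ ⟨hx, y, hy, rfl⟩
    have : y ∈ Z₀.submoduleOf Z ⊓ Z₁' := ⟨hx, hy⟩
    rw [hZ₁'.inf_eq_bot] at this
    simp [(Submodule.mem_bot ℝ).1 this]
  have : FiniteDimensional ℝ Z₁ := Submodule.finiteDimensional_of_le hZ₁Z
  have : FiniteDimensional ℝ Z₀ := Submodule.finiteDimensional_of_le hZ₀Z
  have hrk : finrank ℝ Z₀ + finrank ℝ Z₁ = finrank ℝ Z := by
    have h1 := Submodule.finrank_sup_add_finrank_inf_eq Z₀ Z₁
    rw [hinf, finrank_bot, add_zero, le_antisymm (sup_le hZ₀Z hZ₁Z) hsup] at h1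
    exact h1.symm
  have hZS : ∀ z ∈ Z, ∀ y ∈ S ⊔ T, B z y = 0 := by
    intro z hz y hy
    obtain ⟨s, hs', t, ht, rfl⟩ := Submodule.mem_sup.1 hy
    rw [map_add, hs z s, hST s hs' z hz.2, hST z hz.1 t ht, add_zero]
  have hNNST : N ⊔ N' ≤ S ⊔ T := sup_le_sup hNS hNT
  -- The partners of `Z₁` are sought in the orthogonal of `N ⊔ N'`, so that `U` is orthogonal to `N
  -- ⊔ N'`. A vector of `Z₁` orthogonal to all of them is orthogonal to everything, since `Z` is
  -- already orthogonal to `N ⊔ N'`, hence is in the radical.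
  obtain ⟨U, hU, hUfd, hUneg, hUrk, hUx⟩ := exists_negDefOn_of_isotropic hs
    (Y := B.orthogonal (N ⊔ N')) (Z := Z₁)
    (fun x hx y hy => hZS x (hZ₁Z hx) y (Submodule.mem_sup_left (hZ₁Z hy).1)) (by
      intro z hz hzY
      have hz0 : z ∈ Z₀ := by
        refine ⟨(hZ₁Z hz).1, LinearMap.BilinForm.mem_orthogonal_iff.2 fun x _ => ?_⟩
        obtain ⟨n, hn, hno⟩ := exists_sub_orthogonal_of_negDefOn hNN x
        rw [hs, ← add_sub_cancel n x, map_add, hZS z (hZ₁Z hz) n (hNNST hn),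
          hzY _ (LinearMap.BilinForm.mem_orthogonal_iff.2 hno), add_zero]
      exact (Submodule.mem_bot ℝ).1 (hinf ▸ ⟨hz0, hz⟩))
  obtain ⟨hM, hMr⟩ := negDefOn_sup hs hNN hUneg (by
    intro x hx y hy
    obtain ⟨y₁, hy₁, z, hz, rfl⟩ := Submodule.mem_sup.1 (hU hy)
    rw [map_add, LinearMap.BilinForm.mem_orthogonal_iff.1 hy₁ x hx, hs x z,
      hZS z (hZ₁Z hz) x (hNNST hx), add_zero])
  have hZC : Z ≤ C := fun z hz => ⟨hz.1, LinearMap.BilinForm.mem_orthogonal_iff.2 fun n hn => by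
    rw [hs]; exact hZS z hz n (Submodule.mem_sup_left (hNS hn))⟩
  have hle₁ : S ⊔ T ≤ (N ⊔ N' ⊔ U) ⊔ (C ⊔ C') := by
    refine (sup_le_sup hSN hTN).trans ?_
    refine sup_le (sup_le ?_ ?_) (sup_le ?_ ?_)
    · exact le_sup_of_le_left (le_sup_of_le_left le_sup_left)
    · exact le_sup_of_le_right le_sup_left
    · exact le_sup_of_le_left (le_sup_of_le_left le_sup_right)
    · exact le_sup_of_le_right le_sup_right
  have e₁ : negIndex ⊤ (fun v w => B v w) = finrank ℝ (N ⊔ N' ⊔ U : Submodule ℝ V) := by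
    refine negIndex_eq_finrank (C := C ⊔ C') le_top hM ?_ ?_
    · intro x hx
      obtain ⟨y, hy, z, hz, rfl⟩ := Submodule.mem_sup.1 hx
      rw [bilin_add_self hs, hST y hy.1 z hz.1]
      linarith [hC y hy, hC' z hz]
    · intro x _
      obtain ⟨w, hw, hwz⟩ := hUx x
      -- After correction by `w` the vector is orthogonal to `Z₁`, and trivially to `Z₀`. Only here
      -- does the hypothesis `hZ` enter; it stands in for a duality argument, which is not automatic
      -- in infinite dimension.
      have hxw : x - w ∈ S ⊔ T := by
        refine hZ (LinearMap.BilinForm.mem_orthogonal_iff.2 fun z hz => ?_)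
        obtain ⟨z₀, hz₀, z₁, hz₁, rfl⟩ := Submodule.mem_sup.1 (hsup hz)
        rw [map_add, LinearMap.add_apply, hwz z₁ hz₁, hs,
          LinearMap.BilinForm.mem_orthogonal_iff.1 hz₀.2 _ trivial, add_zero]
      rw [← sub_add_cancel x w]
      refine add_mem (hle₁ hxw) ((sup_le ?_ ?_ : U ⊔ Z₁ ≤ _) hw)
      · exact le_sup_of_le_left le_sup_right
      · exact le_sup_of_le_right (le_sup_of_le_left (hZ₁Z.trans hZC))
  have e₂ : negIndex S (fun v w => B v w) = finrank ℝ N := negIndex_eq_finrank hNS hN hC hSN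
  have e₃ : negIndex T (fun v w => B v w) = finrank ℝ N' := negIndex_eq_finrank hNT hN' hC' hTN
  rw [e₁, e₂, e₃, hMr, hNNr, hUrk, ← hrk]
  push_cast
  ring

end LinearAlgebra

end FinslerIndex

namespace FinslerIndex

/-! ### Linear ordinary differential equations -/

section ODE

open Set Filter

variable {Y : Type*}

/-- Solutions of a local problem which is uniquely solvable on short intervals extend to
a half-line. -/
theorem exists_forward_solution (P : (ℝ → Y) → ℝ → Prop)
    (hloc : ∀ V W t, P V t → V =ᶠ[𝓝 t] W → P W t)
    (hex : ∀ t₀, ∃ δ > 0, ∀ s ∈ Ioo (t₀ - δ) (t₀ + δ), ∀ v, ∃ V, V s = v ∧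
      ∀ r ∈ Ioo (t₀ - δ) (t₀ + δ), P V r)
    (huniq : ∀ V W a b s, s ∈ Ioo a b → (∀ r ∈ Ioo a b, P V r) → (∀ r ∈ Ioo a b, P W r) →
      V s = W s → EqOn V W (Ioo a b)) (v : Y) :
    ∃ δ > 0, ∃ V : ℝ → Y, V 0 = v ∧ ∀ r, -δ < r → P V r := by
  obtain ⟨δ₀, hδ₀, h₀⟩ := hex 0
  refine ⟨δ₀, hδ₀, ?_⟩
  -- Right ends of existence intervals. If they were bounded, a local solution around the supremum,
  -- glued to a solution that comes within `δ` of it, would go beyond.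
  let S : Set ℝ := {b | 0 < b ∧ ∃ V : ℝ → Y, V 0 = v ∧ ∀ r ∈ Ioo (-δ₀) b, P V r}
  have hδS : δ₀ ∈ S := by
    obtain ⟨V, hV, hP⟩ := h₀ 0 ⟨by linarith, by linarith⟩ v
    exact ⟨hδ₀, V, hV, fun r hr => hP r ⟨by linarith [hr.1], by linarith [hr.2]⟩⟩
  have hunb : ¬ BddAbove S := by
    intro hb
    set β := sSup S
    have hβ : δ₀ ≤ β := le_csSup hb hδS
    obtain ⟨δ, hδ, hext⟩ := hex β
    obtain ⟨b, hbS, hb1⟩ := exists_lt_of_lt_csSup ⟨δ₀, hδS⟩ (show β - δ < β by linarith)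
    have hbβ : b ≤ β := le_csSup hb hbS
    obtain ⟨hb0, V, hV0, hV⟩ := hbS
    set a' := max 0 (β - δ)
    have ha' : a' < b := max_lt hb0 hb1
    obtain ⟨s, hs1, hs2⟩ := exists_between ha'
    have h0s : 0 < s := (le_max_left _ _).trans_lt hs1
    obtain ⟨W, hWs, hW⟩ := hext s ⟨(le_max_right _ _).trans_lt hs1, by linarith⟩ (V s)
    have heq : EqOn V W (Ioo a' b) := huniq V W a' b s ⟨hs1, hs2⟩
      (fun r hr => hV r ⟨by linarith [le_max_left 0 (β - δ), hr.1], hr.2⟩)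
      (fun r hr => hW r ⟨(le_max_right _ _).trans_lt hr.1, by linarith [hr.2]⟩) hWs.symm
    have hmem : β + δ ∈ S := by
      refine ⟨by linarith, fun t => if t < b then V t else W t, by simp [hb0, hV0], fun r hr => ?_⟩
      rcases lt_or_ge r b with hrb | hrb
      · refine hloc V _ r (hV r ⟨hr.1, hrb⟩) ?_
        filter_upwards [Iio_mem_nhds hrb] with t ht
        exact (if_pos ht).symm
      · refine hloc W _ r (hW r ⟨by linarith, hr.2⟩) ?_
        filter_upwards [Ioi_mem_nhds (ha'.trans_le hrb)] with t ht
        by_cases htb : t < b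
        · rw [if_pos htb]; exact (heq ⟨ht, htb⟩).symm
        · rw [if_neg htb]
    linarith [le_csSup hb hmem]
  have hall : ∀ T, ∃ V : ℝ → Y, V 0 = v ∧ ∀ r ∈ Ioo (-δ₀) T, P V r := by
    intro T
    obtain ⟨b, ⟨_, V, hV0, hV⟩, hTb⟩ := not_bddAbove_iff.1 hunb T
    exact ⟨V, hV0, fun r hr => hV r ⟨hr.1, hr.2.trans hTb⟩⟩
  choose V hV0 hV using hall
  have hcomp : ∀ T T' t, 0 < T → 0 < T' → -δ₀ < t → t < T → t < T' → V T t = V T' t := by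
    intro T T' t hT hT' h1 h2 h3
    exact huniq (V T) (V T') (-δ₀) (min T T') 0 ⟨by linarith, lt_min hT hT'⟩
      (fun r hr => hV T r ⟨hr.1, hr.2.trans_le (min_le_left _ _)⟩)
      (fun r hr => hV T' r ⟨hr.1, hr.2.trans_le (min_le_right _ _)⟩)
      (by rw [hV0, hV0]) ⟨h1, lt_min h2 h3⟩
  -- The value at `t` is taken from a solution that lives past `t`; by uniqueness this agrees near
  -- `r` with the single solution `V (|r| + 2)`.
  refine ⟨fun t => V (|t| + 1) t, by simpa using hV0 _, fun r hr => ?_⟩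
  refine hloc (V (|r| + 2)) _ r (hV _ r ⟨hr, by linarith [le_abs_self r]⟩) ?_
  filter_upwards [Ioi_mem_nhds hr, Iio_mem_nhds (show r < |r| + 1 by linarith [le_abs_self r])]
    with t ht1 ht2
  exact hcomp _ _ t (by positivity) (by positivity) ht1 (by linarith [mem_Iio.1 ht2])
    (by linarith [le_abs_self t])

/-- Solutions of a local problem which is uniquely solvable on short intervals are global. -/
theorem exists_global_solution (P : (ℝ → Y) → ℝ → Prop)
    (hloc : ∀ V W t, P V t → V =ᶠ[𝓝 t] W → P W t)
    (hex : ∀ t₀, ∃ δ > 0, ∀ s ∈ Ioo (t₀ - δ) (t₀ + δ), ∀ v, ∃ V, V s = v ∧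
      ∀ r ∈ Ioo (t₀ - δ) (t₀ + δ), P V r)
    (huniq : ∀ V W a b s, s ∈ Ioo a b → (∀ r ∈ Ioo a b, P V r) → (∀ r ∈ Ioo a b, P W r) →
      V s = W s → EqOn V W (Ioo a b)) (v : Y) :
    ∃ V : ℝ → Y, V 0 = v ∧ ∀ r, P V r := by
  obtain ⟨δ, hδ, V, hV0, hV⟩ := exists_forward_solution P hloc hex huniq v
  -- The backward half is the forward statement for the time-reversed problem. Both halves extend
  -- slightly past `0`, where uniqueness makes them agree, so that the glued function satisfies the
  -- local property at `0` too.
  obtain ⟨δ', hδ', W, hW0, hW⟩ := exists_forward_solution (fun V t => P (fun s => V (-s)) (-t))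
    (fun V W t h hVW => hloc _ _ _ h
      ((continuous_neg.tendsto' (-t) t (neg_neg t)).eventually hVW))
    (fun t₀ => by
      obtain ⟨δ, hδ, h⟩ := hex (-t₀)
      refine ⟨δ, hδ, fun s hs v => ?_⟩
      obtain ⟨V, hV, hP⟩ := h (-s) ⟨by linarith [hs.2], by linarith [hs.1]⟩ v
      refine ⟨fun r => V (-r), hV, fun r hr => ?_⟩
      simp only [neg_neg]
      exact hP (-r) ⟨by linarith [hr.2], by linarith [hr.1]⟩)
    (fun V W a b s hs hV hW hVW r hr => by
      have := huniq (fun r => V (-r)) (fun r => W (-r)) (-b) (-a) (-s)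
        ⟨by linarith [hs.2], by linarith [hs.1]⟩
        (fun r hr => by simpa using hV (-r) ⟨by linarith [hr.2], by linarith [hr.1]⟩)
        (fun r hr => by simpa using hW (-r) ⟨by linarith [hr.2], by linarith [hr.1]⟩)
        (by simpa using hVW) (show -r ∈ Ioo (-b) (-a) from ⟨by linarith [hr.2], by linarith [hr.1]⟩)
      simpa using this) v
  set η := min δ δ'
  have hη : 0 < η := lt_min hδ hδ'
  have hW' : ∀ r < δ', P (fun s => W (-s)) r := fun r hr => by simpa using hW (-r) (by linarith)
  have heq : EqOn V (fun s => W (-s)) (Ioo (-η) η) := huniq _ _ _ _ 0 ⟨by linarith, hη⟩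
    (fun r hr => hV r (by linarith [hr.1, min_le_left δ δ']))
    (fun r hr => hW' r (by linarith [hr.2, min_le_right δ δ'])) (by simp [hV0, hW0])
  refine ⟨fun t => if t < 0 then W (-t) else V t, by simp [hV0], fun r => ?_⟩
  rcases lt_or_ge r 0 with hr | hr
  · refine hloc _ _ r (hW' r (by linarith)) ?_
    filter_upwards [Iio_mem_nhds hr] with t ht
    exact (if_pos ht).symm
  · refine hloc _ _ r (hV r (by linarith)) ?_
    filter_upwards [Ioi_mem_nhds (show -η < r by linarith)] with t ht
    by_cases ht0 : t < 0
    · rw [if_pos ht0]; exact heq ⟨ht, ht0.trans hη⟩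
    · rw [if_neg ht0]

variable [NormedAddCommGroup Y] [NormedSpace ℝ Y]

theorem lipschitzOnWith_clm (A : Y →L[ℝ] Y) (s : Set Y) : LipschitzOnWith ‖A‖₊ A s :=
  A.lipschitz.lipschitzOnWith

/-- Picard–Lindelöf on the ball of radius `‖v‖ + 1` around `v`, where the field is bounded by `C
(2‖v‖ + 1)`. Since `C (b - a) ≤ 1/2`, the solution moves by at most `‖v‖ + 1/2`: the admissible
interval does not depend on `v`. -/
theorem exists_linear_ode_of_small [CompleteSpace Y] {A : ℝ → Y →L[ℝ] Y} {a b C : ℝ}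
    (hA : ContinuousOn A (Icc a b)) (hC : ∀ t ∈ Icc a b, ‖A t‖ ≤ C) (hab : C * (b - a) ≤ 1 / 2)
    {s : ℝ} (hs : s ∈ Icc a b) (v : Y) :
    ∃ α : ℝ → Y, α s = v ∧ ∀ t ∈ Icc a b, HasDerivWithinAt α (A t (α t)) (Icc a b) t := by
  have hC0 : 0 ≤ C := (norm_nonneg _).trans (hC s hs)
  have hpl : IsPicardLindelof (fun t y => A t y) (⟨s, hs⟩ : Icc a b) v (‖v‖₊ + 1) 0
      (C.toNNReal * (2 * ‖v‖₊ + 1)) C.toNNReal := by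
    refine ⟨fun t ht => ?_, fun x _ => hA.clm_apply continuousOn_const, fun t ht x hx => ?_, ?_⟩
    · refine (lipschitzOnWith_clm (A t) _).weaken ?_
      rw [← NNReal.coe_le_coe, Real.coe_toNNReal _ hC0]
      exact hC t ht
    · have hx' : ‖x‖ ≤ 2 * ‖v‖ + 1 := by
        have h1 : ‖x - v‖ ≤ ‖v‖ + 1 := by simpa [dist_eq_norm] using hx
        calc ‖x‖ = ‖x - v + v‖ := by rw [sub_add_cancel]
          _ ≤ ‖x - v‖ + ‖v‖ := norm_add_le _ _
          _ ≤ 2 * ‖v‖ + 1 := by linarith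
      rw [NNReal.coe_mul, Real.coe_toNNReal _ hC0]
      push_cast
      exact ((A t).le_opNorm x).trans (mul_le_mul (hC t ht) hx' (norm_nonneg _) hC0)
    · rw [NNReal.coe_mul, Real.coe_toNNReal _ hC0]
      push_cast
      have h1 : max (b - s) (s - a) ≤ b - a := max_le (by linarith [hs.1]) (by linarith [hs.2])
      have h2 : C * max (b - s) (s - a) ≤ 1 / 2 := (mul_le_mul_of_nonneg_left h1 hC0).trans hab
      have h3 : 0 ≤ ‖v‖ := norm_nonneg v
      nlinarith
  exact hpl.exists_eq_forall_mem_Icc_hasDerivWithinAt₀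

theorem exists_linear_ode_local [CompleteSpace Y] {A : ℝ → Y →L[ℝ] Y} {t₀ : ℝ} {I : Set ℝ}
    (hI : I ∈ 𝓝 t₀) (hA : ContinuousOn A I) :
    ∃ δ > 0, Ioo (t₀ - δ) (t₀ + δ) ⊆ I ∧ ∀ s ∈ Ioo (t₀ - δ) (t₀ + δ), ∀ v : Y,
      ∃ α : ℝ → Y, α s = v ∧ ∀ t ∈ Ioo (t₀ - δ) (t₀ + δ), HasDerivAt α (A t (α t)) t := by
  obtain ⟨η, hη, hηI⟩ := Metric.nhds_basis_closedBall.mem_iff.1 hI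
  rw [Real.closedBall_eq_Icc] at hηI
  obtain ⟨C, hC⟩ := isCompact_Icc.exists_bound_of_continuousOn (hA.mono hηI)
  set C' := max C 1
  have hC' : 0 < C' := lt_max_of_lt_right one_pos
  -- The interval has length `2δ`, so this makes `C'` times the length at most `1/2`.
  set δ := min η (1 / (4 * C'))
  have hδ : 0 < δ := lt_min hη (by positivity)
  have hsub : Icc (t₀ - δ) (t₀ + δ) ⊆ Icc (t₀ - η) (t₀ + η) :=
    Icc_subset_Icc (by linarith [min_le_left η (1 / (4 * C'))])
      (by linarith [min_le_left η (1 / (4 * C'))])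
  refine ⟨δ, hδ, Ioo_subset_Icc_self.trans (hsub.trans hηI), fun s hs v => ?_⟩
  have hsmall : C' * (t₀ + δ - (t₀ - δ)) ≤ 1 / 2 := by
    have : C' * δ ≤ 1 / 4 := by
      calc C' * δ ≤ C' * (1 / (4 * C')) := mul_le_mul_of_nonneg_left (min_le_right _ _) hC'.le
        _ = 1 / 4 := by field_simp
    linarith
  obtain ⟨α, hα, h⟩ := exists_linear_ode_of_small ((hA.mono hηI).mono hsub)
    (fun t ht => (hC t (hsub ht)).trans (le_max_left _ _)) hsmall (Ioo_subset_Icc_self hs) v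
  exact ⟨α, hα, fun t ht => (h t (Ioo_subset_Icc_self ht)).hasDerivAt (Icc_mem_nhds ht.1 ht.2)⟩

theorem linear_ode_unique_Icc {A : ℝ → Y →L[ℝ] Y} {a b : ℝ} (hA : ContinuousOn A (Icc a b))
    {f g : ℝ → Y} (hf : ContinuousOn f (Icc a b))
    (hf' : ∀ t ∈ Ico a b, HasDerivWithinAt f (A t (f t)) (Ici t) t)
    (hg : ContinuousOn g (Icc a b))
    (hg' : ∀ t ∈ Ico a b, HasDerivWithinAt g (A t (g t)) (Ici t) t) (h : f a = g a) :
    EqOn f g (Icc a b) := by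
  obtain ⟨C, hC⟩ := isCompact_Icc.exists_bound_of_continuousOn hA
  refine ODE_solution_unique_of_mem_Icc_right (v := fun t y => A t y) (s := fun _ => univ)
    (K := C.toNNReal) (fun t ht => ?_) hf hf' (fun _ _ => trivial) hg hg' (fun _ _ => trivial) h
  refine (lipschitzOnWith_clm (A t) _).weaken ?_
  rw [← NNReal.coe_le_coe]
  exact (hC t (Ico_subset_Icc_self ht)).trans (Real.le_coe_toNNReal C)

/-- `A` may be unbounded near the ends of the open interval; the comparison takes place on a compact
interval around `s` and `r`, where the equation is uniformly Lipschitz. -/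
theorem linear_ode_unique_Ioo {A : ℝ → Y →L[ℝ] Y} {a b s : ℝ} (hA : ContinuousOn A (Ioo a b))
    (hs : s ∈ Ioo a b) {f g : ℝ → Y} (hf : ∀ t ∈ Ioo a b, HasDerivAt f (A t (f t)) t)
    (hg : ∀ t ∈ Ioo a b, HasDerivAt g (A t (g t)) t) (h : f s = g s) : EqOn f g (Ioo a b) := by
  intro r hr
  obtain ⟨a', ha1, ha2⟩ := exists_between (lt_min hs.1 hr.1)
  obtain ⟨b', hb1, hb2⟩ := exists_between (max_lt hs.2 hr.2)
  have hsub : Icc a' b' ⊆ Ioo a b := fun t ht => ⟨ha1.trans_le ht.1, ht.2.trans_lt hb2⟩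
  have hsub' : Ioo a' b' ⊆ Ioo a b := Ioo_subset_Icc_self.trans hsub
  obtain ⟨C, hC⟩ := isCompact_Icc.exists_bound_of_continuousOn (hA.mono hsub)
  refine ODE_solution_unique_of_mem_Ioo (v := fun t y => A t y) (s := fun _ => univ)
    (K := C.toNNReal) (fun t ht => ?_) (a := a') (b := b') (t₀ := s)
    ⟨ha2.trans_le (min_le_left _ _), (le_max_left _ _).trans_lt hb1⟩
    (fun t ht => ⟨hf t (hsub' ht), trivial⟩) (fun t ht => ⟨hg t (hsub' ht), trivial⟩) h
    ⟨ha2.trans_le (min_le_right _ _), (le_max_right _ _).trans_lt hb1⟩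
  refine (lipschitzOnWith_clm (A t) _).weaken ?_
  rw [← NNReal.coe_le_coe]
  exact (hC t (Ioo_subset_Icc_self ht)).trans (Real.le_coe_toNNReal C)

theorem exists_linear_ode [CompleteSpace Y] {A : ℝ → Y →L[ℝ] Y} (hA : Continuous A) (v : Y) :
    ∃ α : ℝ → Y, α 0 = v ∧ ∀ t, HasDerivAt α (A t (α t)) t := by
  refine exists_global_solution (fun α t => HasDerivAt α (A t (α t)) t) ?_ ?_ ?_ v
  · intro V W t h hVW
    rw [← hVW.eq_of_nhds]
    exact h.congr_of_eventuallyEq hVW.symm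
  · intro t₀
    obtain ⟨δ, hδ, -, h⟩ := exists_linear_ode_local (t₀ := t₀) univ_mem hA.continuousOn
    exact ⟨δ, hδ, h⟩
  · intro V W a b s hs hV hW h
    exact linear_ode_unique_Ioo hA.continuousOn hs hV hW h

theorem contDiffAt_linear_ode {A : ℝ → Y →L[ℝ] Y} {I : Set ℝ} {t₀ : ℝ} (hI : I ∈ 𝓝 t₀)
    [CompleteSpace Y]
    (hA : ContDiffOn ℝ ∞ A I) {f : ℝ → Y} (hf : ∀ t ∈ I, HasDerivAt f (A t (f t)) t) :
    ContDiffAt ℝ ∞ f t₀ := by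
  obtain ⟨η, hη, hηI⟩ := Metric.nhds_basis_closedBall.mem_iff.1 hI
  rw [Real.closedBall_eq_Icc] at hηI
  have : ContDiffOn ℝ ∞ f (Icc (t₀ - η) (t₀ + η)) := by
    refine ODE.contDiffOn_enat_Icc_of_hasDerivWithinAt (n := ⊤) (f := fun t y => A t y) (u := univ)
      ?_ (fun t ht => (hf t (hηI ht)).hasDerivWithinAt) (fun _ _ => trivial)
    exact ((hA.mono hηI).comp contDiffOn_fst fun x hx => hx.1).clm_apply contDiffOn_snd
  exact this.contDiffAt (Icc_mem_nhds (by linarith) (by linarith))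

end ODE

end FinslerIndex

namespace FinslerIndex

/-! ### Functions with square integrable derivative -/

section Sobolev

open MeasureTheory Set Filter intervalIntegral
open scoped Interval

variable {Y Z : Type*} [NormedAddCommGroup Y]

theorem memLp_two_union {φ : ℝ → Y} {s t : Set ℝ} (hs : MemLp φ 2 (volume.restrict s))
    (ht : MemLp φ 2 (volume.restrict t)) : MemLp φ 2 (volume.restrict (s ∪ t)) := by
  have hm : AEStronglyMeasurable φ (volume.restrict (s ∪ t)) :=
    aestronglyMeasurable_union_iff.2 ⟨hs.1, ht.1⟩
  rw [memLp_two_iff_integrable_sq_norm hm]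
  exact IntegrableOn.union ((memLp_two_iff_integrable_sq_norm hs.1).1 hs)
    ((memLp_two_iff_integrable_sq_norm ht.1).1 ht)

theorem memLp_two_mono {φ : ℝ → Y} {s t : Set ℝ} (h : s ⊆ t)
    (ht : MemLp φ 2 (volume.restrict t)) : MemLp φ 2 (volume.restrict s) :=
  ht.mono_measure (Measure.restrict_mono h le_rfl)

theorem memLp_two_intervalIntegrable {φ : ℝ → Y} {a b c d : ℝ}
    (h : MemLp φ 2 (volume.restrict (Icc a b))) (hc : c ∈ Icc a b) (hd : d ∈ Icc a b) :
    IntervalIntegrable φ volume c d := by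
  have h1 : IntegrableOn φ (Icc a b) := h.integrable (by norm_num)
  exact (h1.mono_set (uIcc_subset_Icc hc hd)).intervalIntegrable

theorem memLp_two_of_continuousOn {φ : ℝ → Y} {a b : ℝ} (h : ContinuousOn φ (Icc a b)) :
    MemLp φ 2 (volume.restrict (Icc a b)) := by
  obtain ⟨C, hC⟩ := isCompact_Icc.exists_bound_of_continuousOn h
  refine MemLp.of_bound (h.aestronglyMeasurable measurableSet_Icc) C ?_
  filter_upwards [ae_restrict_mem measurableSet_Icc] with t ht using hC t ht

variable [NormedSpace ℝ Y] [NormedAddCommGroup Z] [NormedSpace ℝ Z]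

/-- `φ` is a locally square integrable derivative of `f`. -/
structure HasL2Deriv (f φ : ℝ → Y) : Prop where
  memLp : ∀ a b, MemLp φ 2 (volume.restrict (Icc a b))
  eq_integral : ∀ t, f t = f 0 + ∫ s in (0 : ℝ)..t, φ s

namespace HasL2Deriv

variable {f φ h χ : ℝ → Y}

theorem intervalIntegrable (H : HasL2Deriv f φ) (a b : ℝ) : IntervalIntegrable φ volume a b :=
  memLp_two_intervalIntegrable (H.memLp (min a b) (max a b)) ⟨min_le_left _ _, le_max_left _ _⟩
    ⟨min_le_right _ _, le_max_right _ _⟩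

theorem sub_eq (H : HasL2Deriv f φ) (a b : ℝ) : f b - f a = ∫ s in a..b, φ s := by
  rw [H.eq_integral b, H.eq_integral a, add_sub_add_left_eq_sub,
    integral_interval_sub_left (H.intervalIntegrable 0 b) (H.intervalIntegrable 0 a)]

theorem locallyIntegrable (H : HasL2Deriv f φ) : LocallyIntegrable φ volume := by
  refine locallyIntegrable_iff.2 fun K hK => ?_
  obtain ⟨a, b, hab⟩ : ∃ a b, K ⊆ Icc a b := by
    obtain ⟨r, hr⟩ := hK.isBounded.subset_closedBall 0
    exact ⟨_, _, hr.trans (Real.closedBall_eq_Icc).le⟩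
  have h1 : IntegrableOn φ (Icc a b) := (H.memLp a b).integrable (by norm_num)
  exact h1.mono_set hab

/-- Lebesgue's differentiation theorem for the primitive of `φ`. -/
theorem ae_hasDerivAt [CompleteSpace Y] (H : HasL2Deriv f φ) : ∀ᵐ t, HasDerivAt f (φ t) t := by
  filter_upwards [LocallyIntegrable.ae_hasDerivAt_integral H.locallyIntegrable] with t ht
  have : f = fun t => f 0 + ∫ s in (0 : ℝ)..t, φ s := funext H.eq_integral
  rw [this]
  exact (ht 0).const_add _

theorem deriv_ae_eq [CompleteSpace Y] (H : HasL2Deriv f φ) : deriv f =ᵐ[volume] φ := by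
  filter_upwards [H.ae_hasDerivAt] with t ht using ht.deriv

theorem continuous (H : HasL2Deriv f φ) : Continuous f := by
  have : f = fun t => f 0 + ∫ s in (0 : ℝ)..t, φ s := funext H.eq_integral
  rw [this]
  exact continuous_const.add (continuous_primitive H.intervalIntegrable 0)

theorem add (H : HasL2Deriv f φ) (H' : HasL2Deriv h χ) :
    HasL2Deriv (fun t => f t + h t) (fun t => φ t + χ t) := by
  refine ⟨fun a b => (H.memLp a b).add (H'.memLp a b), fun t => ?_⟩
  rw [integral_add (H.intervalIntegrable 0 t) (H'.intervalIntegrable 0 t), H.eq_integral t,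
    H'.eq_integral t]
  abel

theorem clm_comp [CompleteSpace Y] [CompleteSpace Z] (L : Y →L[ℝ] Z) (H : HasL2Deriv f φ) :
    HasL2Deriv (fun t => L (f t)) (fun t => L (φ t)) := by
  refine ⟨fun a b => L.comp_memLp' (H.memLp a b), fun t => ?_⟩
  rw [L.intervalIntegral_comp_comm (H.intervalIntegrable 0 t), H.eq_integral t, map_add]

theorem const_smul (H : HasL2Deriv f φ) (r : ℝ) :
    HasL2Deriv (fun t => r • f t) (fun t => r • φ t) := by
  refine ⟨fun a b => (H.memLp a b).const_smul r, fun t => ?_⟩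
  rw [intervalIntegral.integral_smul, H.eq_integral t, smul_add]

theorem zero : HasL2Deriv (fun _ => (0 : Y)) (fun _ => 0) :=
  ⟨fun _ _ => MemLp.zero', fun _ => by simp⟩

/-- Only the class of `φ` up to null sets matters, so the density can always be normalised to `deriv
f`. -/
theorem congr_ae (H : HasL2Deriv f φ) {ψ : ℝ → Y} (hψ : φ =ᵐ[volume] ψ) : HasL2Deriv f ψ := by
  refine ⟨fun a b => (H.memLp a b).ae_eq (ae_restrict_of_ae hψ), fun t => ?_⟩
  rw [H.eq_integral t]
  congr 1
  exact intervalIntegral.integral_congr_ae (hψ.mono fun s hs _ => hs)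

theorem deriv [CompleteSpace Y] (H : HasL2Deriv f φ) : HasL2Deriv f (deriv f) :=
  H.congr_ae H.deriv_ae_eq.symm

theorem of_hasDerivAt [CompleteSpace Y] (hf : ∀ t, HasDerivAt f (φ t) t) (hφ : Continuous φ) :
    HasL2Deriv f φ := by
  refine ⟨fun a b => memLp_two_of_continuousOn hφ.continuousOn, fun t => ?_⟩
  rw [integral_eq_sub_of_hasDerivAt (fun s _ => hf s) (hφ.intervalIntegrable _ _)]
  abel

theorem of_integral (hφ : ∀ a b, MemLp φ 2 (volume.restrict (Icc a b))) (y : Y) :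
    HasL2Deriv (fun t => y + ∫ s in (0 : ℝ)..t, φ s) φ :=
  ⟨hφ, fun t => by simp⟩

end HasL2Deriv

theorem integrableOn_inner_of_memLp {X : Type*} [NormedAddCommGroup X] [InnerProductSpace ℝ X]
    {φ χ : ℝ → X} {s : Set ℝ} (hφ : MemLp φ 2 (volume.restrict s))
    (hχ : MemLp χ 2 (volume.restrict s)) : IntegrableOn (fun t => inner ℝ (φ t) (χ t)) s := by
  have h : Integrable (fun t => ‖φ t‖ * ‖χ t‖) (volume.restrict s) :=
    hφ.norm.integrable_mul hχ.norm
  exact h.mono' (hφ.1.inner hχ.1) (Eventually.of_forall fun t => norm_inner_le_norm _ _)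

theorem absolutelyContinuousOnInterval_primitive {φ : ℝ → ℝ} {a b t₀ y : ℝ}
    (hφ : IntervalIntegrable φ volume a b) (ht₀ : t₀ ∈ [[a, b]]) :
    AbsolutelyContinuousOnInterval (fun t => y + ∫ s in t₀..t, φ s) a b := by
  refine AbsolutelyContinuousOnInterval.fun_add ?_
    (hφ.absolutelyContinuousOnInterval_intervalIntegral ht₀)
  exact (contDiff_const (n := 1)).contDiffOn.absolutelyContinuousOnInterval

/-- Integration by parts for primitives. -/
theorem integral_mul_add_mul_of_primitive {φ χ : ℝ → ℝ} {a b y z : ℝ}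
    (hφ : IntervalIntegrable φ volume a b) (hχ : IntervalIntegrable χ volume a b) :
    ∫ t in a..b, (φ t * (z + ∫ s in a..t, χ s) + (y + ∫ s in a..t, φ s) * χ t) =
      (y + ∫ s in a..b, φ s) * (z + ∫ s in a..b, χ s) - y * z := by
  have h1 := absolutelyContinuousOnInterval_primitive (y := y) hφ left_mem_uIcc
  have h2 := absolutelyContinuousOnInterval_primitive (y := z) hχ left_mem_uIcc
  have := h1.integral_deriv_mul_eq_sub h2
  simp only [integral_same, add_zero] at this
  rw [← this]
  apply intervalIntegral.integral_congr_ae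
  filter_upwards [hφ.ae_hasDerivAt_integral, hχ.ae_hasDerivAt_integral] with t h3 h4 ht
  have ht' := uIoc_subset_uIcc ht
  rw [((h3 ht' a left_mem_uIcc).const_add y).deriv, ((h4 ht' a left_mem_uIcc).const_add z).deriv]

/-- Scalar integration by parts, summed over the coordinates in an orthonormal basis. -/
theorem HasL2Deriv.integral_inner_add_inner {X : Type*} [NormedAddCommGroup X]
    [InnerProductSpace ℝ X] [FiniteDimensional ℝ X] {f φ h χ : ℝ → X} (Hf : HasL2Deriv f φ)
    (Hh : HasL2Deriv h χ) (a b : ℝ) :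
    ∫ t in a..b, (inner ℝ (φ t) (h t) + inner ℝ (f t) (χ t)) =
      inner ℝ (f b) (h b) - inner ℝ (f a) (h a) := by
  let e := stdOrthonormalBasis ℝ X
  have hc : ∀ {f φ : ℝ → X} (_ : HasL2Deriv f φ) (i),
      HasL2Deriv (fun t => inner ℝ (e i) (f t)) (fun t => inner ℝ (e i) (φ t)) :=
    fun H i => H.clm_comp (innerSL ℝ (e i))
  have hs : ∀ x y : X, inner ℝ x y = ∑ i, inner ℝ (e i) x * inner ℝ (e i) y := by
    intro x y
    rw [← e.sum_inner_mul_inner x y]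
    exact Finset.sum_congr rfl fun i _ => by rw [real_inner_comm x]
  have key : ∀ i, ∫ t in a..b, (inner ℝ (e i) (φ t) * inner ℝ (e i) (h t)
      + inner ℝ (e i) (f t) * inner ℝ (e i) (χ t)) =
      inner ℝ (e i) (f b) * inner ℝ (e i) (h b) - inner ℝ (e i) (f a) * inner ℝ (e i) (h a) := by
    intro i
    have h1 := integral_mul_add_mul_of_primitive (y := inner ℝ (e i) (f a))
      (z := inner ℝ (e i) (h a)) ((hc Hf i).intervalIntegrable a b)
      ((hc Hh i).intervalIntegrable a b)
    simp only [← (hc Hf i).sub_eq a, ← (hc Hh i).sub_eq a, add_sub_cancel] at h1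
    exact h1
  have hint : ∀ i ∈ Finset.univ, IntervalIntegrable (fun t => inner ℝ (e i) (φ t) * inner ℝ (e i) (h t)
      + inner ℝ (e i) (f t) * inner ℝ (e i) (χ t)) volume a b := fun i _ =>
    (((hc Hf i).intervalIntegrable a b).mul_continuousOn (hc Hh i).continuous.continuousOn).add
      (((hc Hh i).intervalIntegrable a b).continuousOn_mul (hc Hf i).continuous.continuousOn)
  rw [hs (f b), hs (f a), ← Finset.sum_sub_distrib, ← Finset.sum_congr rfl fun i _ => key i,
    ← integral_finsetSum hint]
  refine integral_congr fun t _ => ?_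
  simp only [Finset.sum_add_distrib, ← hs]

/-- `y` is, near `t₀`, a primitive of a square integrable function. -/
def H1At (y : ℝ → Y) (t₀ : ℝ) : Prop :=
  ∃ δ > 0, ∃ f : ℝ → Y,
    MemLp f 2 (volume.restrict (Icc (t₀ - δ) (t₀ + δ))) ∧
    ∀ s ∈ Icc (t₀ - δ) (t₀ + δ), y s = y t₀ + ∫ r in t₀..s, f r

theorem HasL2Deriv.h1At {f φ : ℝ → Y} (H : HasL2Deriv f φ) (t₀ : ℝ) : H1At f t₀ :=
  ⟨1, one_pos, φ, H.memLp _ _, fun s _ => by rw [← H.sub_eq, add_sub_cancel]⟩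

namespace H1At

variable {y z : ℝ → Y} {t₀ : ℝ}

theorem shrink (h : H1At y t₀) {η : ℝ} (hη : 0 < η) : ∃ δ > 0, δ ≤ η ∧ ∃ f : ℝ → Y,
    MemLp f 2 (volume.restrict (Icc (t₀ - δ) (t₀ + δ))) ∧
    ∀ s ∈ Icc (t₀ - δ) (t₀ + δ), y s = y t₀ + ∫ r in t₀..s, f r := by
  obtain ⟨δ, hδ, f, hf, hy⟩ := h
  have hsub : Icc (t₀ - min δ η) (t₀ + min δ η) ⊆ Icc (t₀ - δ) (t₀ + δ) :=
    Icc_subset_Icc (by linarith [min_le_left δ η]) (by linarith [min_le_left δ η])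
  exact ⟨min δ η, lt_min hδ hη, min_le_right _ _, f, memLp_two_mono hsub hf,
    fun s hs => hy s (hsub hs)⟩

theorem congr (h : H1At y t₀) (hyz : y =ᶠ[𝓝 t₀] z) : H1At z t₀ := by
  obtain ⟨η, hη, hball⟩ := Metric.nhds_basis_closedBall.mem_iff.1 hyz
  obtain ⟨δ, hδ, hδη, f, hf, hy⟩ := h.shrink hη
  refine ⟨δ, hδ, f, hf, fun s hs => ?_⟩
  have : s ∈ Metric.closedBall t₀ η := by
    rw [Real.closedBall_eq_Icc]; exact ⟨by linarith [hs.1], by linarith [hs.2]⟩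
  rw [← show y s = z s from hball this, ← hyz.eq_of_nhds]
  exact hy s hs

theorem clm_comp [CompleteSpace Y] [CompleteSpace Z] (L : Y →L[ℝ] Z) (h : H1At y t₀) :
    H1At (fun s => L (y s)) t₀ := by
  obtain ⟨δ, hδ, f, hf, hy⟩ := h
  refine ⟨δ, hδ, fun s => L (f s), L.comp_memLp' hf, fun s hs => ?_⟩
  rw [L.intervalIntegral_comp_comm (memLp_two_intervalIntegrable hf
    ⟨by linarith, by linarith⟩ hs), ← map_add, ← hy s hs]

theorem add (h : H1At y t₀) (h' : H1At z t₀) : H1At (fun s => y s + z s) t₀ := by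
  obtain ⟨η, hη, g, hg, hz⟩ := h'
  obtain ⟨δ, hδ, hδη, f, hf, hy⟩ := h.shrink hη
  have hsub : Icc (t₀ - δ) (t₀ + δ) ⊆ Icc (t₀ - η) (t₀ + η) :=
    Icc_subset_Icc (by linarith) (by linarith)
  have ht₀ : t₀ ∈ Icc (t₀ - δ) (t₀ + δ) := ⟨by linarith, by linarith⟩
  refine ⟨δ, hδ, fun s => f s + g s, hf.add (memLp_two_mono hsub hg), fun s hs => ?_⟩
  rw [integral_add (memLp_two_intervalIntegrable hf ht₀ hs)
      (memLp_two_intervalIntegrable hg (hsub ht₀) (hsub hs))]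
  simp only [hy s hs, hz s (hsub hs)]
  abel

theorem zero : H1At (fun _ => (0 : Y)) t₀ :=
  HasL2Deriv.zero.h1At t₀

theorem sum {ι : Type*} (S : Finset ι) {y : ι → ℝ → Y} (h : ∀ i ∈ S, H1At (y i) t₀) :
    H1At (fun s => ∑ i ∈ S, y i s) t₀ := by
  classical
  induction S using Finset.induction_on with
  | empty => simpa using zero
  | insert i S hi ih =>
    simp only [Finset.sum_insert hi]
    exact (h i (Finset.mem_insert_self i S)).add
      (ih fun j hj => h j (Finset.mem_insert_of_mem hj))

/-- The density of the product is `f w + u w'` by the Leibniz rule for primitives. Together with the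
next lemma this makes `H¹` regularity independent of the smooth frame in which components are taken.
-/
theorem mul_contDiffAt {u w : ℝ → ℝ} (hu : H1At u t₀) (hw : ContDiffAt ℝ 1 w t₀) :
    H1At (fun s => u s * w s) t₀ := by
  obtain ⟨U, hU, hwU⟩ := hw.contDiffOn (m := 1) le_rfl (by simp)
  obtain ⟨η, hη, hball⟩ := Metric.nhds_basis_closedBall.mem_iff.1 hU
  -- Half of `η`, so that the closed interval of radius `δ` lies inside the open one on which `w` is
  -- `C¹`.
  obtain ⟨δ, hδ, hδη, f, hf, hy⟩ := hu.shrink (half_pos hη)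
  have hIcc : Icc (t₀ - δ) (t₀ + δ) ⊆ Ioo (t₀ - η) (t₀ + η) := fun s hs =>
    ⟨by linarith [hs.1], by linarith [hs.2]⟩
  have hw1 : ContDiffOn ℝ 1 w (Ioo (t₀ - η) (t₀ + η)) :=
    hwU.mono (((Real.ball_eq_Ioo t₀ η).symm.subset.trans Metric.ball_subset_closedBall).trans hball)
  have hw' : ContinuousOn (deriv w) (Icc (t₀ - δ) (t₀ + δ)) :=
    (hw1.continuousOn_deriv_of_isOpen isOpen_Ioo le_rfl).mono hIcc
  have hwc : ContinuousOn w (Icc (t₀ - δ) (t₀ + δ)) := hw1.continuousOn.mono hIcc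
  have hwd : ∀ s ∈ Icc (t₀ - δ) (t₀ + δ), HasDerivAt w (deriv w s) s := fun s hs =>
    ((hw1.differentiableOn one_ne_zero).differentiableAt
      (isOpen_Ioo.mem_nhds (hIcc hs))).hasDerivAt
  have ht₀ : t₀ ∈ Icc (t₀ - δ) (t₀ + δ) := ⟨by linarith, by linarith⟩
  have huc : ContinuousOn u (Icc (t₀ - δ) (t₀ + δ)) := by
    have h1 : ContinuousOn (fun s => u t₀ + ∫ r in t₀..s, f r) (Icc (t₀ - δ) (t₀ + δ)) := by
      have := (absolutelyContinuousOnInterval_primitive (t₀ := t₀) (y := u t₀)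
        (memLp_two_intervalIntegrable hf (left_mem_Icc.2 (by linarith))
        (right_mem_Icc.2 (by linarith))) (by rwa [uIcc_of_le (by linarith)])).continuousOn
      rwa [uIcc_of_le (by linarith)] at this
    exact h1.congr hy
  refine ⟨δ, hδ, fun s => f s * w s + u s * deriv w s, ?_, fun s hs => ?_⟩
  · refine MemLp.add ?_ (memLp_two_of_continuousOn (huc.mul hw'))
    obtain ⟨C, hC⟩ := isCompact_Icc.exists_bound_of_continuousOn hwc
    refine hf.of_le_mul (c := C) (hf.1.mul (hwc.aestronglyMeasurable measurableSet_Icc)) ?_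
    filter_upwards [ae_restrict_mem measurableSet_Icc] with s hs
    rw [norm_mul, mul_comm]
    exact mul_le_mul_of_nonneg_right (hC s hs) (norm_nonneg _)
  · have hsub : [[t₀, s]] ⊆ Icc (t₀ - δ) (t₀ + δ) := uIcc_subset_Icc ht₀ hs
    have hfi := memLp_two_intervalIntegrable hf ht₀ hs
    have hwi : IntervalIntegrable (deriv w) volume t₀ s := (hw'.mono hsub).intervalIntegrable
    have h1 := integral_mul_add_mul_of_primitive (y := u t₀) (z := w t₀) hfi hwi
    have hww : ∀ r ∈ [[t₀, s]], w t₀ + ∫ q in t₀..r, deriv w q = w r := by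
      intro r hr
      have hr' : [[t₀, r]] ⊆ Icc (t₀ - δ) (t₀ + δ) := uIcc_subset_Icc ht₀ (hsub hr)
      rw [integral_eq_sub_of_hasDerivAt (fun q hq => hwd q (hr' hq))
        (hw'.mono hr').intervalIntegrable, add_sub_cancel]
    have h2 : ∫ r in t₀..s, (f r * w r + u r * deriv w r) = u s * w s - u t₀ * w t₀ := by
      rw [← hww s right_mem_uIcc, hy s hs, ← h1]
      refine integral_congr fun r hr => ?_
      simp only [hww r hr, ← hy r (hsub hr)]
    rw [h2]
    ring

theorem smul_contDiffAt [FiniteDimensional ℝ Y] {u : ℝ → ℝ} {w : ℝ → Y} (hu : H1At u t₀)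
    (hw : ContDiffAt ℝ 1 w t₀) : H1At (fun s => u s • w s) t₀ := by
  have : CompleteSpace Y := FiniteDimensional.complete ℝ Y
  let b := Module.finBasis ℝ Y
  have h1 : ∀ i, H1At (fun s => (u s * (b.coord i).toContinuousLinearMap (w s)) • b i) t₀ :=
    fun i => (hu.mul_contDiffAt ((ContinuousLinearMap.contDiff _).contDiffAt.comp t₀ hw)).clm_comp
      (ContinuousLinearMap.toSpanSingleton ℝ (b i))
  have h2 := sum Finset.univ fun i _ => h1 i
  refine h2.congr (Eventually.of_forall fun s => ?_)
  simp only [LinearMap.coe_toContinuousLinearMap',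
    Module.Basis.coord_apply, mul_smul, ← Finset.smul_sum, b.sum_repr]

/-- The unspecified local density coincides almost everywhere with `deriv y`. This canonical choice
is what allows local primitives to be patched together. -/
theorem exists_hasL2Deriv_deriv [CompleteSpace Y] (h : H1At y t₀) : ∃ δ > 0,
    MemLp (deriv y) 2 (volume.restrict (Icc (t₀ - δ) (t₀ + δ))) ∧
    ∀ s ∈ Icc (t₀ - δ) (t₀ + δ), y s = y t₀ + ∫ r in t₀..s, deriv y r := by
  obtain ⟨δ, hδ, f, hf, hy⟩ := h
  have ht₀ : t₀ ∈ Icc (t₀ - δ) (t₀ + δ) := ⟨by linarith, by linarith⟩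
  have hle : t₀ - δ ≤ t₀ + δ := by linarith
  have hfi := memLp_two_intervalIntegrable hf (left_mem_Icc.2 hle) (right_mem_Icc.2 hle)
  -- At the two ends the integral formula holds on one side only, so they are discarded as a null
  -- set.
  have hne : ∀ a : ℝ, ∀ᵐ s : ℝ, s ≠ a := fun a => by simp [ae_iff, measure_singleton]
  have hae : ∀ᵐ s, s ∈ Icc (t₀ - δ) (t₀ + δ) → f s = deriv y s := by
    filter_upwards [hfi.ae_hasDerivAt_integral, hne (t₀ - δ), hne (t₀ + δ)] with s hs h1 h2 hsI
    rw [uIcc_of_le hle] at hs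
    have h3 := (hs hsI t₀ ht₀).const_add (y t₀)
    refine (HasDerivAt.deriv (h3.congr_of_eventuallyEq ?_)).symm
    filter_upwards [Icc_mem_nhds (lt_of_le_of_ne hsI.1 h1.symm) (lt_of_le_of_ne hsI.2 h2)] with r hr
      using hy r hr
  refine ⟨δ, hδ, hf.ae_eq ((ae_restrict_iff' measurableSet_Icc).2 hae), fun s hs => ?_⟩
  rw [hy s hs]
  congr 1
  refine intervalIntegral.integral_congr_ae ?_
  filter_upwards [hae] with r hr hr'
  exact hr (uIcc_subset_Icc ht₀ hs (uIoc_subset_uIcc hr'))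

end H1At

/-- Compactness patches local square integrability; the difference of `f` and the primitive of
`deriv f` is locally constant, hence constant. -/
theorem hasL2Deriv_of_h1At [CompleteSpace Y] {f : ℝ → Y} (h : ∀ t, H1At f t) :
    HasL2Deriv f (deriv f) := by
  choose δ hδ hmem heq using fun t => (h t).exists_hasL2Deriv_deriv
  have hL2 : ∀ a b, MemLp (deriv f) 2 (volume.restrict (Icc a b)) := by
    intro a b
    refine (isCompact_Icc (a := a) (b := b)).induction_on
      (p := fun s => MemLp (deriv f) 2 (volume.restrict s)) (by simp)
      (fun s t hst ht => memLp_two_mono hst ht) (fun s t hs ht => memLp_two_union hs ht)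
      fun t _ => ⟨Icc (t - δ t) (t + δ t), mem_nhdsWithin_of_mem_nhds
        (Icc_mem_nhds (by linarith [hδ t]) (by linarith [hδ t])), hmem t⟩
  have hint : ∀ a b, IntervalIntegrable (deriv f) volume a b := fun a b =>
    memLp_two_intervalIntegrable (hL2 (min a b) (max a b)) ⟨min_le_left _ _, le_max_left _ _⟩
      ⟨min_le_right _ _, le_max_right _ _⟩
  refine ⟨hL2, fun t => ?_⟩
  have hconst : IsLocallyConstant fun t => f t - ∫ s in (0 : ℝ)..t, deriv f s := by
    rw [IsLocallyConstant.iff_eventually_eq]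
    intro t
    filter_upwards [Icc_mem_nhds (show t - δ t < t by linarith [hδ t])
      (show t < t + δ t by linarith [hδ t])] with s hs
    rw [heq t s hs, ← integral_add_adjacent_intervals (hint 0 t) (hint t s)]
    abel
  have := hconst.apply_eq_of_isPreconnected isPreconnected_univ (mem_univ t) (mem_univ (0 : ℝ))
  simp only [integral_same, sub_zero] at this
  rw [← this, sub_add_cancel]

end Sobolev

end FinslerIndex

noncomputable section

namespace FinslerIndex

/-! ### The index form in a parallel frame -/

section Model

open MeasureTheory Set Filter intervalIntegral Module

variable {X : Type*} [NormedAddCommGroup X] [InnerProductSpace ℝ X]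

/-- The functions `f` with locally square integrable derivative such that `f (t + 1) = A (f t)`. -/
def twistedH1 [FiniteDimensional ℝ X] (A : X ≃ₗᵢ[ℝ] X) : Submodule ℝ (ℝ → X) where
  carrier := {f | HasL2Deriv f (deriv f) ∧ ∀ t, f (t + 1) = A (f t)}
  zero_mem' := ⟨HasL2Deriv.zero.deriv, fun t => by simp⟩
  add_mem' := fun {f g} hf hg => ⟨(hf.1.add hg.1).deriv, fun t => by
    rw [Pi.add_apply, Pi.add_apply, map_add, hf.2, hg.2]⟩
  smul_mem' := fun r f hf => ⟨(hf.1.const_smul r).deriv, fun t => by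
    rw [Pi.smul_apply, Pi.smul_apply, map_smul, hf.2]⟩

/-- The functions in `twistedH1 A` which vanish at `0`. -/
def twistedH1Zero [FiniteDimensional ℝ X] (A : X ≃ₗᵢ[ℝ] X) : Submodule ℝ (ℝ → X) :=
  twistedH1 A ⊓ LinearMap.ker (LinearMap.proj (0 : ℝ) : (ℝ → X) →ₗ[ℝ] X)

/-- The index form `∫₀¹ ⟨f', h'⟩ + ⟨R f, h⟩`. -/
def modelForm (R : ℝ → X →L[ℝ] X) (f h : ℝ → X) : ℝ :=
  ∫ t in (0 : ℝ)..1, (inner ℝ (deriv f t) (deriv h t) + inner ℝ (R t (f t)) (h t))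

/-- The solutions of `J'' = R J`. -/
def modelJacobi (R : ℝ → X →L[ℝ] X) : Submodule ℝ (ℝ → X) where
  carrier := {J | (∀ t, DifferentiableAt ℝ J t) ∧ ∀ t, HasDerivAt (deriv J) (R t (J t)) t}
  zero_mem' := ⟨fun t => differentiableAt_const 0, fun t => by
    have : deriv (0 : ℝ → X) = fun _ => 0 := funext fun t => deriv_const t 0
    rw [this, Pi.zero_apply, map_zero]
    exact hasDerivAt_const t 0⟩
  add_mem' := fun {J K} hJ hK => ⟨fun t => (hJ.1 t).add (hK.1 t), fun t => by
    have : deriv (J + K) = deriv J + deriv K := funext fun t => deriv_add (hJ.1 t) (hK.1 t)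
    rw [this, Pi.add_apply, map_add]
    exact (hJ.2 t).add (hK.2 t)⟩
  smul_mem' := fun r J hJ => ⟨fun t => (hJ.1 t).const_smul r, fun t => by
    have : deriv (r • J) = r • deriv J := funext fun t => deriv_const_smul r (hJ.1 t)
    rw [this, Pi.smul_apply, map_smul]
    exact (hJ.2 t).const_smul r⟩

variable {R : ℝ → X →L[ℝ] X} {A : X ≃ₗᵢ[ℝ] X}

theorem deriv_add_of_mem {J K : ℝ → X} (hJ : J ∈ modelJacobi R) (hK : K ∈ modelJacobi R) (t : ℝ) :
    deriv (J + K) t = deriv J t + deriv K t := deriv_add (hJ.1 t) (hK.1 t)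

theorem deriv_smul_of_mem {J : ℝ → X} (hJ : J ∈ modelJacobi R) (r t : ℝ) :
    deriv (r • J) t = r • deriv J t := deriv_const_smul r (hJ.1 t)

/-- The elements `J` of `modelJacobi R` with `J 1 = A (J 0)`. -/
def modelJacobiClosed (R : ℝ → X →L[ℝ] X) (A : X ≃ₗᵢ[ℝ] X) : Submodule ℝ (ℝ → X) where
  carrier := {J | J ∈ modelJacobi R ∧ J 1 = A (J 0)}
  zero_mem' := ⟨zero_mem _, by simp⟩
  add_mem' := fun hJ hK => ⟨add_mem hJ.1 hK.1, by
    rw [Pi.add_apply, Pi.add_apply, map_add, hJ.2, hK.2]⟩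
  smul_mem' := fun r _ hJ => ⟨(modelJacobi R).smul_mem r hJ.1, by
    rw [Pi.smul_apply, Pi.smul_apply, map_smul, hJ.2]⟩

/-- The elements `J` of `modelJacobi R` with `J 1 = A (J 0)` and `J' 1 = A (J' 0)`. -/
def modelJacobiPeriodic (R : ℝ → X →L[ℝ] X) (A : X ≃ₗᵢ[ℝ] X) : Submodule ℝ (ℝ → X) where
  carrier := {J | J ∈ modelJacobi R ∧ J 1 = A (J 0) ∧ deriv J 1 = A (deriv J 0)}
  zero_mem' := ⟨zero_mem _, by simp, by
    have : deriv (0 : ℝ → X) = fun _ => 0 := funext fun t => deriv_const t 0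
    simp [this]⟩
  add_mem' := fun hJ hK => ⟨add_mem hJ.1 hK.1, by
    rw [Pi.add_apply, Pi.add_apply, map_add, hJ.2.1, hK.2.1], by
    rw [deriv_add_of_mem hJ.1 hK.1, deriv_add_of_mem hJ.1 hK.1, map_add, hJ.2.2, hK.2.2]⟩
  smul_mem' := fun r _ hJ => ⟨(modelJacobi R).smul_mem r hJ.1, by
    rw [Pi.smul_apply, Pi.smul_apply, map_smul, hJ.2.1], by
    rw [deriv_smul_of_mem hJ.1, deriv_smul_of_mem hJ.1, map_smul, hJ.2.2]⟩

/-- The elements of `modelJacobi R` which vanish at `0` and at `1`. -/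
def modelJacobiZero (R : ℝ → X →L[ℝ] X) : Submodule ℝ (ℝ → X) where
  carrier := {J | J ∈ modelJacobi R ∧ J 0 = 0 ∧ J 1 = 0}
  zero_mem' := ⟨zero_mem _, rfl, rfl⟩
  add_mem' := fun hJ hK => ⟨add_mem hJ.1 hK.1, by
    rw [Pi.add_apply, hJ.2.1, hK.2.1, add_zero], by
    rw [Pi.add_apply, hJ.2.2, hK.2.2, add_zero]⟩
  smul_mem' := fun r _ hJ => ⟨(modelJacobi R).smul_mem r hJ.1, by
    rw [Pi.smul_apply, hJ.2.1, smul_zero], by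
    rw [Pi.smul_apply, hJ.2.2, smul_zero]⟩

/-- The form `⟨A⁻¹ J₁'(1) - J₁'(0), J₂(0)⟩`. -/
def modelClosingForm (A : X ≃ₗᵢ[ℝ] X) (J₁ J₂ : ℝ → X) : ℝ :=
  inner ℝ (A.symm (deriv J₁ 1) - deriv J₁ 0) (J₂ 0)

/-! #### Twisted periodic extension -/

/-- The extension of the restriction of a function to `[0,1)` to a function with
`f (t + 1) = A (f t)`. -/
def twist (A : X ≃ₗᵢ[ℝ] X) : (ℝ → X) →ₗ[ℝ] (ℝ → X) where
  toFun f t := (A ^ ⌊t⌋) (f (Int.fract t))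
  map_add' f g := funext fun t => by simp
  map_smul' r f := funext fun t => by simp

theorem twist_apply (A : X ≃ₗᵢ[ℝ] X) (f : ℝ → X) (t : ℝ) :
    twist A f t = (A ^ ⌊t⌋) (f (Int.fract t)) := rfl

theorem twist_of_mem {f : ℝ → X} {t : ℝ} (ht : t ∈ Ico (0 : ℝ) 1) : twist A f t = f t := by
  rw [twist_apply, Int.floor_eq_zero_iff.2 ht, Int.fract_eq_self.2 ht, zpow_zero]
  rfl

theorem twist_zero_apply (f : ℝ → X) : twist A f 0 = f 0 := twist_of_mem ⟨le_rfl, one_pos⟩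

theorem eq_zpow_of_add_one {g : ℝ → X} (h : ∀ t, g (t + 1) = A (g t)) (k : ℤ) (t : ℝ) :
    g (t + k) = (A ^ k) (g t) := by
  induction k using Int.induction_on with
  | zero => simp
  | succ k ih =>
    rw [Int.cast_add, Int.cast_one, ← add_assoc, h, ih, add_comm, zpow_one_add]
    rfl
  | pred k ih =>
    have h1 := h (t + ((-k - 1 : ℤ) : ℝ))
    have h2 : t + ((-k - 1 : ℤ) : ℝ) + 1 = t + ((-k : ℤ) : ℝ) := by push_cast; ring
    rw [h2, ih] at h1
    apply A.injective
    rw [← h1]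
    change _ = (A * A ^ (-(k : ℤ) - 1)) (g t)
    rw [← zpow_one_add]
    congr 2
    ring

theorem twist_eq_of_eqOn {f g : ℝ → X} (hg : ∀ t, g (t + 1) = A (g t))
    (hfg : EqOn f g (Ico 0 1)) : twist A f = g := by
  funext t
  rw [twist_apply, hfg ⟨Int.fract_nonneg t, Int.fract_lt_one t⟩, ← eq_zpow_of_add_one hg]
  congr 1
  exact Int.fract_add_floor t

theorem twist_add_one (f : ℝ → X) (t : ℝ) : twist A f (t + 1) = A (twist A f t) := by
  rw [twist_apply, twist_apply, Int.floor_add_one, Int.fract_add_one, add_comm, zpow_one_add]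
  rfl

/-- On `[k, k + 1)` the twisted extension is `A ^ k` applied to a translate of `φ`, and finitely
many such intervals cover `[a, b]`. -/
theorem memLp_twist {φ : ℝ → X} (hφ : ∀ a b, MemLp φ 2 (volume.restrict (Icc a b))) (a b : ℝ) :
    MemLp (twist A φ) 2 (volume.restrict (Icc a b)) := by
  have hk : ∀ k : ℤ, MemLp (twist A φ) 2 (volume.restrict (Ico (k : ℝ) (k + 1))) := by
    intro k
    have h1 : MemLp φ 2 (volume.restrict (Ico (0 : ℝ) 1)) :=
      memLp_two_mono Ico_subset_Icc_self (hφ 0 1)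
    have h2 : MeasurePreserving (fun t : ℝ => t - k) (volume.restrict (Ico (k : ℝ) (k + 1)))
        (volume.restrict (Ico (0 : ℝ) 1)) := by
      have := (measurePreserving_sub_right volume (k : ℝ)).restrict_preimage
        (measurableSet_Ico (a := (0 : ℝ)) (b := 1))
      convert this using 2
      ext t
      simp only [mem_Ico, mem_preimage]
      constructor <;> rintro ⟨h1, h2⟩ <;> constructor <;> linarith
    have h3 := ((A ^ k).toContinuousLinearEquiv.toContinuousLinearMap).comp_memLp'
      (h1.comp_measurePreserving h2)
    refine h3.ae_eq ?_
    filter_upwards [ae_restrict_mem measurableSet_Ico] with t ht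
    have hfl : ⌊t⌋ = k := Int.floor_eq_iff.2 ht
    rw [twist_apply, Int.fract, hfl]
    rfl
  have hn : ∀ n : ℕ, MemLp (twist A φ) 2
      (volume.restrict (Ico ((⌊a⌋ : ℤ) : ℝ) ((⌊a⌋ + n : ℤ) : ℝ))) := by
    intro n
    induction n with
    | zero => simp
    | succ n ih =>
      have := memLp_two_union ih (hk (⌊a⌋ + n))
      rwa [Ico_union_Ico_eq_Ico (by push_cast; linarith [n.cast_nonneg (α := ℝ)]) (by linarith),
        show (((⌊a⌋ + n : ℤ) : ℝ) + 1) = ((⌊a⌋ + (n + 1 : ℕ) : ℤ) : ℝ) by push_cast; ring] at this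
  obtain ⟨n, hnb⟩ := exists_nat_gt (b - ⌊a⌋)
  have hsub : Icc a b ⊆ Ico ((⌊a⌋ : ℤ) : ℝ) ((⌊a⌋ + n : ℤ) : ℝ) := fun t ht =>
    ⟨(Int.floor_le a).trans ht.1, by push_cast; linarith [ht.2]⟩
  exact memLp_two_mono hsub (hn n)

theorem integral_congr_of_eqOn_Ioo {Y : Type*} [NormedAddCommGroup Y] [NormedSpace ℝ Y]
    {f g : ℝ → Y} {a b : ℝ} (hab : a ≤ b) (h : EqOn f g (Ioo a b)) :
    ∫ t in a..b, f t = ∫ t in a..b, g t := by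
  rw [integral_of_le hab, integral_of_le hab, integral_Ioc_eq_integral_Ioo,
    integral_Ioc_eq_integral_Ioo]
  exact setIntegral_congr_fun measurableSet_Ioo h

/-- The condition `f 1 = A (f 0)` makes the extension continuous at the integers. The primitive of
the twisted density, started at `f 0`, satisfies the twisted periodicity and equals `f` on `[0,1]`,
so it is the extension of `f`. -/
theorem HasL2Deriv.twist [FiniteDimensional ℝ X] {f φ : ℝ → X} (H : HasL2Deriv f φ)
    (h1 : f 1 = A (f 0)) :
    HasL2Deriv (twist A f) (FinslerIndex.twist A φ) := by
  set ψ := FinslerIndex.twist A φ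
  have hψ : ∀ a b, MemLp ψ 2 (volume.restrict (Icc a b)) := memLp_twist H.memLp
  set g := fun t => f 0 + ∫ s in (0 : ℝ)..t, ψ s
  have Hg : HasL2Deriv g ψ := HasL2Deriv.of_integral hψ (f 0)
  have hgf : ∀ t ∈ Icc (0 : ℝ) 1, g t = f t := by
    intro t ht
    rw [H.eq_integral t]
    simp only [g]
    congr 1
    refine integral_congr_of_eqOn_Ioo ht.1 fun s hs => ?_
    have hs' : s ∈ Ico (0 : ℝ) 1 := ⟨hs.1.le, hs.2.trans_le ht.2⟩
    exact twist_of_mem hs'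
  have hg1 : ∀ t, g (t + 1) = A (g t) := by
    intro t
    have e1 : g (t + 1) - g 1 = ∫ s in (1 : ℝ)..(t + 1), ψ s := Hg.sub_eq 1 (t + 1)
    have e2 : g t - g 0 = ∫ s in (0 : ℝ)..t, ψ s := Hg.sub_eq 0 t
    have e3 : ∫ s in (1 : ℝ)..(t + 1), ψ s = A (∫ s in (0 : ℝ)..t, ψ s) := by
      have := integral_comp_add_right (a := 0) (b := t) ψ 1
      rw [zero_add] at this
      rw [← this]
      have h4 := (A.toContinuousLinearEquiv.toContinuousLinearMap).intervalIntegral_comp_comm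
        (Hg.intervalIntegrable 0 t)
      refine Eq.trans ?_ h4
      refine integral_congr fun s _ => ?_
      exact twist_add_one φ s
    rw [e3, ← e2, map_sub, hgf 1 ⟨zero_le_one, le_rfl⟩, hgf 0 ⟨le_rfl, zero_le_one⟩, h1] at e1
    exact sub_left_injective e1
  rw [twist_eq_of_eqOn hg1 fun t ht => (hgf t ⟨ht.1, ht.2.le⟩).symm]
  exact Hg

theorem twist_mem [FiniteDimensional ℝ X] {f φ : ℝ → X} (H : HasL2Deriv f φ)
    (h1 : f 1 = A (f 0)) :
    twist A f ∈ twistedH1 A :=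
  ⟨(H.twist h1).deriv, twist_add_one f⟩

theorem eq_twist_of_mem [FiniteDimensional ℝ X] {f g : ℝ → X} (hg : g ∈ twistedH1 A)
    (hfg : EqOn f g (Ico 0 1)) :
    twist A f = g := twist_eq_of_eqOn hg.2 hfg

/-! #### The index form -/

theorem intervalIntegrable_modelForm (hR : Continuous R) {f φ h χ : ℝ → X} (Hf : HasL2Deriv f φ)
    (Hh : HasL2Deriv h χ) (a b : ℝ) :
    IntervalIntegrable (fun t => inner ℝ (φ t) (χ t) + inner ℝ (R t (f t)) (h t)) volume a b := by
  refine IntervalIntegrable.add ?_ ?_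
  · have h1 := integrableOn_inner_of_memLp (Hf.memLp (min a b) (max a b))
      (Hh.memLp (min a b) (max a b))
    exact h1.intervalIntegrable
  · exact ((hR.clm_apply Hf.continuous).inner Hh.continuous).intervalIntegrable _ _

theorem modelForm_eq [CompleteSpace X] {f φ h χ : ℝ → X} (Hf : HasL2Deriv f φ)
    (Hh : HasL2Deriv h χ) :
    modelForm R f h = ∫ t in (0 : ℝ)..1, (inner ℝ (φ t) (χ t) + inner ℝ (R t (f t)) (h t)) := by
  refine intervalIntegral.integral_congr_ae ?_
  filter_upwards [Hf.deriv_ae_eq, Hh.deriv_ae_eq] with t h1 h2 _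
  rw [h1, h2]

theorem modelForm_add_left [FiniteDimensional ℝ X] (hR : Continuous R) {f g h : ℝ → X}
    (hf : f ∈ twistedH1 A)
    (hg : g ∈ twistedH1 A) (hh : h ∈ twistedH1 A) :
    modelForm R (f + g) h = modelForm R f h + modelForm R g h := by
  rw [show f + g = fun t => f t + g t from rfl, modelForm_eq (hf.1.add hg.1) hh.1,
    modelForm, modelForm,
    ← integral_add (intervalIntegrable_modelForm hR hf.1 hh.1 0 1)
    (intervalIntegrable_modelForm hR hg.1 hh.1 0 1)]
  refine integral_congr fun t _ => ?_
  simp only [map_add, inner_add_left]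
  ring

theorem modelForm_smul_left [FiniteDimensional ℝ X] {f h : ℝ → X} (r : ℝ) (hf : f ∈ twistedH1 A)
    (hh : h ∈ twistedH1 A) : modelForm R (r • f) h = r * modelForm R f h := by
  rw [show r • f = fun t => r • f t from rfl, modelForm_eq (hf.1.const_smul r) hh.1,
    modelForm, ← intervalIntegral.integral_const_mul]
  refine integral_congr fun t _ => ?_
  simp only [map_smul, real_inner_smul_left]
  ring

theorem modelForm_comm (hs : ∀ t x y, inner ℝ (R t x) y = inner ℝ x (R t y)) (f h : ℝ → X) :
    modelForm R f h = modelForm R h f := by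
  refine integral_congr fun t _ => ?_
  rw [hs, real_inner_comm, real_inner_comm (R t (h t))]

/-- The index form as a bilinear form on `twistedH1 A`. -/
def modelBilin [FiniteDimensional ℝ X] (A : X ≃ₗᵢ[ℝ] X) (hR : Continuous R)
    (hs : ∀ t x y, inner ℝ (R t x) y = inner ℝ x (R t y)) :
    LinearMap.BilinForm ℝ (twistedH1 A) :=
  LinearMap.mk₂ ℝ (fun f h => modelForm R f h)
    (fun f g h => modelForm_add_left hR f.2 g.2 h.2)
    (fun r f h => modelForm_smul_left r f.2 h.2)
    (fun f g h => by
      rw [modelForm_comm hs, modelForm_comm hs (f : ℝ → X), modelForm_comm hs (f : ℝ → X)]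
      exact modelForm_add_left hR g.2 h.2 f.2)
    (fun r f h => by
      rw [modelForm_comm hs, modelForm_comm hs (f : ℝ → X)]
      exact modelForm_smul_left r h.2 f.2)

/-- A Poincaré inequality. -/
theorem integral_sq_norm_le [CompleteSpace X] {f φ : ℝ → X} (H : HasL2Deriv f φ)
    {a b : ℝ} (hab : a < b)
    (ha : f a = 0) :
    ∫ t in a..b, ‖f t‖ ^ 2 ≤ (b - a) ^ 2 * ∫ t in a..b, ‖φ t‖ ^ 2 := by
  have hφ : IntervalIntegrable (fun t => ‖φ t‖) volume a b := (H.intervalIntegrable a b).norm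
  have hφ2 : IntervalIntegrable (fun t => ‖φ t‖ ^ 2) volume a b := by
    have h1 : IntegrableOn (fun t => ‖φ t‖ ^ 2) (Icc a b) :=
      (memLp_two_iff_integrable_sq_norm (H.memLp a b).1).1 (H.memLp a b)
    rw [← uIcc_of_le hab.le] at h1
    exact h1.intervalIntegrable
  set s := ∫ t in a..b, ‖φ t‖
  set q := ∫ t in a..b, ‖φ t‖ ^ 2
  have hs : s ^ 2 ≤ (b - a) * q := by
    -- Cauchy–Schwarz, by expanding the nonnegative integral of `(‖φ‖ - l) ^ 2` with `l` the mean of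
    -- `‖φ‖`.
    set l := s / (b - a)
    have h0 : 0 ≤ ∫ t in a..b, (‖φ t‖ - l) ^ 2 :=
      integral_nonneg hab.le fun t _ => sq_nonneg _
    have h1 : ∫ t in a..b, (‖φ t‖ - l) ^ 2 = q - 2 * l * s + l ^ 2 * (b - a) := by
      have : (fun t => (‖φ t‖ - l) ^ 2) = fun t => ‖φ t‖ ^ 2 - 2 * l * ‖φ t‖ + l ^ 2 := by
        funext t; ring
      rw [this, integral_add (hφ2.sub (hφ.const_mul _)) (by simp), integral_sub hφ2
        (hφ.const_mul _), intervalIntegral.integral_const_mul, intervalIntegral.integral_const,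
        smul_eq_mul]
      ring
    have h2 : l * (b - a) = s := div_mul_cancel₀ s (by linarith)
    rw [h1] at h0
    have hba : 0 < b - a := by linarith
    nlinarith
  have hpt : ∀ t ∈ Icc a b, ‖f t‖ ^ 2 ≤ (b - a) * q := by
    intro t ht
    refine le_trans ?_ hs
    have h1 : f t = ∫ r in a..t, φ r := by rw [← H.sub_eq, ha, sub_zero]
    have h2 : ‖f t‖ ≤ s := by
      rw [h1]
      refine (intervalIntegral.norm_integral_le_integral_norm ht.1).trans ?_
      exact integral_mono_interval le_rfl ht.1 ht.2
        (Eventually.of_forall fun _ => norm_nonneg _) hφ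
    exact pow_le_pow_left₀ (norm_nonneg _) h2 2
  calc ∫ t in a..b, ‖f t‖ ^ 2 ≤ ∫ _ in a..b, (b - a) * q :=
        integral_mono_on hab.le ((H.continuous.norm.pow 2).intervalIntegrable _ _) (by simp) hpt
    _ = (b - a) ^ 2 * q := by
        rw [intervalIntegral.integral_const, smul_eq_mul]; ring

/-- Choose `m` larger than `sup ‖R‖` on `[0,1]` and than `1`. On each mesh interval the potential
term is at least `-m ∫ ‖f‖²`, and as `f` vanishes at the left end, Poincaré bounds `m ∫ ‖f‖²` by
`(1/m) ∫ ‖φ‖² ≤ ∫ ‖φ‖²`. Vanishing at the left ends suffices, whence `Fin m`. -/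
theorem modelForm_self_nonneg [CompleteSpace X] (hR : Continuous R) :
    ∃ m : ℕ, ∀ f φ : ℝ → X, HasL2Deriv f φ → (∀ k : Fin m, f ((k : ℕ) / (m : ℝ)) = 0) →
      0 ≤ modelForm R f f := by
  obtain ⟨C, hC⟩ := (isCompact_Icc (a := (0 : ℝ)) (b := 1)).exists_bound_of_continuousOn
    hR.continuousOn
  obtain ⟨m, hm⟩ := exists_nat_gt (max C 1)
  have hm1 : (1 : ℝ) < m := (le_max_right _ _).trans_lt hm
  have hmC : C ≤ m := (le_max_left _ _).trans hm.le
  have hm0 : (0 : ℝ) < m := by linarith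
  refine ⟨m, fun f φ H hf => ?_⟩
  rw [modelForm_eq H H]
  set F := fun t => inner ℝ (φ t) (φ t) + inner ℝ (R t (f t)) (f t)
  have hint : ∀ a b, IntervalIntegrable F volume a b := intervalIntegrable_modelForm hR H H
  have hsum : ∑ k ∈ Finset.range m, ∫ t in ((k : ℕ) / (m : ℝ))..(((k + 1 : ℕ) : ℝ) / m), F t =
      ∫ t in (0 : ℝ)..1, F t := by
    have := sum_integral_adjacent_intervals (f := F) (μ := volume)
      (a := fun k : ℕ => (k : ℝ) / m) (n := m) fun k _ => hint _ _
    simpa [div_self hm0.ne'] using this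
  rw [← hsum]
  refine Finset.sum_nonneg fun k hk => ?_
  have hkm : k < m := Finset.mem_range.1 hk
  set a := (k : ℝ) / m
  set b := ((k + 1 : ℕ) : ℝ) / m
  have hba : b - a = 1 / m := by simp only [a, b]; push_cast; ring
  have hab : a < b := by have : 0 < 1 / (m : ℝ) := by positivity
                         linarith
  have ha0 : 0 ≤ a := by positivity
  have hb1 : b ≤ 1 := by
    rw [div_le_one hm0]
    exact_mod_cast hkm
  have hφ2 : IntervalIntegrable (fun t => ‖φ t‖ ^ 2) volume a b := by
    have h1 : IntegrableOn (fun t => ‖φ t‖ ^ 2) (Icc a b) :=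
      (memLp_two_iff_integrable_sq_norm (H.memLp a b).1).1 (H.memLp a b)
    rw [← uIcc_of_le hab.le] at h1
    exact h1.intervalIntegrable
  have hf2 : IntervalIntegrable (fun t => (m : ℝ) * ‖f t‖ ^ 2) volume a b :=
    (continuous_const.mul (H.continuous.norm.pow 2)).intervalIntegrable _ _
  have h1 : ∫ t in a..b, (‖φ t‖ ^ 2 - m * ‖f t‖ ^ 2) ≤ ∫ t in a..b, F t := by
    refine integral_mono_on hab.le (hφ2.sub hf2) (hint a b) fun t ht => ?_
    have h2 : ‖R t‖ ≤ m := (hC t ⟨ha0.trans ht.1, ht.2.trans hb1⟩).trans hmC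
    have h3 : -(‖R t (f t)‖ * ‖f t‖) ≤ inner ℝ (R t (f t)) (f t) :=
      neg_le_of_abs_le (abs_real_inner_le_norm _ _)
    have h4 : ‖R t (f t)‖ * ‖f t‖ ≤ m * ‖f t‖ ^ 2 := by
      rw [pow_two, ← mul_assoc]
      exact mul_le_mul_of_nonneg_right (((R t).le_opNorm _).trans
        (mul_le_mul_of_nonneg_right h2 (norm_nonneg _))) (norm_nonneg _)
    simp only [F, real_inner_self_eq_norm_sq]
    linarith
  refine le_trans ?_ h1
  rw [integral_sub hφ2 hf2, intervalIntegral.integral_const_mul]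
  have h5 := integral_sq_norm_le H hab (hf ⟨k, hkm⟩)
  have h6 : 0 ≤ ∫ t in a..b, ‖φ t‖ ^ 2 := integral_nonneg hab.le fun t _ => sq_nonneg _
  rw [hba] at h5
  have h7 : (m : ℝ) * ∫ t in a..b, ‖f t‖ ^ 2 ≤ ∫ t in a..b, ‖φ t‖ ^ 2 := by
    calc (m : ℝ) * ∫ t in a..b, ‖f t‖ ^ 2 ≤ m * ((1 / m) ^ 2 * ∫ t in a..b, ‖φ t‖ ^ 2) :=
          mul_le_mul_of_nonneg_left h5 hm0.le
      _ = (1 / m) * ∫ t in a..b, ‖φ t‖ ^ 2 := by field_simp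
      _ ≤ 1 * ∫ t in a..b, ‖φ t‖ ^ 2 := by
          refine mul_le_mul_of_nonneg_right ?_ h6
          rw [div_le_one hm0]; exact hm1.le
      _ = _ := one_mul _
  linarith

/-- The form is nonnegative on the kernel of evaluation at the `m` mesh points, whose target is
finite dimensional. -/
theorem negIndex_twistedH1_ne_top [FiniteDimensional ℝ X] (A : X ≃ₗᵢ[ℝ] X) (hR : Continuous R) :
    negIndex (twistedH1 A) (modelForm R) ≠ ⊤ := by
  obtain ⟨m, hm⟩ := modelForm_self_nonneg hR
  let ev : (ℝ → X) →ₗ[ℝ] (Fin m → X) := LinearMap.pi fun k => LinearMap.proj ((k : ℕ) / (m : ℝ))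
  refine ne_top_of_le_ne_top (ENat.natCast_ne_top _)
    (negIndex_le_of_nonneg_on_ker ev fun f hf h0 => hm f _ hf.1 fun k => ?_)
  exact congrFun h0 k

end Model

end FinslerIndex

end

noncomputable section

namespace FinslerIndex

/-! ### Jacobi fields in a parallel frame: boundary value problem, weak solutions and the index
formula. -/

section ModelIndex

open MeasureTheory Set Filter intervalIntegral Module

variable {X : Type*} [NormedAddCommGroup X] [InnerProductSpace ℝ X]
  {R : ℝ → X →L[ℝ] X} {A : X ≃ₗᵢ[ℝ] X}

/-! #### Solutions of `J'' = R J` -/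

/-- The first order system equivalent to `J'' = R J`. -/
def jacobiSystem (R : ℝ → X →L[ℝ] X) (t : ℝ) : X × X →L[ℝ] X × X :=
  (ContinuousLinearMap.snd ℝ X X).prod ((R t).comp (ContinuousLinearMap.fst ℝ X X))

theorem jacobiSystem_apply (t : ℝ) (p : X × X) : jacobiSystem R t p = (p.2, R t p.1) := rfl

theorem continuous_jacobiSystem (hR : Continuous R) : Continuous (jacobiSystem R) := by
  have h1 : Continuous fun t => (R t).comp (ContinuousLinearMap.fst ℝ X X) :=
    hR.clm_comp continuous_const
  have h2 : Continuous fun t => (ContinuousLinearMap.inl ℝ X X).comp (ContinuousLinearMap.snd ℝ X X)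
      + (ContinuousLinearMap.inr ℝ X X).comp ((R t).comp (ContinuousLinearMap.fst ℝ X X)) :=
    continuous_const.add (continuous_const.clm_comp h1)
  convert h2 using 2 with t
  ext p <;> simp [jacobiSystem]

theorem hasDerivAt_jacobiSystem {J : ℝ → X} (hJ : J ∈ modelJacobi R) (t : ℝ) :
    HasDerivAt (fun t => (J t, deriv J t)) (jacobiSystem R t (J t, deriv J t)) t :=
  (hJ.1 t).hasDerivAt.prodMk (hJ.2 t)

theorem exists_modelJacobi [CompleteSpace X] (hR : Continuous R) (s : ℝ) (a b : X) :
    ∃ J ∈ modelJacobi R, J s = a ∧ deriv J s = b := by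
  obtain ⟨α, h0, hα⟩ := exists_linear_ode
    ((continuous_jacobiSystem hR).comp (continuous_add_const s)) (a, b)
  have h1 : ∀ t, HasDerivAt (fun t => α (t - s)) (jacobiSystem R t (α (t - s))) t := by
    intro t
    have := (hα (t - s)).scomp t ((hasDerivAt_id t).sub_const s)
    simpa [Function.comp_def] using this
  have h2 : ∀ t, HasDerivAt (fun t => (α (t - s)).1) (α (t - s)).2 t := fun t =>
    (ContinuousLinearMap.fst ℝ X X).hasFDerivAt.comp_hasDerivAt t (h1 t)
  have h3 : deriv (fun t => (α (t - s)).1) = fun t => (α (t - s)).2 := funext fun t => (h2 t).deriv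
  refine ⟨fun t => (α (t - s)).1, ⟨fun t => (h2 t).differentiableAt, fun t => ?_⟩, ?_, ?_⟩
  · rw [h3]
    exact (ContinuousLinearMap.snd ℝ X X).hasFDerivAt.comp_hasDerivAt t (h1 t)
  · simp [h0]
  · simp [h3, h0]

theorem eq_zero_of_mem_modelJacobi (hR : Continuous R) {J : ℝ → X} (hJ : J ∈ modelJacobi R)
    {s : ℝ} (h0 : J s = 0) (h1 : deriv J s = 0) : J = 0 := by
  funext t
  have key := linear_ode_unique_Ioo (a := min s t - 1) (b := max s t + 1) (s := s)
    (continuous_jacobiSystem hR).continuousOn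
    ⟨by linarith [min_le_left s t], by linarith [le_max_left s t]⟩
    (fun t _ => hasDerivAt_jacobiSystem hJ t)
    (fun t _ => hasDerivAt_jacobiSystem (zero_mem (modelJacobi R)) t)
    (by
      have h2 : deriv (0 : ℝ → X) s = 0 := deriv_const s 0
      rw [h0, h1, h2, Pi.zero_apply])
  have := key (x := t) ⟨by linarith [min_le_right s t], by linarith [le_max_right s t]⟩
  exact congrArg Prod.fst this

/-- The Cauchy data at `0` of a solution of `J'' = R J`. -/
def cauchyData (R : ℝ → X →L[ℝ] X) : modelJacobi R →ₗ[ℝ] X × X where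
  toFun J := ((J : ℝ → X) 0, deriv (J : ℝ → X) 0)
  map_add' J K := Prod.ext rfl (deriv_add_of_mem J.2 K.2 0)
  map_smul' r J := Prod.ext rfl (deriv_smul_of_mem J.2 r 0)

theorem cauchyData_injective (hR : Continuous R) : Function.Injective (cauchyData R) := by
  rw [← LinearMap.ker_eq_bot, LinearMap.ker_eq_bot']
  intro J hJ
  exact Subtype.ext (eq_zero_of_mem_modelJacobi hR J.2 (congrArg Prod.fst hJ)
    (congrArg Prod.snd hJ))

theorem finiteDimensional_modelJacobi [FiniteDimensional ℝ X] (hR : Continuous R) :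
    FiniteDimensional ℝ (modelJacobi R) :=
  Module.Finite.of_injective _ (cauchyData_injective hR)

theorem modelJacobiZero_le : modelJacobiZero R ≤ modelJacobi R := fun _ h => h.1

theorem finrank_modelJacobiZero_le [FiniteDimensional ℝ X] (hR : Continuous R) :
    finrank ℝ (modelJacobiZero R) ≤ finrank ℝ X := by
  let g : modelJacobiZero R →ₗ[ℝ] X :=
    (LinearMap.snd ℝ X X ∘ₗ cauchyData R) ∘ₗ Submodule.inclusion modelJacobiZero_le
  refine LinearMap.finrank_le_finrank_of_injective (f := g) ?_
  rw [← LinearMap.ker_eq_bot, LinearMap.ker_eq_bot']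
  rintro ⟨J, hJ⟩ h0
  exact Subtype.ext (eq_zero_of_mem_modelJacobi hR hJ.1 hJ.2.1 h0)

theorem HasL2Deriv.of_mem_modelJacobi [CompleteSpace X] {J : ℝ → X} (hJ : J ∈ modelJacobi R) :
    HasL2Deriv J (_root_.deriv J) :=
  HasL2Deriv.of_hasDerivAt (fun t => (hJ.1 t).hasDerivAt)
    (continuous_iff_continuousAt.2 fun t => (hJ.2 t).continuousAt)

theorem HasL2Deriv.deriv_of_mem_modelJacobi [CompleteSpace X] (hR : Continuous R) {J : ℝ → X}
    (hJ : J ∈ modelJacobi R) : HasL2Deriv (_root_.deriv J) (fun t => R t (J t)) :=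
  HasL2Deriv.of_hasDerivAt hJ.2
    (hR.clm_apply (continuous_iff_continuousAt.2 fun t => (hJ.1 t).continuousAt))

/-- The twisted extension remembers `J` on `[0,1)` only, but the Cauchy data at the interior point
`1/2` already determine `J`. -/
theorem zero_of_twist_eq_zero (hR : Continuous R) {J : ℝ → X} (hJ : J ∈ modelJacobi R)
    (h : twist A J = 0) : J = 0 := by
  have h0 : ∀ t ∈ Ico (0 : ℝ) 1, J t = 0 := fun t ht => by rw [← twist_of_mem (A := A) (f := J) ht, h]; rfl
  have hev : J =ᶠ[𝓝 (1 / 2 : ℝ)] fun _ => 0 := by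
    filter_upwards [Ioo_mem_nhds (show (0 : ℝ) < 1 / 2 by norm_num)
      (show (1 / 2 : ℝ) < 1 by norm_num)] with t ht
    exact h0 t ⟨ht.1.le, ht.2⟩
  exact eq_zero_of_mem_modelJacobi hR hJ hev.eq_of_nhds (by rw [hev.deriv_eq, deriv_const])

/-- On `(0,1)` the integrand is the derivative of `⟨J', h⟩`. The boundary term at `1` involves the
derivative of the Jacobi field `J` itself: the twisted extension may have a corner there. -/
theorem modelForm_twist [FiniteDimensional ℝ X] (hR : Continuous R) {J h : ℝ → X}
    (hJ : J ∈ modelJacobi R) (hh : h ∈ twistedH1 A) :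
    modelForm R (twist A J) h = inner ℝ (deriv J 1) (h 1) - inner ℝ (deriv J 0) (h 0) := by
  have hcomm := (HasL2Deriv.deriv_of_mem_modelJacobi hR hJ).integral_inner_add_inner hh.1 0 1
  rw [← hcomm]
  refine integral_congr_of_eqOn_Ioo zero_le_one fun t ht => ?_
  have hev : twist A J =ᶠ[𝓝 t] J := by
    filter_upwards [Ioo_mem_nhds ht.1 ht.2] with s hs
    exact twist_of_mem ⟨hs.1.le, hs.2⟩
  simp only [hev.deriv_eq, hev.eq_of_nhds]
  ring

/-- The Wronskian of two solutions of `J'' = R J` is constant. -/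
theorem wronskian_const (hs : ∀ t x y, inner ℝ (R t x) y = inner ℝ x (R t y)) {J K : ℝ → X}
    (hJ : J ∈ modelJacobi R) (hK : K ∈ modelJacobi R) (s t : ℝ) :
    inner ℝ (deriv J s) (K s) - inner ℝ (J s) (deriv K s) =
      inner ℝ (deriv J t) (K t) - inner ℝ (J t) (deriv K t) := by
  have hd : ∀ r, HasDerivAt (fun r => inner ℝ (deriv J r) (K r) - inner ℝ (J r) (deriv K r)) 0 r := by
    intro r
    have := ((hJ.2 r).inner ℝ (hK.1 r).hasDerivAt).sub ((hJ.1 r).hasDerivAt.inner ℝ (hK.2 r))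
    refine this.congr_deriv ?_
    rw [hs]
    ring
  exact is_const_of_deriv_eq_zero (fun r => (hd r).differentiableAt) (fun r => (hd r).deriv) s t

/-- The Fredholm alternative for the boundary value problem for `J'' = R J`. -/
theorem exists_modelJacobi_boundary [FiniteDimensional ℝ X] (hR : Continuous R)
    (hs : ∀ t x y, inner ℝ (R t x) y = inner ℝ x (R t y)) (a b : X)
    (h : ∀ K ∈ modelJacobiZero R, inner ℝ (deriv K 1) b = inner ℝ (deriv K 0) a) :
    ∃ J ∈ modelJacobi R, J 0 = a ∧ J 1 = b := by
  -- `J₀` takes care of the value at `0`. It remains to reach `b - J₀ 1` by a solution vanishing at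
  -- `0`, and `S` is the space of reachable values.
  obtain ⟨J₀, hJ₀, h0, h0'⟩ := exists_modelJacobi hR 0 a 0
  let S : Submodule ℝ X := (modelJacobi R ⊓ LinearMap.ker
    (LinearMap.proj (0 : ℝ) : (ℝ → X) →ₗ[ℝ] X)).map (LinearMap.proj (1 : ℝ))
  have : FiniteDimensional ℝ S := FiniteDimensional.finiteDimensional_submodule S
  have : CompleteSpace S := FiniteDimensional.complete ℝ S
  have : S.HasOrthogonalProjection := Submodule.HasOrthogonalProjection.ofCompleteSpace S
  have hmem : b - J₀ 1 ∈ S := by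
    rw [← Submodule.orthogonal_orthogonal S, Submodule.mem_orthogonal]
    intro c hc
    -- For `c` orthogonal to `S`, the solution with data `(0, c)` at `1` vanishes also at `0`: its
    -- Wronskian with the solution `J` of data `(0, K 0)` at `0` is `‖K 0‖²` there and `-⟨J 1, c⟩ =
    -- 0` at `1`. So the compatibility hypothesis applies to `K`.
    obtain ⟨K, hK, hK1, hK1'⟩ := exists_modelJacobi hR 1 0 c
    have hK0 : K 0 = 0 := by
      obtain ⟨J, hJ, hJ0, hJ0'⟩ := exists_modelJacobi hR 0 0 (K 0)
      have h1 := wronskian_const hs hJ hK 0 1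
      have h2 : inner ℝ (J 1) c = 0 := (Submodule.mem_orthogonal S c).1 hc _ ⟨J, ⟨hJ, hJ0⟩, rfl⟩
      rw [hJ0', hJ0, hK1, hK1', h2] at h1
      simpa using h1
    have h3 := h K ⟨hK, hK0, hK1⟩
    have h4 := wronskian_const hs hJ₀ hK 0 1
    rw [h0', h0, hK1, hK1', hK0] at h4
    simp only [inner_zero_right] at h4
    rw [hK1'] at h3
    rw [inner_sub_right, h3, real_inner_comm, real_inner_comm (J₀ 1)]
    linarith
  obtain ⟨J, ⟨hJ, hJ0⟩, hJ1⟩ := hmem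
  have hJ0' : J 0 = 0 := hJ0
  have hJ1' : J 1 = b - J₀ 1 := hJ1
  exact ⟨J₀ + J, add_mem hJ₀ hJ, by simp [h0, hJ0'], by simp [hJ1']⟩

theorem modelJacobiZero_le_closed : modelJacobiZero R ≤ modelJacobiClosed R A :=
  fun J hJ => ⟨hJ.1, by rw [hJ.2.1, hJ.2.2, map_zero]⟩

variable [FiniteDimensional ℝ X]

/-- Weak solutions of `f'' = R f` are solutions. -/
theorem exists_modelJacobi_of_weak (hR : Continuous R) {f : ℝ → X} (hf : f ∈ twistedH1 A)
    (h : ∀ g ∈ twistedH1Zero A, modelForm R f g = 0) :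
    ∃ J ∈ modelJacobiClosed R A, twist A J = f := by
  set φ := deriv f
  have hf1 := hf.1
  have hfc : Continuous f := hf1.continuous
  have hRf : Continuous fun t => R t (f t) := hR.clm_apply hfc
  set w := fun t => ∫ s in (0 : ℝ)..t, R s (f s)
  have hw : ∀ t, HasDerivAt w (R t (f t)) t := fun t => hRf.integral_hasStrictDerivAt 0 t |>.hasDerivAt
  have Hw : HasL2Deriv w (fun t => R t (f t)) := HasL2Deriv.of_hasDerivAt hw hRf
  -- The du Bois-Reymond argument: `w` is a primitive of `R f`, and `φ - w` should be constant. Its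
  -- deviation `k` from the mean has a primitive `g` vanishing at `0` and `1`, which is therefore an
  -- admissible test function.
  set m := ∫ t in (0 : ℝ)..1, (φ t - w t)
  set k := fun t => φ t - w t - m
  have hφw : IntervalIntegrable (fun t => φ t - w t) volume 0 1 :=
    (hf1.intervalIntegrable 0 1).sub (Hw.continuous.intervalIntegrable _ _)
  have hkL2 : ∀ a b, MemLp k 2 (volume.restrict (Icc a b)) := fun a b =>
    ((hf1.memLp a b).sub (memLp_two_of_continuousOn Hw.continuous.continuousOn)).sub
      (memLp_two_of_continuousOn continuousOn_const)
  set g := fun t => (0 : X) + ∫ s in (0 : ℝ)..t, k s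
  have Hg : HasL2Deriv g k := HasL2Deriv.of_integral hkL2 0
  have hg0 : g 0 = 0 := by simp [g]
  have hg1 : g 1 = 0 := by
    simp only [g, k]
    rw [integral_sub hφw (by simp)]
    simp [m]
  have hgT : twist A g ∈ twistedH1Zero A :=
    ⟨twist_mem Hg (by rw [hg0, hg1, map_zero]), by
      change twist A g 0 = 0
      rw [twist_zero_apply, hg0]⟩
  have e1 : ∫ t in (0 : ℝ)..1, (inner ℝ (φ t) (k t) + inner ℝ (R t (f t)) (g t)) = 0 := by
    refine Eq.trans ?_ (h _ hgT)
    rw [modelForm_eq hf1 (Hg.twist (A := A) (by rw [hg0, hg1, map_zero]))]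
    refine integral_congr_of_eqOn_Ioo (f := fun t => (inner ℝ (φ t) (k t) + inner ℝ (R t (f t)) (g t)))
      zero_le_one fun t ht => ?_
    have ht' : t ∈ Ico (0 : ℝ) 1 := ⟨ht.1.le, ht.2⟩
    simp only [twist_of_mem ht']
    rfl
  have e2 := Hw.integral_inner_add_inner Hg 0 1
  rw [hg0, hg1, inner_zero_right, inner_zero_right, sub_zero] at e2
  have i1 : IntervalIntegrable (fun t => inner ℝ (φ t) (k t)) volume 0 1 :=
    (integrableOn_inner_of_memLp (hf1.memLp (min 0 1) (max 0 1)) (hkL2 _ _)).intervalIntegrable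
  have i2 : IntervalIntegrable (fun t => inner ℝ (w t) (k t)) volume 0 1 :=
    (integrableOn_inner_of_memLp (memLp_two_of_continuousOn Hw.continuous.continuousOn)
      (hkL2 (min 0 1) (max 0 1))).intervalIntegrable
  have i3 : IntervalIntegrable (fun t => inner ℝ (R t (f t)) (g t)) volume 0 1 :=
    (hRf.inner Hg.continuous).intervalIntegrable _ _
  have i4 : IntervalIntegrable (fun t => inner ℝ m (k t)) volume 0 1 :=
    (integrableOn_inner_of_memLp (memLp_two_of_continuousOn continuousOn_const)
      (hkL2 (min 0 1) (max 0 1))).intervalIntegrable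
  have e3 : ∫ t in (0 : ℝ)..1, inner ℝ m (k t) = 0 := by
    have := (innerSL ℝ m).intervalIntegral_comp_comm (Hg.intervalIntegrable 0 1)
    refine Eq.trans this ?_
    have h2 : ∫ t in (0 : ℝ)..1, k t = 0 := by rw [← Hg.sub_eq, hg0, hg1, sub_zero]
    rw [h2, map_zero]
  -- The weak equation tested with `g`, combined with integration by parts for `w` and `g`, gives `∫
  -- ⟨φ - w, k⟩ = 0`, and `k` has mean zero.
  have e4 : ∫ t in (0 : ℝ)..1, ‖k t‖ ^ 2 = 0 := by
    rw [integral_add i1 i3] at e1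
    rw [integral_add i3 i2] at e2
    have : ∀ t, ‖k t‖ ^ 2 = inner ℝ (φ t) (k t) - inner ℝ (w t) (k t) - inner ℝ m (k t) := by
      intro t
      rw [← real_inner_self_eq_norm_sq, ← inner_sub_left, ← inner_sub_left]
    simp only [this]
    rw [integral_sub (i1.sub i2) i4, integral_sub i1 i2, e3]
    linarith
  have hk0 : ∀ᵐ t, t ∈ Ioc (0 : ℝ) 1 → φ t = w t + m := by
    have h1 : IntegrableOn (fun t => ‖k t‖ ^ 2) (Icc 0 1) :=
      (memLp_two_iff_integrable_sq_norm (hkL2 0 1).1).1 (hkL2 0 1)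
    rw [← uIcc_of_le zero_le_one] at h1
    have h2 := (integral_eq_zero_iff_of_nonneg_ae (a := (0 : ℝ)) (b := 1)
      (f := fun t => ‖k t‖ ^ 2) (μ := volume) (Eventually.of_forall fun t => sq_nonneg ‖k t‖)
      h1.intervalIntegrable).1 e4
    rw [Ioc_eq_empty (by norm_num : ¬ (1 : ℝ) < 0), union_empty] at h2
    filter_upwards [(ae_restrict_iff' measurableSet_Ioc).1 h2] with t ht ht'
    have h3 : ‖k t‖ ^ 2 = 0 := ht ht'
    have h4 : k t = 0 := by simpa using h3
    simp only [k] at h4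
    rw [sub_sub, sub_eq_zero] at h4
    exact h4
  obtain ⟨J, hJ, hJ0, hJ0'⟩ := exists_modelJacobi hR 0 (f 0) m
  -- `F` is a `C¹` replacement for `f`. It agrees with `f`, and so solves the equation, on `[0,1]`
  -- only; hence the comparison with `J` by one-sided uniqueness on a closed interval.
  set F := fun t => f 0 + ∫ s in (0 : ℝ)..t, (w s + m)
  have hF : ∀ t, HasDerivAt F (w t + m) t := fun t =>
    ((Hw.continuous.add continuous_const).integral_hasStrictDerivAt 0 t).hasDerivAt.const_add _
  have hFf : ∀ t ∈ Icc (0 : ℝ) 1, F t = f t := by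
    intro t ht
    rw [hf1.eq_integral t]
    simp only [F]
    congr 1
    refine intervalIntegral.integral_congr_ae ?_
    filter_upwards [hk0] with s hs hs'
    rw [uIoc_of_le ht.1] at hs'
    exact (hs ⟨hs'.1, hs'.2.trans ht.2⟩).symm
  have heq := linear_ode_unique_Icc (a := 0) (b := 1) (continuous_jacobiSystem hR).continuousOn
    (f := fun t => (F t, w t + m)) (g := fun t => (J t, deriv J t))
    (fun t _ => ((hF t).prodMk ((hw t).add_const m)).continuousAt.continuousWithinAt)
    (fun t ht => by
      have := ((hF t).prodMk ((hw t).add_const m)).hasDerivWithinAt (s := Ici t)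
      rw [jacobiSystem_apply, hFf t (Ico_subset_Icc_self ht)]
      exact this)
    (fun t _ => (hasDerivAt_jacobiSystem hJ t).continuousAt.continuousWithinAt)
    (fun t _ => (hasDerivAt_jacobiSystem hJ t).hasDerivWithinAt)
    (by simp [F, w, hJ0, hJ0'])
  have hJf : ∀ t ∈ Icc (0 : ℝ) 1, J t = f t := fun t ht => by
    rw [← hFf t ht]
    exact (congrArg Prod.fst (heq ht)).symm
  refine ⟨J, ⟨hJ, ?_⟩, eq_twist_of_mem hf fun t ht => hJf t ⟨ht.1, ht.2.le⟩⟩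
  rw [hJf 1 ⟨zero_le_one, le_rfl⟩, hJf 0 ⟨le_rfl, zero_le_one⟩, ← hf.2, zero_add]

/-- Closed Jacobi fields as elements of `twistedH1 A`. -/
def twistClosed (R : ℝ → X →L[ℝ] X) (A : X ≃ₗᵢ[ℝ] X) : modelJacobiClosed R A →ₗ[ℝ] twistedH1 A :=
  ((twist A).domRestrict _).codRestrict _ fun J =>
    twist_mem (HasL2Deriv.of_mem_modelJacobi J.2.1) J.2.2

theorem twistClosed_injective (hR : Continuous R) : Function.Injective (twistClosed R A) := by
  rw [← LinearMap.ker_eq_bot, LinearMap.ker_eq_bot']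
  intro J hJ
  exact Subtype.ext (zero_of_twist_eq_zero hR J.2.1 (congrArg Subtype.val hJ))

/-- With `h 1 = A (h 0)` and `A` isometric, both boundary terms move to time `0`. So a closed Jacobi
field pairs with `h` through `h 0` alone: it is orthogonal to functions vanishing at `0`, and on
closed Jacobi fields the index form becomes the closing form. -/
theorem modelForm_twist_eq_closing (hR : Continuous R) {J h : ℝ → X}
    (hJ : J ∈ modelJacobi R) (hh : h ∈ twistedH1 A) :
    modelForm R (twist A J) h = inner ℝ (A.symm (deriv J 1) - deriv J 0) (h 0) := by
  rw [modelForm_twist hR hJ hh, inner_sub_left]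
  congr 1
  have h1 : h 1 = A (h 0) := by rw [← hh.2, zero_add]
  rw [h1, ← A.inner_map_map (A.symm _), A.apply_symm_apply]

/-- The segment from `a` to `A a`, extended by twisting. -/
theorem exists_mem_twistedH1 (A : X ≃ₗᵢ[ℝ] X) (a : X) : ∃ h ∈ twistedH1 A, h 0 = a := by
  have hd : ∀ t, HasDerivAt (fun t : ℝ => a + t • (A a - a)) (A a - a) t := fun t => by
    simpa using ((hasDerivAt_id t).smul_const (A a - a)).const_add a
  refine ⟨twist A fun t : ℝ => a + t • (A a - a),
    twist_mem (HasL2Deriv.of_hasDerivAt hd continuous_const) (by simp), ?_⟩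
  rw [twist_zero_apply]
  simp

theorem finrank_map_eq {V W : Type*} [AddCommGroup V] [Module ℝ V] [AddCommGroup W] [Module ℝ W]
    {S : Submodule ℝ V} {T U : Submodule ℝ V} {f : S →ₗ[ℝ] W} (hf : Function.Injective f)
    (hT : T ≤ S) (hU : T = U) : finrank ℝ ((T.submoduleOf S).map f) = finrank ℝ U := by
  subst hU
  rw [← (Submodule.equivMapOfInjective f hf _).finrank_eq,
    (Submodule.submoduleOfEquivOfLe hT).finrank_eq]

/-- The index formula in a parallel frame. -/
theorem negIndex_twistedH1_add_finrank (hR : Continuous R)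
    (hs : ∀ t x y, inner ℝ (R t x) y = inner ℝ x (R t y)) :
    negIndex (twistedH1 A) (modelForm R)
        + finrank ℝ (modelJacobiZero R ⊓ modelJacobiPeriodic R A : Submodule ℝ (ℝ → X)) =
      negIndex (twistedH1Zero A) (modelForm R)
        + negIndex (modelJacobiClosed R A) (modelClosingForm A)
        + finrank ℝ (modelJacobiZero R) := by
  set B := modelBilin A hR hs
  have hB : ∀ f h, B f h = modelForm R f h := fun f h => rfl
  have hBs : ∀ f h, B f h = B h f := fun f h => modelForm_comm hs f h
  let ι := (twistedH1 A).subtype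
  let S : Submodule ℝ (twistedH1 A) := (twistedH1Zero A).submoduleOf (twistedH1 A)
  have hS : ∀ f : twistedH1 A, f ∈ S ↔ (f : ℝ → X) 0 = 0 := fun f =>
    ⟨fun hf => hf.2, fun hf => ⟨f.2, hf⟩⟩
  let τ := twistClosed R A
  have hτ : Function.Injective τ := twistClosed_injective hR
  have hBτ : ∀ (J : modelJacobiClosed R A) f, B (τ J) f =
      inner ℝ (A.symm (deriv (J : ℝ → X) 1) - deriv (J : ℝ → X) 0) ((f : ℝ → X) 0) :=
    fun J f => modelForm_twist_eq_closing hR J.2.1 f.2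
  have hτ0 : ∀ J : modelJacobiClosed R A, (τ J : ℝ → X) 0 = (J : ℝ → X) 0 := fun J =>
    twist_zero_apply _
  -- A function orthogonal to `S` is a weak solution of the Jacobi equation; conversely only the
  -- pairing with the value at `0` survives.
  have horth : B.orthogonal S = (⊤ : Submodule ℝ (modelJacobiClosed R A)).map τ := by
    apply le_antisymm
    · intro f hf
      obtain ⟨J, hJ, hJf⟩ := exists_modelJacobi_of_weak hR f.2 fun g hg => by
        rw [modelForm_comm hs]
        exact LinearMap.BilinForm.mem_orthogonal_iff.1 hf ⟨g, hg.1⟩ hg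
      exact ⟨⟨J, hJ⟩, trivial, Subtype.ext hJf⟩
    · rintro _ ⟨J, -, rfl⟩
      refine LinearMap.BilinForm.mem_orthogonal_iff.2 fun g hg => ?_
      rw [hBs, hBτ, (hS g).1 hg, inner_zero_right]
  have hZ : S ⊓ B.orthogonal S =
      ((modelJacobiZero R).submoduleOf (modelJacobiClosed R A)).map τ := by
    rw [horth]
    apply le_antisymm
    · rintro _ ⟨hf, J, -, rfl⟩
      have h0 : (J : ℝ → X) 0 = 0 := by rw [← hτ0]; exact (hS _).1 hf
      have h1 : (J : ℝ → X) 1 = 0 := by rw [J.2.2, h0, map_zero]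
      exact ⟨J, ⟨J.2.1, h0, h1⟩, rfl⟩
    · rintro _ ⟨J, hJ, rfl⟩
      exact ⟨(hS _).2 (by rw [hτ0]; exact hJ.2.1), J, trivial, rfl⟩
  have hZ₀ : S ⊓ B.orthogonal ⊤ =
      ((modelJacobiZero R ⊓ modelJacobiPeriodic R A).submoduleOf (modelJacobiClosed R A)).map τ := by
    apply le_antisymm
    · intro f hf
      have hf' : f ∈ S ⊓ B.orthogonal S := ⟨hf.1, LinearMap.BilinForm.mem_orthogonal_iff.2
        fun g _ => LinearMap.BilinForm.mem_orthogonal_iff.1 hf.2 g trivial⟩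
      rw [hZ] at hf'
      obtain ⟨J, hJ, rfl⟩ := hf'
      -- Tested against a function whose value at `0` is the jump of the derivative, the form gives
      -- the squared norm of this jump, so the jump vanishes.
      obtain ⟨h, hh, h0⟩ := exists_mem_twistedH1 A
        (A.symm (deriv (J : ℝ → X) 1) - deriv (J : ℝ → X) 0)
      have h1 := LinearMap.BilinForm.mem_orthogonal_iff.1 hf.2 ⟨h, hh⟩ trivial
      rw [hBs, hBτ] at h1
      simp only [h0, inner_self_eq_zero, sub_eq_zero] at h1
      have h2 : deriv (J : ℝ → X) 1 = A (deriv (J : ℝ → X) 0) := by rw [← h1, A.apply_symm_apply]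
      exact ⟨J, ⟨hJ, J.2.1, J.2.2, h2⟩, rfl⟩
    · rintro _ ⟨J, hJ, rfl⟩
      refine ⟨(hS _).2 (by rw [hτ0]; exact hJ.1.2.1),
        LinearMap.BilinForm.mem_orthogonal_iff.2 fun g _ => ?_⟩
      have h2 : deriv (J : ℝ → X) 1 = A (deriv (J : ℝ → X) 0) := hJ.2.2.2
      rw [hBs, hBτ, h2, A.symm_apply_apply, sub_self, inner_zero_left]
  have hfd := finiteDimensional_modelJacobi (X := X) hR
  have hfd0 : FiniteDimensional ℝ (modelJacobiZero R) :=
    Submodule.finiteDimensional_of_le modelJacobiZero_le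
  have hfd1 : FiniteDimensional ℝ (S ⊓ B.orthogonal S : Submodule ℝ (twistedH1 A)) := by
    rw [hZ]
    have : FiniteDimensional ℝ ((modelJacobiZero R).submoduleOf (modelJacobiClosed R A)) :=
      (Submodule.submoduleOfEquivOfLe modelJacobiZero_le_closed).symm.finiteDimensional
    infer_instance
  have e1 : negIndex (twistedH1 A) (modelForm R) = negIndex ⊤ (fun f h => B f h) := by
    rw [← negIndex_map ι (B' := modelForm R) (fun x _ hx => Subtype.ext hx) fun x _ => rfl,
      Submodule.map_top, Submodule.range_subtype]
  have e2 : negIndex (twistedH1Zero A) (modelForm R) = negIndex S (fun f h => B f h) := by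
    have h1 : S.map ι = twistedH1Zero A :=
      (Submodule.map_comap_subtype _ _).trans (inf_eq_right.2 inf_le_left)
    rw [← negIndex_map ι (B' := modelForm R) (fun x _ hx => Subtype.ext hx) fun x _ => rfl, h1]
  have e3 : negIndex (modelJacobiClosed R A) (modelClosingForm A) =
      negIndex (B.orthogonal S) (fun f h => B f h) := by
    rw [horth, negIndex_map τ (B := fun J K => modelClosingForm A J K)
      (fun x _ hx => hτ (by rw [hx, map_zero])) fun J _ => by
        change B (τ J) (τ J) = _
        rw [hBτ, hτ0]
        rfl]
    rw [← negIndex_map (modelJacobiClosed R A).subtype (B' := modelClosingForm A)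
      (fun x _ hx => Subtype.ext hx) fun x _ => rfl, Submodule.map_top, Submodule.range_subtype]
  -- For `f` orthogonal to `J^0` the boundary values `f 0` and `A (f 0)` satisfy the Fredholm
  -- condition; subtracting the closed Jacobi field with these values leaves an element of `S`.
  have hmain := negIndex_top_add_finrank hBs S
    (by rw [← e1]; exact negIndex_twistedH1_ne_top A hR) (by
      intro f hf
      obtain ⟨J, hJ, hJ0, hJ1⟩ := exists_modelJacobi_boundary hR hs ((f : ℝ → X) 0)
        (A ((f : ℝ → X) 0)) fun K hK => by
          have h1 := LinearMap.BilinForm.mem_orthogonal_iff.1 hf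
            (τ ⟨K, modelJacobiZero_le_closed hK⟩) (by rw [hZ]; exact ⟨_, hK, rfl⟩)
          rw [hBτ, inner_sub_left, sub_eq_zero] at h1
          rw [← h1, ← A.inner_map_map (A.symm _), A.apply_symm_apply]
      let J' : modelJacobiClosed R A := ⟨J, hJ, by rw [hJ0, hJ1]⟩
      rw [← sub_add_cancel f (τ J')]
      refine Submodule.add_mem_sup ((hS _).2 ?_) (by rw [horth]; exact ⟨J', trivial, rfl⟩)
      change (f : ℝ → X) 0 - (τ J' : ℝ → X) 0 = 0
      rw [hτ0]
      change (f : ℝ → X) 0 - J 0 = 0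
      rw [hJ0, sub_self])
  rw [e1, e2, e3, ← finrank_map_eq (f := τ) hτ (inf_le_left.trans modelJacobiZero_le_closed) rfl,
    ← hZ₀, hmain, hZ, finrank_map_eq hτ modelJacobiZero_le_closed rfl]

/-- The form vanishes on fields with `J 0 = 0`, so evaluation at `0` embeds every negative definite
subspace into `X`. -/
theorem negIndex_modelClosingForm_le (R : ℝ → X →L[ℝ] X) (A : X ≃ₗᵢ[ℝ] X) :
    negIndex (modelJacobiClosed R A) (modelClosingForm A) ≤ finrank ℝ X := by
  refine negIndex_le_of_nonneg_on_ker (LinearMap.proj (0 : ℝ)) fun J _ h0 => ?_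
  have : J 0 = 0 := h0
  simp [modelClosingForm, this]

end ModelIndex

end FinslerIndex

end

noncomputable section

namespace FinslerIndex

section FinslerTensor

theorem two_le_infty : (2 : WithTop ℕ∞) ≤ ∞ := WithTop.coe_le_coe.2 (le_top (a := (2 : ℕ∞)))

theorem minSmoothness_two_le_infty : minSmoothness ℝ 2 ≤ ∞ := by
  simpa using two_le_infty

/-- The points `(x, v)` with `x ∈ U` and `v ≠ 0`. -/
def slit {E : Type*} [Zero E] (U : Set E) : Set (E × E) := U ×ˢ {0}ᶜ

theorem isOpen_slit {E : Type*} [NormedAddCommGroup E] {U : Set E} (hU : IsOpen U) :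
    IsOpen (slit U) :=
  hU.prod isOpen_compl_singleton

variable {E : Type*} [NormedAddCommGroup E] [NormedSpace ℝ E]

/-! ### The fundamental tensor as a smooth function on the tangent bundle -/

/-- A field `g` of inner products on `E`, depending on `(x, v)`, which behaves like the
fundamental tensor of a Finsler metric. -/
structure IsFinslerTensor (g : E × E → E →L[ℝ] E →L[ℝ] ℝ) (Ω : Set (E × E)) : Prop where
  isOpen : IsOpen Ω
  smooth : ContDiffOn ℝ ∞ g Ω
  symm : ∀ p ∈ Ω, ∀ u w, g p u w = g p w u
  pos : ∀ p ∈ Ω, ∀ u, u ≠ 0 → 0 < g p u u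
  -- The vertical derivative of `g` is twice the Cartan tensor: it is totally symmetric, and by
  -- homogeneity it is annihilated by the base vector.
  vert_symm : ∀ p ∈ Ω, ∀ a b c, fderiv ℝ g p (0, a) b c = fderiv ℝ g p (0, b) a c
  vert_self : ∀ p ∈ Ω, ∀ a b, fderiv ℝ g p (0, a) p.2 b = 0

theorem HasFDerivAt.apply_two {W G : Type*} [NormedAddCommGroup W] [NormedSpace ℝ W]
    [NormedAddCommGroup G] [NormedSpace ℝ G] {g : W → E →L[ℝ] E →L[ℝ] G}
    {g' : W →L[ℝ] E →L[ℝ] E →L[ℝ] G} {p : W} (h : HasFDerivAt g g' p) (b c : E) :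
    HasFDerivAt (fun q => g q b c) ((g'.flip b).flip c) p :=
  ((h.clm_apply (hasFDerivAt_const b p)).clm_apply (hasFDerivAt_const c p)).congr_fderiv
    (by ext; simp)

theorem IsFinslerTensor.contDiffAt {g : E × E → E →L[ℝ] E →L[ℝ] ℝ} {Ω : Set (E × E)}
    (h : IsFinslerTensor g Ω) {p : E × E} (hp : p ∈ Ω) : ContDiffAt ℝ ∞ g p :=
  h.smooth.contDiffAt (h.isOpen.mem_nhds hp)

theorem IsFinslerTensor.differentiableAt {g : E × E → E →L[ℝ] E →L[ℝ] ℝ} {Ω : Set (E × E)}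
    (h : IsFinslerTensor g Ω) {p : E × E} (hp : p ∈ Ω) : DifferentiableAt ℝ g p :=
  (h.contDiffAt hp).differentiableAt (by simp)

theorem IsFinslerTensor.fderiv_symm {g : E × E → E →L[ℝ] E →L[ℝ] ℝ} {Ω : Set (E × E)}
    (h : IsFinslerTensor g Ω) {p : E × E} (hp : p ∈ Ω) (ξ : E × E) (b c : E) :
    fderiv ℝ g p ξ b c = fderiv ℝ g p ξ c b := by
  have h1 := fun b c => HasFDerivAt.apply_two (h.differentiableAt hp).hasFDerivAt b c
  have h2 : (fun q => g q b c) =ᶠ[𝓝 p] fun q => g q c b := by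
    filter_upwards [h.isOpen.mem_nhds hp] with q hq
    exact h.symm q hq b c
  exact congrArg (fun L => L ξ) ((h1 b c).unique ((h1 c b).congr_of_eventuallyEq h2))

/-- The coordinate expression `Q` of the square of a Finsler metric, over the open set `U`. -/
structure IsFinslerSq (Q : E → E → ℝ) (U : Set E) : Prop where
  isOpen : IsOpen U
  smooth : ContDiffOn ℝ ∞ (Function.uncurry Q) (slit U)
  homogeneous : ∀ x ∈ U, ∀ y, ∀ r : ℝ, 0 < r → Q x (r • y) = r ^ 2 * Q x y
  convex : ∀ x ∈ U, ∀ v u, v ≠ 0 → u ≠ 0 → 0 < fundTensor (Q x) v u u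

/-- The restriction of a bilinear form on `E × E` to the second factor. -/
def restrictVert : ((E × E) →L[ℝ] (E × E) →L[ℝ] ℝ) →L[ℝ] E →L[ℝ] E →L[ℝ] ℝ :=
  (ContinuousLinearMap.compL ℝ E ((E × E) →L[ℝ] ℝ) (E →L[ℝ] ℝ)
    ((ContinuousLinearMap.compL ℝ E (E × E) ℝ).flip (ContinuousLinearMap.inr ℝ E E))) ∘L
  ((ContinuousLinearMap.compL ℝ E (E × E) ((E × E) →L[ℝ] ℝ)).flip
    (ContinuousLinearMap.inr ℝ E E))

theorem contDiff_restrictVert : ContDiff ℝ ∞ (restrictVert (E := E)) :=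
  ContinuousLinearMap.contDiff (𝕜 := ℝ) (E := (E × E) →L[ℝ] (E × E) →L[ℝ] ℝ)
    (F := E →L[ℝ] E →L[ℝ] ℝ) restrictVert

/-- Half the vertical Hessian of `Q`. -/
def vertHess (Q : E → E → ℝ) (p : E × E) : E →L[ℝ] E →L[ℝ] ℝ :=
  (1 / 2 : ℝ) • restrictVert (fderiv ℝ (fderiv ℝ (Function.uncurry Q)) p)

theorem vertHess_apply (Q : E → E → ℝ) (p : E × E) (u w : E) :
    vertHess Q p u w =
      (1 / 2 : ℝ) * fderiv ℝ (fderiv ℝ (Function.uncurry Q)) p (0, u) (0, w) := rfl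

theorem deriv_deriv_eq_fderiv {W : Type*} [NormedAddCommGroup W] [NormedSpace ℝ W] {f : W → ℝ}
    {p : W} (hf : ContDiffAt ℝ 2 f p) (a b : W) :
    deriv (fun t : ℝ => deriv (fun s : ℝ => f (p + t • a + s • b)) 0) 0 =
      fderiv ℝ (fderiv ℝ f) p a b := by
  have h1 : ∀ᶠ y in 𝓝 p, DifferentiableAt ℝ f y := by
    filter_upwards [hf.eventually (by simp)] with y hy
    exact hy.differentiableAt (by simp)
  have h2 : Filter.Tendsto (fun t : ℝ => p + t • a) (𝓝 0) (𝓝 p) := by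
    have : Continuous fun t : ℝ => p + t • a := by fun_prop
    simpa using this.tendsto 0
  have h3 : (fun t : ℝ => deriv (fun s : ℝ => f (p + t • a + s • b)) 0) =ᶠ[𝓝 0]
      fun t => fderiv ℝ f (p + t • a) b := by
    filter_upwards [h2.eventually h1] with t ht
    exact ht.lineDeriv_eq_fderiv
  rw [h3.deriv_eq]
  have h4 : DifferentiableAt ℝ (fderiv ℝ f) p :=
    (hf.fderiv_right (m := 1) (by norm_num)).differentiableAt (by simp)
  have h5 : HasLineDerivAt ℝ (fderiv ℝ f) (fderiv ℝ (fderiv ℝ f) p a) p a :=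
    h4.hasFDerivAt.hasLineDerivAt a
  have h6 : HasDerivAt (fun t : ℝ => fderiv ℝ f (p + t • a)) (fderiv ℝ (fderiv ℝ f) p a) 0 := h5
  simpa using (h6.clm_apply (hasDerivAt_const (0 : ℝ) b)).deriv

theorem IsFinslerSq.contDiffAt {Q : E → E → ℝ} {U : Set E} (h : IsFinslerSq Q U) {p : E × E}
    (hp : p ∈ slit U) : ContDiffAt ℝ ∞ (Function.uncurry Q) p :=
  h.smooth.contDiffAt ((isOpen_slit h.isOpen).mem_nhds hp)

theorem IsFinslerSq.fundTensor_eq {Q : E → E → ℝ} {U : Set E} (h : IsFinslerSq Q U) {p : E × E}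
    (hp : p ∈ slit U) (u w : E) : fundTensor (Q p.1) p.2 u w = vertHess Q p u w := by
  rw [vertHess_apply, ← deriv_deriv_eq_fderiv ((h.contDiffAt hp).of_le two_le_infty), fundTensor]
  simp [Function.uncurry]

/-- Each vertical derivative lowers the degree of homogeneity by one, so second derivatives of a
function of degree two have degree zero. -/
theorem fundTensor_smul {W : Type*} [AddCommGroup W] [Module ℝ W] {Q : W → ℝ} {r : ℝ} (hr : 0 < r)
    (hQ : ∀ y, Q (r • y) = r ^ 2 * Q y) (v u w : W) :
    fundTensor Q (r • v) u w = fundTensor Q v u w := by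
  have h1 : ∀ t s : ℝ, Q (r • v + t • u + s • w) =
      r ^ 2 * Q (v + (r⁻¹ * t) • u + (r⁻¹ * s) • w) := by
    intro t s
    rw [← hQ, smul_add, smul_add, smul_smul, smul_smul, mul_inv_cancel_left₀ hr.ne',
      mul_inv_cancel_left₀ hr.ne']
  simp only [fundTensor, h1, deriv_const_mul_field]
  congr 1
  have h2 : ∀ t : ℝ, deriv (fun s : ℝ => Q (v + (r⁻¹ * t) • u + (r⁻¹ * s) • w)) 0 =
      r⁻¹ * deriv (fun s : ℝ => Q (v + (r⁻¹ * t) • u + s • w)) 0 := by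
    intro t
    have := deriv_comp_mul_left r⁻¹ (fun s : ℝ => Q (v + (r⁻¹ * t) • u + s • w)) 0
    simpa using this
  simp only [h2, deriv_const_mul_field]
  have h3 := deriv_comp_mul_left r⁻¹
    (fun t : ℝ => deriv (fun s : ℝ => Q (v + t • u + s • w)) 0) 0
  rw [h3]
  simp only [mul_zero, smul_eq_mul]
  field_simp

theorem fderiv_vertHess {Q : E → E → ℝ} {p : E × E} (hQ : ContDiffAt ℝ ∞ (Function.uncurry Q) p)
    (ξ : E × E) (b c : E) :
    fderiv ℝ (vertHess Q) p ξ b c = (1 / 2 : ℝ) *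
      fderiv ℝ (fderiv ℝ (fderiv ℝ (Function.uncurry Q))) p ξ (0, b) (0, c) := by
  have h0 : ContDiffAt ℝ ∞ (fderiv ℝ (fderiv ℝ (Function.uncurry Q))) p :=
    (hQ.fderiv_right (m := ∞) (by simp)).fderiv_right (m := ∞) (by simp)
  have h1 := h0.differentiableAt (by simp)
  have h2 : DifferentiableAt ℝ (vertHess Q) p := by
    have h3 := (contDiff_restrictVert (E := E)).contDiffAt.comp p h0
    exact (h3.const_smul (1 / 2 : ℝ)).differentiableAt (by simp)
  have h3 := ((h2.hasFDerivAt.clm_apply (hasFDerivAt_const b p)).clm_apply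
    (hasFDerivAt_const c p)).fderiv
  have h4 := (((h1.hasFDerivAt.clm_apply (hasFDerivAt_const ((0, b) : E × E) p)).clm_apply
    (hasFDerivAt_const ((0, c) : E × E) p)).const_mul (1 / 2)).fderiv
  have h5 := congrArg (fun L => L ξ) (h3.symm.trans h4)
  simpa using h5

/-- `vert_symm` is the symmetry of third derivatives. After it, `vert_self` is Euler's relation: the
fundamental tensor is constant along `(1 + t) v`. -/
theorem IsFinslerSq.isFinslerTensor {Q : E → E → ℝ} {U : Set E} (h : IsFinslerSq Q U) :
    IsFinslerTensor (vertHess Q) (slit U) := by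
  have ho := isOpen_slit h.isOpen
  have hs : ContDiffOn ℝ ∞ (vertHess Q) (slit U) := by
    have h1 : ContDiffOn ℝ ∞ (fderiv ℝ (fderiv ℝ (Function.uncurry Q))) (slit U) :=
      (h.smooth.fderiv_of_isOpen (m := ∞) ho (by simp)).fderiv_of_isOpen ho (by simp)
    have h2 := (contDiff_restrictVert (E := E)).comp_contDiffOn h1
    exact h2.const_smul (1 / 2 : ℝ)
  have hsymm : ∀ p ∈ slit U, ∀ u w, vertHess Q p u w = vertHess Q p w u := by
    intro p hp u w
    rw [vertHess_apply, vertHess_apply,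
      ((h.contDiffAt hp).isSymmSndFDerivAt minSmoothness_two_le_infty).eq]
  have hvs : ∀ p ∈ slit U, ∀ a b c,
      fderiv ℝ (vertHess Q) p (0, a) b c = fderiv ℝ (vertHess Q) p (0, b) a c := by
    intro p hp a b c
    rw [fderiv_vertHess (h.contDiffAt hp), fderiv_vertHess (h.contDiffAt hp),
      (((h.contDiffAt hp).fderiv_right (m := ∞) (by simp)).isSymmSndFDerivAt minSmoothness_two_le_infty).eq]
  refine ⟨ho, hs, hsymm, fun p hp u hu => ?_, hvs, fun p hp a b => ?_⟩
  · rw [← h.fundTensor_eq hp]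
    exact h.convex p.1 hp.1 p.2 u hp.2 hu
  · rw [hvs p hp]
    have h1 : HasDerivAt (fun t : ℝ => vertHess Q (p + t • (0, p.2)))
        (fderiv ℝ (vertHess Q) p (0, p.2)) 0 :=
      ((hs.contDiffAt (ho.mem_nhds hp)).differentiableAt (by simp)).hasFDerivAt.hasLineDerivAt _
    have h2 := ((h1.clm_apply (hasDerivAt_const (0 : ℝ) a)).clm_apply
      (hasDerivAt_const (0 : ℝ) b)).deriv
    have h3 : (fun t : ℝ => vertHess Q (p + t • (0, p.2)) a b) =ᶠ[𝓝 0]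
        fun _ => vertHess Q p a b := by
      filter_upwards [Ioi_mem_nhds (show (-1 : ℝ) < 0 by norm_num)] with t ht
      have ht' : 0 < 1 + t := by linarith [ht.out]
      have h4 : p + t • (0, p.2) = (p.1, (1 + t) • p.2) := by
        ext <;> simp [add_smul]
      have h5 : ((p.1, (1 + t) • p.2) : E × E) ∈ slit U :=
        ⟨hp.1, smul_ne_zero ht'.ne' hp.2⟩
      rw [h4, ← h.fundTensor_eq h5, ← h.fundTensor_eq hp]
      exact fundTensor_smul ht' (fun y => h.homogeneous p.1 hp.1 y _ ht') _ _ _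
    rw [h3.deriv_eq, deriv_const] at h2
    simpa using h2.symm

/-- Twice one quarter of the third derivative is the derivative of half the Hessian; the order of
differentiation is adjusted by total symmetry. -/
theorem IsFinslerSq.cartanTensor_eq {Q : E → E → ℝ} {U : Set E} (h : IsFinslerSq Q U) {p : E × E}
    (hp : p ∈ slit U) (a b c : E) :
    2 * cartanTensor (Q p.1) p.2 a b c = fderiv ℝ (vertHess Q) p (0, a) b c := by
  have hT := h.isFinslerTensor
  have ho := hT.isOpen.mem_nhds hp
  have h1 : HasDerivAt (fun t : ℝ => vertHess Q (p + t • (0, c)))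
      (fderiv ℝ (vertHess Q) p (0, c)) 0 :=
    ((hT.smooth.contDiffAt ho).differentiableAt (by simp)).hasFDerivAt.hasLineDerivAt _
  have h2 := ((h1.clm_apply (hasDerivAt_const (0 : ℝ) b)).clm_apply
      (hasDerivAt_const (0 : ℝ) a)).deriv
  have h3 : Filter.Tendsto (fun t : ℝ => p + t • ((0, c) : E × E)) (𝓝 0) (𝓝 p) := by
    have : Continuous fun t : ℝ => p + t • ((0, c) : E × E) := by fun_prop
    simpa using this.tendsto 0
  have h4 : (fun s₃ : ℝ => deriv (fun s₂ : ℝ => deriv (fun s₁ : ℝ =>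
      Q p.1 (p.2 + s₁ • a + s₂ • b + s₃ • c)) 0) 0) =ᶠ[𝓝 0]
      fun t => 2 * vertHess Q (p + t • ((0, c) : E × E)) b a := by
    filter_upwards [h3.eventually ho] with t ht
    have h5 : ∀ s₂ s₁ : ℝ, Q p.1 (p.2 + s₁ • a + s₂ • b + t • c) =
        Q (p + t • ((0, c) : E × E)).1 ((p + t • ((0, c) : E × E)).2 + s₂ • b + s₁ • a) := by
      intro s₂ s₁
      rw [Prod.fst_add, Prod.snd_add, Prod.smul_fst, Prod.smul_snd, smul_zero, add_zero]
      congr 1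
      abel
    simp only [h5]
    rw [← h.fundTensor_eq ht, fundTensor]
    ring
  rw [cartanTensor, h4.deriv_eq, deriv_const_mul_field, h2]
  have h5 : fderiv ℝ (vertHess Q) p (0, c) b a = fderiv ℝ (vertHess Q) p (0, a) b c := by
    rw [hT.vert_symm p hp, hT.fderiv_symm hp, hT.vert_symm p hp]
  simp only [map_zero, add_zero, h5]
  ring

end FinslerTensor

end FinslerIndex

end

noncomputable section

namespace FinslerIndex

section Chern

set_option maxSynthPendingDepth 3

variable {E : Type*} [NormedAddCommGroup E] [NormedSpace ℝ E]
  {g : E × E → E →L[ℝ] E →L[ℝ] ℝ} {Ω : Set (E × E)} {p : E × E}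

/-! ### Existence, uniqueness and smoothness of the Chern connection -/

/-- The equations of the Chern connection in terms of the fundamental tensor. -/
structure IsChern (g : E × E → E →L[ℝ] E →L[ℝ] ℝ) (p : E × E) (Γ : E →L[ℝ] E →L[ℝ] E) :
    Prop where
  torsion_free : ∀ u w, Γ u w = Γ w u
  -- Differentiating in the direction `(u, -Γ u v)`, the horizontal lift of `u`, absorbs the Cartan
  -- term of the almost metric equation.
  metric : ∀ u w z, fderiv ℝ g p (u, -Γ u p.2) w z = g p (Γ u w) z + g p w (Γ u z)

theorem IsFinslerSq.isChernChristoffel_iff {Q : E → E → ℝ} {U : Set E} (h : IsFinslerSq Q U)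
    (hp : p ∈ slit U) (Γ : E →L[ℝ] E →L[ℝ] E) :
    IsChernChristoffel Q p.1 p.2 Γ ↔ IsChern (vertHess Q) p Γ := by
  have hT := h.isFinslerTensor
  have h1 : ∀ u w z, deriv (fun s : ℝ => fundTensor (Q (p.1 + s • u)) p.2 w z) 0 =
      fderiv ℝ (vertHess Q) p (u, 0) w z := by
    intro u w z
    have h2 : HasDerivAt (fun t : ℝ => vertHess Q (p + t • (u, 0)) w z)
        (fderiv ℝ (vertHess Q) p (u, 0) w z) 0 :=
      (HasFDerivAt.apply_two (hT.differentiableAt hp).hasFDerivAt w z).hasLineDerivAt (u, 0)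
    rw [← h2.deriv]
    apply Filter.EventuallyEq.deriv_eq
    have h3 : Filter.Tendsto (fun t : ℝ => p + t • ((u, 0) : E × E)) (𝓝 0) (𝓝 p) := by
      have : Continuous fun t : ℝ => p + t • ((u, 0) : E × E) := by fun_prop
      simpa using this.tendsto 0
    filter_upwards [h3.eventually (hT.isOpen.mem_nhds hp)] with t ht
    rw [← h.fundTensor_eq ht]
    simp
  have h2 : ∀ u a w z, fderiv ℝ (vertHess Q) p (u, -a) w z =
      fderiv ℝ (vertHess Q) p (u, 0) w z - fderiv ℝ (vertHess Q) p (0, a) w z := by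
    intro u a w z
    have : ((u, -a) : E × E) = (u, 0) - (0, a) := by simp
    rw [this, map_sub]
    rfl
  constructor
  · intro hΓ
    refine ⟨hΓ.torsion_free, fun u w z => ?_⟩
    have := hΓ.almost_metric u w z
    rw [h1, h.cartanTensor_eq hp, h.fundTensor_eq hp, h.fundTensor_eq hp] at this
    rw [h2, this]
    ring
  · intro hΓ
    refine ⟨hΓ.torsion_free, fun u w z => ?_⟩
    have := hΓ.metric u w z
    rw [h1, h.cartanTensor_eq hp, h.fundTensor_eq hp, h.fundTensor_eq hp, ← this, h2]
    ring

theorem IsFinslerTensor.eq_zero_of_forall (h : IsFinslerTensor g Ω) (hp : p ∈ Ω) {a : E}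
    (ha : ∀ z, g p a z = 0) : a = 0 := by
  by_contra h0
  exact (h.pos p hp a h0).ne' (ha a)

theorem fderiv_zero_snd_zero (w z : E) : fderiv ℝ g p (0, 0) w z = 0 := by
  have : ((0, 0) : E × E) = 0 := rfl
  rw [this, map_zero]
  rfl

/-- Write `v` for `p.2`. The Cartan term couples the equations only through `Δ u v`. Putting `v` in
the arguments kills it by `vert_self` and gives `Δ v v = 0`; then `Δ u v = 0` for all `u`. What
remains is the Levi-Civita argument: a trilinear form symmetric in its first two slots and skew in
the last two is zero. -/
theorem IsFinslerTensor.chern_homogeneous (h : IsFinslerTensor g Ω) (hp : p ∈ Ω)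
    {Δ : E →L[ℝ] E →L[ℝ] E} (hs : ∀ u w, Δ u w = Δ w u)
    (hm : ∀ u w z, fderiv ℝ g p (0, -Δ u p.2) w z = g p (Δ u w) z + g p w (Δ u z)) : Δ = 0 := by
  have key : ∀ T : E → E → E → ℝ, (∀ u w z, T u w z = T w u z) → (∀ u w z, T u w z = -T u z w) →
      ∀ u w z, T u w z = 0 := by
    intro T h1 h2 u w z
    have e1 := h2 u w z
    have e2 := h1 u z w
    have e3 := h2 z u w
    have e4 := h1 z w u
    have e5 := h2 w z u
    have e6 := h1 w u z
    linarith
  have h1 : ∀ u z, g p (Δ u p.2) z = -g p p.2 (Δ u z) := by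
    intro u z
    have := hm u p.2 z
    rw [h.vert_self p hp] at this
    linarith
  have h2 : ∀ u, g p (Δ u p.2) p.2 = 0 := by
    intro u
    have := h1 u p.2
    rw [h.symm p hp p.2] at this
    linarith
  have h3 : Δ p.2 p.2 = 0 := by
    refine h.eq_zero_of_forall hp fun z => ?_
    rw [h1, hs, h.symm p hp, h2, neg_zero]
  have h4 : ∀ w, Δ w p.2 = 0 := by
    intro w
    refine h.eq_zero_of_forall hp fun z => ?_
    have e1 := hm p.2 w z
    rw [h3, neg_zero, fderiv_zero_snd_zero] at e1
    have e2 := h1 w z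
    have e3 := h1 z w
    rw [hs z w] at e3
    rw [hs p.2 w, h.symm p hp w, hs p.2 z] at e1
    linarith
  have h5 : ∀ u w z, g p (Δ u w) z = 0 := by
    refine key (fun u w z => g p (Δ u w) z) (fun u w z => by simp only [hs u w]) fun u w z => ?_
    have e1 := hm u w z
    rw [h4, neg_zero, fderiv_zero_snd_zero, h.symm p hp w] at e1
    linarith
  ext u w
  exact h.eq_zero_of_forall hp (h5 u w)

theorem IsChern.unique (h : IsFinslerTensor g Ω) (hp : p ∈ Ω) {Γ Γ' : E →L[ℝ] E →L[ℝ] E}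
    (hΓ : IsChern g p Γ) (hΓ' : IsChern g p Γ') : Γ = Γ' := by
  rw [← sub_eq_zero]
  refine h.chern_homogeneous hp (fun u w => ?_) fun u w z => ?_
  · simp only [sub_apply, hΓ.torsion_free u w, hΓ'.torsion_free u w]
  · have e1 := hΓ.metric u w z
    have e2 := hΓ'.metric u w z
    have : ((0, -(Γ - Γ') u p.2) : E × E) = (u, -Γ u p.2) - (u, -Γ' u p.2) := by
      simp
      abel
    rw [this, map_sub]
    simp only [sub_apply, map_sub, e1, e2]
    ring

/-- The permutation of the arguments of a trilinear form with `rotate T u w z = T z u w`. -/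
def rotate (T : E →L[ℝ] E →L[ℝ] E →L[ℝ] ℝ) : E →L[ℝ] E →L[ℝ] E →L[ℝ] ℝ :=
  (ContinuousLinearMap.flipₗᵢ ℝ E E ℝ : (E →L[ℝ] E →L[ℝ] ℝ) →L[ℝ] E →L[ℝ] E →L[ℝ] ℝ) ∘L T.flip

theorem rotate_apply (T : E →L[ℝ] E →L[ℝ] E →L[ℝ] ℝ) (u w z : E) : rotate T u w z = T z u w := rfl

/-- The vertical derivative of `g` in the direction `Γ u v`. -/
def chernVert (g : E × E → E →L[ℝ] E →L[ℝ] ℝ) (p : E × E) (Γ : E →L[ℝ] E →L[ℝ] E) :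
    E →L[ℝ] E →L[ℝ] E →L[ℝ] ℝ :=
  (fderiv ℝ g p ∘L ContinuousLinearMap.inr ℝ E E) ∘L Γ.flip p.2

theorem chernVert_apply (Γ : E →L[ℝ] E →L[ℝ] E) (u w z : E) :
    chernVert g p Γ u w z = fderiv ℝ g p (0, Γ u p.2) w z := rfl

/-- The right hand side of the Koszul formula for the Chern connection. -/
def chernRhs (g : E × E → E →L[ℝ] E →L[ℝ] ℝ) (p : E × E) : E →L[ℝ] E →L[ℝ] E →L[ℝ] ℝ :=
  (fderiv ℝ g p ∘L ContinuousLinearMap.inl ℝ E E)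
    + (fderiv ℝ g p ∘L ContinuousLinearMap.inl ℝ E E).flip
    - rotate (fderiv ℝ g p ∘L ContinuousLinearMap.inl ℝ E E)

theorem chernRhs_apply (u w z : E) :
    chernRhs g p u w z = fderiv ℝ g p (u, 0) w z + fderiv ℝ g p (w, 0) u z
      - fderiv ℝ g p (z, 0) u w := rfl

variable [FiniteDimensional ℝ E]

/-- The left hand side of the Koszul formula for the Chern connection. -/
def chernOp (g : E × E → E →L[ℝ] E →L[ℝ] ℝ) (p : E × E) :
    (E →L[ℝ] E →L[ℝ] E) →L[ℝ] E →L[ℝ] E →L[ℝ] E →L[ℝ] ℝ :=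
  LinearMap.toContinuousLinearMap
    { toFun := fun Γ => (2 : ℝ) • (ContinuousLinearMap.compL ℝ E E (E →L[ℝ] ℝ) (g p)) ∘L Γ
        + chernVert g p Γ + (chernVert g p Γ).flip - rotate (chernVert g p Γ)
      map_add' := fun Γ Γ' => by
        ext u w z
        have : ∀ a b : E, ((0, a + b) : E × E) = (0, a) + (0, b) := by simp
        simp only [chernVert_apply, rotate_apply, add_apply, sub_apply, smul_apply, map_add,
          ContinuousLinearMap.comp_apply, ContinuousLinearMap.compL_apply,
          ContinuousLinearMap.flip_apply, this, smul_eq_mul]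
        ring
      map_smul' := fun (r : ℝ) Γ => by
        ext u w z
        have : ∀ a : E, ((0, r • a) : E × E) = r • (0, a) := by simp
        simp only [chernVert_apply, rotate_apply, add_apply, sub_apply, smul_apply, map_smul,
          ContinuousLinearMap.comp_apply, ContinuousLinearMap.compL_apply,
          ContinuousLinearMap.flip_apply, this, smul_eq_mul, RingHom.id_apply]
        ring }

theorem chernOp_apply (Γ : E →L[ℝ] E →L[ℝ] E) (u w z : E) :
    chernOp g p Γ u w z = 2 * g p (Γ u w) z + fderiv ℝ g p (0, Γ u p.2) w z
      + fderiv ℝ g p (0, Γ w p.2) u z - fderiv ℝ g p (0, Γ z p.2) u w := rfl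

/-- The Koszul trick. The alternating cyclic sum of the metric equations gives the right hand side;
conversely the part skew in `u, w` is torsion-freeness and the part symmetric in `w, z` is the
metric equation. As the Cartan terms contain `Γ`, this is a linear system for `Γ` and not an
explicit formula. -/
theorem IsFinslerTensor.isChern_iff (h : IsFinslerTensor g Ω) (hp : p ∈ Ω)
    (Γ : E →L[ℝ] E →L[ℝ] E) : IsChern g p Γ ↔ chernOp g p Γ = chernRhs g p := by
  have hsub : ∀ u a w z, fderiv ℝ g p (u, -a) w z =
      fderiv ℝ g p (u, 0) w z - fderiv ℝ g p (0, a) w z := by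
    intro u a w z
    have : ((u, -a) : E × E) = (u, 0) - (0, a) := by simp
    rw [this, map_sub]
    rfl
  constructor
  · intro hΓ
    ext u w z
    have e1 := hΓ.metric u w z
    have e2 := hΓ.metric w u z
    have e3 := hΓ.metric z u w
    rw [hsub] at e1 e2 e3
    rw [hΓ.torsion_free z u, hΓ.torsion_free z w, h.symm p hp _ w] at e3
    rw [hΓ.torsion_free w u] at e2
    rw [chernOp_apply, chernRhs_apply]
    linarith
  · intro hΓ
    have key : ∀ u w z, 2 * g p (Γ u w) z + fderiv ℝ g p (0, Γ u p.2) w z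
        + fderiv ℝ g p (0, Γ w p.2) u z - fderiv ℝ g p (0, Γ z p.2) u w =
        fderiv ℝ g p (u, 0) w z + fderiv ℝ g p (w, 0) u z - fderiv ℝ g p (z, 0) u w := by
      intro u w z
      rw [← chernOp_apply, hΓ, chernRhs_apply]
    have hs : ∀ u w, Γ u w = Γ w u := by
      intro u w
      rw [← sub_eq_zero]
      refine h.eq_zero_of_forall hp fun z => ?_
      have e1 := key u w z
      have e2 := key w u z
      rw [h.fderiv_symm hp _ w u, h.fderiv_symm hp (z, 0) w u] at e2
      rw [map_sub, sub_apply]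
      linarith
    refine ⟨hs, fun u w z => ?_⟩
    have e1 := key u w z
    have e2 := key u z w
    rw [h.fderiv_symm hp _ z w, h.fderiv_symm hp (u, 0) z w] at e2
    rw [hsub, h.symm p hp w]
    linarith

theorem IsFinslerTensor.chernOp_injective (h : IsFinslerTensor g Ω) (hp : p ∈ Ω) :
    Function.Injective (chernOp g p) := by
  rw [injective_iff_map_eq_zero]
  intro Γ hΓ
  have key : ∀ u w z, 2 * g p (Γ u w) z + fderiv ℝ g p (0, Γ u p.2) w z
      + fderiv ℝ g p (0, Γ w p.2) u z - fderiv ℝ g p (0, Γ z p.2) u w = 0 := by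
    intro u w z
    rw [← chernOp_apply, hΓ]
    rfl
  have hs : ∀ u w, Γ u w = Γ w u := by
    intro u w
    rw [← sub_eq_zero]
    refine h.eq_zero_of_forall hp fun z => ?_
    have e1 := key u w z
    have e2 := key w u z
    rw [h.fderiv_symm hp _ w u] at e2
    rw [map_sub, sub_apply]
    linarith
  refine h.chern_homogeneous hp hs fun u w z => ?_
  have e1 := key u w z
  have e2 := key u z w
  have e3 : fderiv ℝ g p (0, -Γ u p.2) w z = -fderiv ℝ g p (0, Γ u p.2) w z := by
    have : ((0, -Γ u p.2) : E × E) = -(0, Γ u p.2) := by simp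
    rw [this, map_neg]
    rfl
  rw [h.fderiv_symm hp _ z w] at e2
  rw [e3, h.symm p hp w]
  linarith

/-- The Christoffel symbols of the Chern connection of a fundamental tensor. -/
def chernSymbol (g : E × E → E →L[ℝ] E →L[ℝ] ℝ) (p : E × E) : E →L[ℝ] E →L[ℝ] E :=
  (chernOp g p).inverse (chernRhs g p)

/-- Source and target have the same dimension, since `E` and its dual do; injectivity, that is
uniqueness of the connection, thus yields existence. -/
theorem IsFinslerTensor.exists_equiv (h : IsFinslerTensor g Ω) (hp : p ∈ Ω) :
    ∃ e : (E →L[ℝ] E →L[ℝ] E) ≃L[ℝ] (E →L[ℝ] E →L[ℝ] E →L[ℝ] ℝ),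
      (e : (E →L[ℝ] E →L[ℝ] E) →L[ℝ] (E →L[ℝ] E →L[ℝ] E →L[ℝ] ℝ)) = chernOp g p := by
  have hinj : Function.Injective (g p) := by
    rw [injective_iff_map_eq_zero]
    exact fun a ha => h.eq_zero_of_forall hp fun z => by rw [ha]; rfl
  have hd : Module.finrank ℝ E = Module.finrank ℝ (E →L[ℝ] ℝ) := by
    rw [← (LinearMap.toContinuousLinearMap (𝕜 := ℝ) (E := E) (F' := ℝ)).finrank_eq,
      Module.finrank_linearMap_self]
  let e₀ : E ≃L[ℝ] (E →L[ℝ] ℝ) := ContinuousLinearEquiv.ofFinrankEq hd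
  have hd' : Module.finrank ℝ (E →L[ℝ] E →L[ℝ] E) =
      Module.finrank ℝ (E →L[ℝ] E →L[ℝ] E →L[ℝ] ℝ) :=
    ((ContinuousLinearEquiv.refl ℝ E).arrowCongr
      ((ContinuousLinearEquiv.refl ℝ E).arrowCongr e₀)).toLinearEquiv.finrank_eq
  refine ⟨(LinearMap.linearEquivOfInjective (chernOp g p : _ →ₗ[ℝ] _)
    (h.chernOp_injective hp) hd').toContinuousLinearEquiv, ?_⟩
  ext Γ : 1
  rfl

theorem IsFinslerTensor.isChern_chernSymbol (h : IsFinslerTensor g Ω) (hp : p ∈ Ω) :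
    IsChern g p (chernSymbol g p) := by
  obtain ⟨e, he⟩ := h.exists_equiv hp
  rw [h.isChern_iff hp, chernSymbol, ← he, ContinuousLinearMap.inverse_equiv]
  exact e.apply_symm_apply _

/-- Operator and right hand side of the linear system depend smoothly on `p`, and inversion is
smooth at invertible operators. -/
theorem IsFinslerTensor.contDiffOn_chernSymbol (h : IsFinslerTensor g Ω) :
    ContDiffOn ℝ ∞ (chernSymbol g) Ω := by
  intro p hp
  have hg := h.smooth
  have hdg : ContDiffOn ℝ ∞ (fderiv ℝ g) Ω := h.smooth.fderiv_of_isOpen h.isOpen (by simp)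
  have hdg' : ∀ ξ : E × E → E × E, ContDiffOn ℝ ∞ ξ Ω → ∀ w z,
      ContDiffOn ℝ ∞ (fun p => fderiv ℝ g p (ξ p) w z) Ω := fun ξ hξ w z =>
    ((hdg.clm_apply hξ).clm_apply contDiffOn_const).clm_apply contDiffOn_const
  have h1 : ContDiffOn ℝ ∞ (chernOp g) Ω := by
    refine contDiffOn_clm_apply.2 fun Γ => contDiffOn_clm_apply.2 fun u =>
      contDiffOn_clm_apply.2 fun w => contDiffOn_clm_apply.2 fun z => ?_
    simp only [chernOp_apply]
    have hv : ∀ u, ContDiffOn ℝ ∞ (fun p : E × E => ((0, Γ u p.2) : E × E)) Ω := fun u =>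
      contDiffOn_const.prodMk ((Γ u).contDiff.comp_contDiffOn contDiffOn_snd)
    exact (((contDiffOn_const.mul ((hg.clm_apply contDiffOn_const).clm_apply contDiffOn_const)).add
      (hdg' _ (hv u) w z)).add (hdg' _ (hv w) u z)).sub (hdg' _ (hv z) u w)
  have h2 : ContDiffOn ℝ ∞ (chernRhs g) Ω := by
    refine contDiffOn_clm_apply.2 fun u =>
      contDiffOn_clm_apply.2 fun w => contDiffOn_clm_apply.2 fun z => ?_
    simp only [chernRhs_apply]
    exact ((hdg' _ contDiffOn_const w z).add (hdg' _ contDiffOn_const u z)).sub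
      (hdg' _ contDiffOn_const u w)
  obtain ⟨e, he⟩ := h.exists_equiv hp
  have h3 : ContDiffAt ℝ ∞ ContinuousLinearMap.inverse (chernOp g p) := by
    rw [← he]
    exact contDiffAt_map_inverse e
  exact (h3.comp_contDiffWithinAt p (h1 p hp)).clm_apply (h2 p hp)

/-- Existence and uniqueness force the choice made in `christoffel`. -/
theorem IsFinslerSq.christoffel_eq {Q : E → E → ℝ} {U : Set E} (h : IsFinslerSq Q U)
    (hp : p ∈ slit U) : christoffel Q p.1 p.2 = chernSymbol (vertHess Q) p := by
  have h1 := h.isFinslerTensor.isChern_chernSymbol hp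
  have h2 : IsChernChristoffel Q p.1 p.2 (christoffel Q p.1 p.2) :=
    Classical.epsilon_spec ⟨_, (h.isChernChristoffel_iff hp _).2 h1⟩
  exact ((h.isChernChristoffel_iff hp _).1 h2).unique h.isFinslerTensor hp h1

end Chern

end FinslerIndex

end

noncomputable section

namespace FinslerIndex

section Curvature

set_option maxSynthPendingDepth 3

variable {E : Type*} [NormedAddCommGroup E] [NormedSpace ℝ E]
  {g : E × E → E →L[ℝ] E →L[ℝ] ℝ} {Ω : Set (E × E)} {p : E × E}

/-! ### Change of coordinates -/

/-- A change of coordinates `ψ` between two fundamental tensors. -/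
structure IsTensorChange (g₀ g₁ : E × E → E →L[ℝ] E →L[ℝ] ℝ) (Ω₀ Ω₁ : Set (E × E))
    (ψ : E → E) (V : Set E) : Prop where
  left : IsFinslerTensor g₀ Ω₀
  right : IsFinslerTensor g₁ Ω₁
  isOpen : IsOpen V
  smooth : ContDiffOn ℝ ∞ ψ V
  fst_mem : ∀ p ∈ Ω₀, p.1 ∈ V
  mem : ∀ p ∈ Ω₀, (ψ p.1, fderiv ℝ ψ p.1 p.2) ∈ Ω₁
  injective : ∀ x ∈ V, Function.Injective (fderiv ℝ ψ x)
  tensor : ∀ p ∈ Ω₀, ∀ u w,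
    g₀ p u w = g₁ (ψ p.1, fderiv ℝ ψ p.1 p.2) (fderiv ℝ ψ p.1 u) (fderiv ℝ ψ p.1 w)

variable {g₀ g₁ : E × E → E →L[ℝ] E →L[ℝ] ℝ} {Ω₀ Ω₁ : Set (E × E)} {ψ : E → E} {V : Set E}

theorem IsTensorChange.contDiffAt (h : IsTensorChange g₀ g₁ Ω₀ Ω₁ ψ V) {x : E} (hx : x ∈ V) :
    ContDiffAt ℝ ∞ ψ x := h.smooth.contDiffAt (h.isOpen.mem_nhds hx)

theorem IsTensorChange.hasFDerivAt (h : IsTensorChange g₀ g₁ Ω₀ Ω₁ ψ V) {x : E} (hx : x ∈ V) :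
    HasFDerivAt ψ (fderiv ℝ ψ x) x :=
  ((h.contDiffAt hx).differentiableAt (by simp)).hasFDerivAt

theorem IsTensorChange.contDiffAt_fderiv (h : IsTensorChange g₀ g₁ Ω₀ Ω₁ ψ V) {x : E}
    (hx : x ∈ V) : ContDiffAt ℝ ∞ (fderiv ℝ ψ) x := (h.contDiffAt hx).fderiv_right (by simp)

theorem IsTensorChange.hasFDerivAt_fderiv (h : IsTensorChange g₀ g₁ Ω₀ Ω₁ ψ V) {x : E}
    (hx : x ∈ V) : HasFDerivAt (fderiv ℝ ψ) (fderiv ℝ (fderiv ℝ ψ) x) x :=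
  ((h.contDiffAt_fderiv hx).differentiableAt (by simp)).hasFDerivAt

theorem IsTensorChange.hasFDerivAt_fderiv_fderiv (h : IsTensorChange g₀ g₁ Ω₀ Ω₁ ψ V) {x : E}
    (hx : x ∈ V) :
    HasFDerivAt (fderiv ℝ (fderiv ℝ ψ)) (fderiv ℝ (fderiv ℝ (fderiv ℝ ψ)) x) x :=
  (((h.contDiffAt_fderiv hx).fderiv_right (m := ∞) (by simp)).differentiableAt
    (by simp)).hasFDerivAt

theorem IsTensorChange.fderiv_fderiv_comm (h : IsTensorChange g₀ g₁ Ω₀ Ω₁ ψ V) {x : E}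
    (hx : x ∈ V) (u w : E) :
    fderiv ℝ (fderiv ℝ ψ) x u w = fderiv ℝ (fderiv ℝ ψ) x w u :=
  ((h.contDiffAt hx).isSymmSndFDerivAt minSmoothness_two_le_infty).eq u w

/-- The derivative of the induced change of coordinates on the tangent bundle. -/
theorem IsTensorChange.hasFDerivAt_tangent (h : IsTensorChange g₀ g₁ Ω₀ Ω₁ ψ V)
    (hp : p.1 ∈ V) :
    ∃ L : E × E →L[ℝ] E × E, HasFDerivAt (fun q : E × E => (ψ q.1, fderiv ℝ ψ q.1 q.2)) L p ∧
      ∀ a b, L (a, b) =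
        (fderiv ℝ ψ p.1 a, fderiv ℝ ψ p.1 b + fderiv ℝ (fderiv ℝ ψ) p.1 a p.2) := by
  have h1 := HasFDerivAt.comp p (h.hasFDerivAt hp) hasFDerivAt_fst
  have h2 := HasFDerivAt.comp p (h.hasFDerivAt_fderiv hp) hasFDerivAt_fst
  exact ⟨_, h1.prodMk (h2.clm_apply hasFDerivAt_snd), fun a b => rfl⟩

variable [FiniteDimensional ℝ E]

/-! ### The curvature of the Chern connection -/

/-- The horizontal lift of `u` to the point `p` of the tangent bundle. -/
def horizLift (g : E × E → E →L[ℝ] E →L[ℝ] ℝ) (p : E × E) (u : E) : E × E :=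
  (u, -chernSymbol g p u p.2)

/-- The curvature of the Chern connection. -/
def chernCurv (g : E × E → E →L[ℝ] E →L[ℝ] ℝ) (p : E × E) (u w z : E) : E :=
  fderiv ℝ (chernSymbol g) p (horizLift g p u) w z - fderiv ℝ (chernSymbol g) p (horizLift g p w) u z
    + chernSymbol g p u (chernSymbol g p w z) - chernSymbol g p w (chernSymbol g p u z)

theorem IsFinslerTensor.contDiffAt_chernSymbol (h : IsFinslerTensor g Ω) (hp : p ∈ Ω) :
    ContDiffAt ℝ ∞ (chernSymbol g) p :=
  h.contDiffOn_chernSymbol.contDiffAt (h.isOpen.mem_nhds hp)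

theorem IsFinslerTensor.differentiableAt_chernSymbol (h : IsFinslerTensor g Ω) (hp : p ∈ Ω) :
    DifferentiableAt ℝ (chernSymbol g) p :=
  (h.contDiffAt_chernSymbol hp).differentiableAt (by simp)

theorem IsFinslerTensor.chernSymbol_comm (h : IsFinslerTensor g Ω) (hp : p ∈ Ω) (u w : E) :
    chernSymbol g p u w = chernSymbol g p w u := (h.isChern_chernSymbol hp).torsion_free u w

theorem IsFinslerTensor.fderiv_horizLift (h : IsFinslerTensor g Ω) (hp : p ∈ Ω) (u w z : E) :
    fderiv ℝ g p (horizLift g p u) w z =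
      g p (chernSymbol g p u w) z + g p w (chernSymbol g p u z) :=
  (h.isChern_chernSymbol hp).metric u w z

theorem IsFinslerTensor.fderiv_chernSymbol_comm (h : IsFinslerTensor g Ω) (hp : p ∈ Ω)
    (ξ : E × E) (b c : E) :
    fderiv ℝ (chernSymbol g) p ξ b c = fderiv ℝ (chernSymbol g) p ξ c b := by
  have h1 := fun b c =>
    HasFDerivAt.apply_two (h.differentiableAt_chernSymbol hp).hasFDerivAt b c
  have h2 : (fun q => chernSymbol g q b c) =ᶠ[𝓝 p] fun q => chernSymbol g q c b := by
    filter_upwards [h.isOpen.mem_nhds hp] with q hq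
    exact h.chernSymbol_comm hq b c
  exact congrArg (fun L => L ξ) ((h1 b c).unique ((h1 c b).congr_of_eventuallyEq h2))

/-- The partial derivatives in `x` and in `v` that make up `horizontalDeriv` combine to one
derivative along the horizontal lift. -/
theorem IsFinslerSq.curvature_eq {Q : E → E → ℝ} {U : Set E} (h : IsFinslerSq Q U)
    (hp : p ∈ slit U) (u w z : E) :
    curvature Q p.1 p.2 u w z = chernCurv (vertHess Q) p u w z := by
  have hT := h.isFinslerTensor
  have hΓ := h.christoffel_eq hp
  have hd := (hT.differentiableAt_chernSymbol hp).hasFDerivAt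
  have hx : ∀ u, fderiv ℝ (fun x' => christoffel Q x' p.2) p.1 u =
      fderiv ℝ (chernSymbol (vertHess Q)) p (u, 0) := by
    intro u
    have h1 : (fun x' => christoffel Q x' p.2) =ᶠ[𝓝 p.1]
        fun x' => chernSymbol (vertHess Q) (x', p.2) := by
      filter_upwards [h.isOpen.mem_nhds hp.1] with x hx
      exact h.christoffel_eq (p := (x, p.2)) ⟨hx, hp.2⟩
    have h2 : HasFDerivAt (fun x' : E => (x', p.2)) (ContinuousLinearMap.inl ℝ E E) p.1 :=
      hasFDerivAt_prodMk_left p.1 p.2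
    rw [h1.fderiv_eq]
    have h3 : HasFDerivAt (fun x' => chernSymbol (vertHess Q) (x', p.2)) _ p.1 :=
      HasFDerivAt.comp p.1 (f := fun x' : E => (x', p.2)) hd h2
    rw [h3.fderiv]
    rfl
  have hv : ∀ b, fderiv ℝ (fun v' => christoffel Q p.1 v') p.2 b =
      fderiv ℝ (chernSymbol (vertHess Q)) p (0, b) := by
    intro u
    have h1 : (fun v' => christoffel Q p.1 v') =ᶠ[𝓝 p.2]
        fun v' => chernSymbol (vertHess Q) (p.1, v') := by
      filter_upwards [isOpen_ne.mem_nhds hp.2] with v hv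
      exact h.christoffel_eq (p := (p.1, v)) ⟨hp.1, hv⟩
    have h2 : HasFDerivAt (fun v' : E => (p.1, v')) (ContinuousLinearMap.inr ℝ E E) p.2 :=
      hasFDerivAt_prodMk_right p.1 p.2
    rw [h1.fderiv_eq]
    have h3 : HasFDerivAt (fun v' => chernSymbol (vertHess Q) (p.1, v')) _ p.2 :=
      HasFDerivAt.comp p.2 (f := fun v' : E => (p.1, v')) hd h2
    rw [h3.fderiv]
    rfl
  have hh : ∀ u, horizontalDeriv Q p.1 p.2 u =
      fderiv ℝ (chernSymbol (vertHess Q)) p (horizLift (vertHess Q) p u) := by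
    intro u
    have : horizLift (vertHess Q) p u = (u, 0) - (0, chernSymbol (vertHess Q) p u p.2) := by
      simp [horizLift]
    rw [horizontalDeriv, hx, hv, hΓ, this, map_sub]
  simp only [curvature, chernCurv, hh, hΓ]

theorem IsFinslerTensor.hasFDerivAt_horizLift (h : IsFinslerTensor g Ω) (hp : p ∈ Ω) (w : E) :
    HasFDerivAt (fun q => horizLift g q w)
      ((0 : E × E →L[ℝ] E).prod (-(((chernSymbol g p w).comp (ContinuousLinearMap.snd ℝ E E)) +
        ((fderiv ℝ (chernSymbol g) p).flip w).flip p.2))) p := by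
  have h1 : HasFDerivAt (fun q => chernSymbol g q w) ((fderiv ℝ (chernSymbol g) p).flip w) p :=
    ((h.differentiableAt_chernSymbol hp).hasFDerivAt.clm_apply (hasFDerivAt_const w p)).congr_fderiv
      (by ext <;> simp)
  exact (hasFDerivAt_const w p).prodMk (h1.clm_apply hasFDerivAt_snd).neg

/-- For constant `z`, the horizontal derivative along `u` of `g(v, z)` is `g(v, Γ u z)`. The
commutator of two horizontal lifts is the vertical vector `-R(u,w)v`, and the vertical derivative of
`g(v, z)` along `b` is `g(b, z)` by `vert_self`. Having `v` in one slot is what makes the Cartan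
terms disappear. -/
theorem IsFinslerTensor.chernCurv_skew (h : IsFinslerTensor g Ω) (hp : p ∈ Ω) (u w z : E) :
    g p (chernCurv g p u w p.2) z + g p p.2 (chernCurv g p u w z) = 0 := by
  -- the differential of `ℓ z`, `q ↦ g q q.2 z`
  have hℓ : ∀ q ∈ Ω, ∀ z, HasFDerivAt (fun q => g q q.2 z)
      ((((g q).comp (ContinuousLinearMap.snd ℝ E E)) + (fderiv ℝ g q).flip q.2).flip z) q := by
    intro q hq z
    exact (((h.differentiableAt hq).hasFDerivAt.clm_apply hasFDerivAt_snd).clm_apply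
      (hasFDerivAt_const z q)).congr_fderiv (by ext <;> simp)
  have hℓh : ∀ q ∈ Ω, ∀ u z, fderiv ℝ (fun q => g q q.2 z) q (horizLift g q u) =
      g q q.2 (chernSymbol g q u z) := by
    intro q hq u z
    rw [(hℓ q hq z).fderiv]
    change g q (horizLift g q u).2 z + fderiv ℝ g q (horizLift g q u) q.2 z = _
    rw [h.fderiv_horizLift hq, horizLift, map_neg, neg_apply]
    ring
  have hc : ContDiffAt ℝ ∞ (fun q => g q q.2 z) p :=
    ((h.contDiffAt hp).clm_apply contDiffAt_snd).clm_apply contDiffAt_const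
  have hsymm := (hc.isSymmSndFDerivAt minSmoothness_two_le_infty).eq
  have hd : DifferentiableAt ℝ (fderiv ℝ (fun q => g q q.2 z)) p :=
    (hc.fderiv_right (m := ∞) (by simp)).differentiableAt (by simp)
  -- The identity `hℓh` for `w`, differentiated along the horizontal lift of `u`. In the difference
  -- with `u` and `w` exchanged the second derivatives cancel.
  have key : ∀ u w, fderiv ℝ (fderiv ℝ (fun q => g q q.2 z)) p (horizLift g p u) (horizLift g p w)
      + fderiv ℝ (fun q => g q q.2 z) p
        (0, -(chernSymbol g p w (horizLift g p u).2 +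
          fderiv ℝ (chernSymbol g) p (horizLift g p u) w p.2)) =
      g p p.2 (chernSymbol g p u (chernSymbol g p w z)) +
        g p p.2 (fderiv ℝ (chernSymbol g) p (horizLift g p u) w z) := by
    intro u w
    have h1 := hd.hasFDerivAt.clm_apply (h.hasFDerivAt_horizLift hp w)
    have h2 : HasFDerivAt (fun q => g q q.2 (chernSymbol g q w z)) _ p :=
      ((h.differentiableAt hp).hasFDerivAt.clm_apply hasFDerivAt_snd).clm_apply
        (HasFDerivAt.apply_two (h.differentiableAt_chernSymbol hp).hasFDerivAt w z)
    have h3 : (fun q => fderiv ℝ (fun q => g q q.2 z) q (horizLift g q w)) =ᶠ[𝓝 p]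
        fun q => g q q.2 (chernSymbol g q w z) := by
      filter_upwards [h.isOpen.mem_nhds hp] with q hq
      exact hℓh q hq w z
    have h4 := congrArg (fun L => L (horizLift g p u)) (h1.unique (h2.congr_of_eventuallyEq h3))
    have h5 := hℓh p hp u (chernSymbol g p w z)
    rw [(hℓ p hp _).fderiv] at h5
    have h6 : fderiv ℝ (fun q => g q q.2 z) p
        (0, -(chernSymbol g p w (horizLift g p u).2 +
          fderiv ℝ (chernSymbol g) p (horizLift g p u) w p.2)) +
        fderiv ℝ (fderiv ℝ (fun q => g q q.2 z)) p (horizLift g p u) (horizLift g p w) =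
        g p p.2 (fderiv ℝ (chernSymbol g) p (horizLift g p u) w z) +
        ((((g p).comp (ContinuousLinearMap.snd ℝ E E)) + (fderiv ℝ g p).flip p.2).flip
          (chernSymbol g p w z)) (horizLift g p u) := h4
    rw [h5] at h6
    linarith
  have k1 := key u w
  have k2 := key w u
  rw [hsymm] at k1
  have h7 : ∀ b, fderiv ℝ (fun q => g q q.2 z) p (0, b) = g p b z := by
    intro b
    rw [(hℓ p hp z).fderiv]
    change g p b z + fderiv ℝ g p (0, b) p.2 z = _
    rw [h.vert_self p hp, add_zero]
  rw [h7] at k1 k2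
  simp only [horizLift, map_neg, map_add, add_apply, neg_apply] at k1 k2
  simp only [chernCurv, horizLift, map_add, map_sub, add_apply, sub_apply]
  linarith

theorem IsFinslerTensor.chernCurv_bianchi (h : IsFinslerTensor g Ω) (hp : p ∈ Ω) (u w z : E) :
    chernCurv g p u w z + chernCurv g p w z u + chernCurv g p z u w = 0 := by
  simp only [chernCurv]
  rw [h.fderiv_chernSymbol_comm hp _ u w, h.fderiv_chernSymbol_comm hp _ u z,
    h.fderiv_chernSymbol_comm hp _ z w, h.chernSymbol_comm hp w z, h.chernSymbol_comm hp u z,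
    h.chernSymbol_comm hp w u]
  abel

theorem chernCurv_swap (u w z : E) : chernCurv g p u w z = -chernCurv g p w u z := by
  simp only [chernCurv]
  abel

/-- The Jacobi operator `R(v, ·)v` is symmetric. -/
theorem IsFinslerTensor.chernCurv_symm (h : IsFinslerTensor g Ω) (hp : p ∈ Ω) (w z : E) :
    g p (chernCurv g p p.2 w p.2) z = g p w (chernCurv g p p.2 z p.2) := by
  -- Skewness rewrites both sides as `-g(v, R(v,w)z)` and `-g(v, R(v,z)w)`. By the Bianchi identity
  -- these differ by `g(v, R(z,w)v)`, up to sign, and this vanishes by `e3`.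
  have e1 := h.chernCurv_skew hp p.2 w z
  have e2 := h.chernCurv_skew hp p.2 z w
  have e3 := h.chernCurv_skew hp z w p.2
  have e4 := congrArg (g p p.2) (h.chernCurv_bianchi hp p.2 z w)
  rw [h.symm p hp _ p.2] at e3
  rw [map_add, map_add, map_zero, chernCurv_swap w p.2 z, map_neg] at e4
  rw [h.symm p hp w]
  linarith

/-- The Jacobi operator `R(v, ·)v`. -/
def jacobiOp (g : E × E → E →L[ℝ] E →L[ℝ] ℝ) (p : E × E) : E →L[ℝ] E :=
  LinearMap.toContinuousLinearMap
    { toFun := fun w => chernCurv g p p.2 w p.2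
      map_add' := fun w w' => by
        have : horizLift g p (w + w') = horizLift g p w + horizLift g p w' := by
          simp [horizLift, add_comm]
        simp only [chernCurv, this, map_add, add_apply]
        abel
      map_smul' := fun r w => by
        have : horizLift g p (r • w) = r • horizLift g p w := by
          simp [horizLift]
        simp only [chernCurv, this, map_smul, smul_apply, RingHom.id_apply, smul_add, smul_sub] }

theorem IsFinslerTensor.contDiffOn_jacobiOp (h : IsFinslerTensor g Ω) :
    ContDiffOn ℝ ∞ (jacobiOp g) Ω := by
  refine contDiffOn_clm_apply.2 fun w => ?_
  have hΓ := h.contDiffOn_chernSymbol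
  have hdΓ : ContDiffOn ℝ ∞ (fderiv ℝ (chernSymbol g)) Ω := hΓ.fderiv_of_isOpen h.isOpen (by simp)
  have hv : ContDiffOn ℝ ∞ (fun p : E × E => p.2) Ω := contDiffOn_snd
  have hc : ContDiffOn ℝ ∞ (fun _ : E × E => w) Ω := contDiffOn_const
  have h1 : ContDiffOn ℝ ∞ (fun p => horizLift g p p.2) Ω :=
    hv.prodMk ((hΓ.clm_apply hv).clm_apply hv).neg
  have h2 : ContDiffOn ℝ ∞ (fun p => horizLift g p w) Ω :=
    hc.prodMk ((hΓ.clm_apply hc).clm_apply hv).neg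
  have h3 := (hΓ.clm_apply hv).clm_apply ((hΓ.clm_apply hc).clm_apply hv)
  have h4 := (hΓ.clm_apply hc).clm_apply ((hΓ.clm_apply hv).clm_apply hv)
  exact (((((hdΓ.clm_apply h1).clm_apply hc).clm_apply hv).sub
    (((hdΓ.clm_apply h2).clm_apply hv).clm_apply hv)).add h3).sub h4

/-- The symbol `Γ` defined by the classical transformation law satisfies the Chern equations of
`g₀`, and these have only one solution. -/
theorem IsTensorChange.chernSymbol_eq (h : IsTensorChange g₀ g₁ Ω₀ Ω₁ ψ V) (hp : p ∈ Ω₀)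
    (u w : E) : fderiv ℝ ψ p.1 (chernSymbol g₀ p u w) =
      chernSymbol g₁ (ψ p.1, fderiv ℝ ψ p.1 p.2) (fderiv ℝ ψ p.1 u) (fderiv ℝ ψ p.1 w)
        + fderiv ℝ (fderiv ℝ ψ) p.1 u w := by
  have hV := h.fst_mem p hp
  let e : E ≃L[ℝ] E := (LinearEquiv.ofInjectiveEndo (fderiv ℝ ψ p.1 : E →ₗ[ℝ] E)
    (h.injective _ hV)).toContinuousLinearEquiv
  have he : ∀ u, e u = fderiv ℝ ψ p.1 u := fun u => rfl
  set q : E × E := (ψ p.1, fderiv ℝ ψ p.1 p.2) with hq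
  let Γ : E →L[ℝ] E →L[ℝ] E := (ContinuousLinearMap.compL ℝ E E E (e.symm : E →L[ℝ] E)) ∘L
    ((chernSymbol g₁ q).bilinearComp (fderiv ℝ ψ p.1) (fderiv ℝ ψ p.1)
      + fderiv ℝ (fderiv ℝ ψ) p.1)
  have hΓ : ∀ u w, fderiv ℝ ψ p.1 (Γ u w) =
      chernSymbol g₁ q (fderiv ℝ ψ p.1 u) (fderiv ℝ ψ p.1 w) + fderiv ℝ (fderiv ℝ ψ) p.1 u w :=
    fun u w => e.apply_symm_apply _
  suffices IsChern g₀ p Γ by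
    rw [(h.left.isChern_chernSymbol hp).unique h.left hp this, hΓ]
  have hq1 := h.mem p hp
  refine ⟨fun u w => h.injective _ hV ?_, fun u w z => ?_⟩
  · rw [hΓ, hΓ, h.right.chernSymbol_comm hq1, h.fderiv_fderiv_comm hV]
  · obtain ⟨L, hL, hL'⟩ := h.hasFDerivAt_tangent hV
    -- The second derivative of `ψ` in the law cancels that of the tangent map, so horizontal lifts
    -- go to horizontal lifts and the metric equation of `g₁` can be used.
    have hLu : L (u, -Γ u p.2) = horizLift g₁ q (fderiv ℝ ψ p.1 u) := by
      rw [hL', map_neg, hΓ, horizLift]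
      simp [hq]
    have hB := HasFDerivAt.comp p (h.hasFDerivAt_fderiv hV) hasFDerivAt_fst
    have h1 : HasFDerivAt (fun r : E × E => g₁ (ψ r.1, fderiv ℝ ψ r.1 r.2)
        (fderiv ℝ ψ r.1 w) (fderiv ℝ ψ r.1 z)) _ p :=
      ((HasFDerivAt.comp p (h.right.differentiableAt hq1).hasFDerivAt hL).clm_apply
        (hB.clm_apply (hasFDerivAt_const w p))).clm_apply (hB.clm_apply (hasFDerivAt_const z p))
    have h2 : (fun r => g₀ r w z) =ᶠ[𝓝 p] fun r : E × E => g₁ (ψ r.1, fderiv ℝ ψ r.1 r.2)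
        (fderiv ℝ ψ r.1 w) (fderiv ℝ ψ r.1 z) := by
      filter_upwards [h.left.isOpen.mem_nhds hp] with r hr
      exact h.tensor r hr w z
    have h3 := (HasFDerivAt.apply_two (h.left.differentiableAt hp).hasFDerivAt w z).unique
      (h1.congr_of_eventuallyEq h2)
    have h4 := congrArg (fun M => M (u, -Γ u p.2)) h3
    simp only [ContinuousLinearMap.flip_apply, add_apply, ContinuousLinearMap.comp_apply, hLu,
      Function.comp_apply] at h4
    simp only [zero_apply, map_zero, zero_add, ContinuousLinearMap.coe_fst']
      at h4
    rw [← hq, h.right.fderiv_horizLift hq1] at h4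
    rw [h.tensor p hp, h.tensor p hp, hΓ, hΓ, h4, ← hq]
    simp only [map_add, add_apply]
    ring

theorem IsTensorChange.map_horizLift (h : IsTensorChange g₀ g₁ Ω₀ Ω₁ ψ V) (hp : p ∈ Ω₀)
    {L : E × E →L[ℝ] E × E} (hL : ∀ a b, L (a, b) =
      (fderiv ℝ ψ p.1 a, fderiv ℝ ψ p.1 b + fderiv ℝ (fderiv ℝ ψ) p.1 a p.2)) (u : E) :
    L (horizLift g₀ p u) = horizLift g₁ (ψ p.1, fderiv ℝ ψ p.1 p.2) (fderiv ℝ ψ p.1 u) := by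
  rw [horizLift, hL, map_neg, h.chernSymbol_eq hp, horizLift]
  simp

/-- The transformation law, differentiated along a horizontal lift, which the tangent map sends to a
horizontal lift. -/
theorem IsTensorChange.fderiv_chernSymbol_eq (h : IsTensorChange g₀ g₁ Ω₀ Ω₁ ψ V) (hp : p ∈ Ω₀)
    (u w z : E) : fderiv ℝ ψ p.1 (fderiv ℝ (chernSymbol g₀) p (horizLift g₀ p u) w z) +
        fderiv ℝ (fderiv ℝ ψ) p.1 u (chernSymbol g₀ p w z) =
      fderiv ℝ (chernSymbol g₁) (ψ p.1, fderiv ℝ ψ p.1 p.2)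
        (horizLift g₁ (ψ p.1, fderiv ℝ ψ p.1 p.2) (fderiv ℝ ψ p.1 u)) (fderiv ℝ ψ p.1 w)
          (fderiv ℝ ψ p.1 z)
      + chernSymbol g₁ (ψ p.1, fderiv ℝ ψ p.1 p.2) (fderiv ℝ (fderiv ℝ ψ) p.1 u w)
          (fderiv ℝ ψ p.1 z)
      + chernSymbol g₁ (ψ p.1, fderiv ℝ ψ p.1 p.2) (fderiv ℝ ψ p.1 w)
          (fderiv ℝ (fderiv ℝ ψ) p.1 u z)
      + fderiv ℝ (fderiv ℝ (fderiv ℝ ψ)) p.1 u w z := by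
  have hV := h.fst_mem p hp
  have hq1 := h.mem p hp
  obtain ⟨L, hL, hL'⟩ := h.hasFDerivAt_tangent hV
  have hLu := h.map_horizLift hp hL' u
  have hB := HasFDerivAt.comp p (h.hasFDerivAt_fderiv hV) hasFDerivAt_fst
  have hB2 := HasFDerivAt.comp p (h.hasFDerivAt_fderiv_fderiv hV) hasFDerivAt_fst
  have h1 : HasFDerivAt (fun r : E × E => chernSymbol g₁ (ψ r.1, fderiv ℝ ψ r.1 r.2)
      (fderiv ℝ ψ r.1 w) (fderiv ℝ ψ r.1 z) + fderiv ℝ (fderiv ℝ ψ) r.1 w z) _ p :=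
    (((HasFDerivAt.comp p (h.right.differentiableAt_chernSymbol hq1).hasFDerivAt hL).clm_apply
      (hB.clm_apply (hasFDerivAt_const w p))).clm_apply
        (hB.clm_apply (hasFDerivAt_const z p))).add (HasFDerivAt.apply_two hB2 w z)
  have h0 : HasFDerivAt (fun r : E × E => fderiv ℝ ψ r.1 (chernSymbol g₀ r w z)) _ p :=
    hB.clm_apply (HasFDerivAt.apply_two (h.left.differentiableAt_chernSymbol hp).hasFDerivAt w z)
  have h2 : (fun r : E × E => fderiv ℝ ψ r.1 (chernSymbol g₀ r w z)) =ᶠ[𝓝 p]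
      fun r : E × E => chernSymbol g₁ (ψ r.1, fderiv ℝ ψ r.1 r.2)
        (fderiv ℝ ψ r.1 w) (fderiv ℝ ψ r.1 z) + fderiv ℝ (fderiv ℝ ψ) r.1 w z := by
    filter_upwards [h.left.isOpen.mem_nhds hp] with r hr
    exact h.chernSymbol_eq hr w z
  have h4 := congrArg (fun M => M (horizLift g₀ p u)) (h0.unique (h1.congr_of_eventuallyEq h2))
  simp only [ContinuousLinearMap.flip_apply, add_apply, ContinuousLinearMap.comp_apply, hLu,
    Function.comp_apply, zero_apply, map_zero, zero_add,
    ContinuousLinearMap.coe_fst'] at h4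
  change _ + fderiv ℝ (fderiv ℝ ψ) p.1 u (chernSymbol g₀ p w z) =
    chernSymbol g₁ _ _ (fderiv ℝ (fderiv ℝ ψ) p.1 u z) +
      (chernSymbol g₁ _ (fderiv ℝ (fderiv ℝ ψ) p.1 u w) _ + _) +
        fderiv ℝ (fderiv ℝ (fderiv ℝ ψ)) p.1 u w z at h4
  rw [h4]
  abel

/-- The curvature is a tensor. -/
theorem IsTensorChange.chernCurv_eq (h : IsTensorChange g₀ g₁ Ω₀ Ω₁ ψ V) (hp : p ∈ Ω₀)
    (u w z : E) : fderiv ℝ ψ p.1 (chernCurv g₀ p u w z) =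
      chernCurv g₁ (ψ p.1, fderiv ℝ ψ p.1 p.2) (fderiv ℝ ψ p.1 u) (fderiv ℝ ψ p.1 w)
        (fderiv ℝ ψ p.1 z) := by
  have hV := h.fst_mem p hp
  have e1 := eq_sub_of_add_eq (h.fderiv_chernSymbol_eq hp u w z)
  have e2 := eq_sub_of_add_eq (h.fderiv_chernSymbol_eq hp w u z)
  -- All terms with second and third derivatives of `ψ` are symmetric in `u, w` or occur in
  -- cancelling pairs.
  have e3 : fderiv ℝ (fderiv ℝ (fderiv ℝ ψ)) p.1 u w = fderiv ℝ (fderiv ℝ (fderiv ℝ ψ)) p.1 w u :=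
    ((h.contDiffAt_fderiv hV).isSymmSndFDerivAt minSmoothness_two_le_infty).eq u w
  simp only [chernCurv, map_add, map_sub, e1, e2, h.chernSymbol_eq hp, e3,
    h.fderiv_fderiv_comm hV w u]
  abel

theorem IsTensorChange.jacobiOp_eq (h : IsTensorChange g₀ g₁ Ω₀ Ω₁ ψ V) (hp : p ∈ Ω₀) (w : E) :
    fderiv ℝ ψ p.1 (jacobiOp g₀ p w) =
      jacobiOp g₁ (ψ p.1, fderiv ℝ ψ p.1 p.2) (fderiv ℝ ψ p.1 w) :=
  h.chernCurv_eq hp _ _ _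

end Curvature

end FinslerIndex

end

noncomputable section

namespace FinslerIndex

section Charts

open Set

variable {E : Type*} [NormedAddCommGroup E] [NormedSpace ℝ E]
  {M : Type*} [TopologicalSpace M] [ChartedSpace E M]

/-! ### Finsler metrics in charts -/

theorem fundTensor_comp_linear {W W' : Type*} [AddCommGroup W] [Module ℝ W] [AddCommGroup W']
    [Module ℝ W'] (Q : W' → ℝ) (L : W →ₗ[ℝ] W') (v u w : W) :
    fundTensor (fun y => Q (L y)) v u w = fundTensor Q (L v) (L u) (L w) := by
  simp only [fundTensor, map_add, map_smul]

/-- The set where the change of coordinates between two charts is defined. -/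
def overlap (x₀ x₁ : M) : Set E :=
  (extChartAt 𝓘(ℝ, E) x₀).target ∩
    (extChartAt 𝓘(ℝ, E) x₀).symm ⁻¹' (extChartAt 𝓘(ℝ, E) x₁).source

/-- The change of coordinates between two charts. -/
def transition (x₀ x₁ : M) : E → E :=
  extChartAt 𝓘(ℝ, E) x₁ ∘ (extChartAt 𝓘(ℝ, E) x₀).symm

theorem isOpen_overlap (x₀ x₁ : M) : IsOpen (overlap (E := E) x₀ x₁) :=
  (continuousOn_extChartAt_symm x₀).isOpen_inter_preimage (isOpen_extChartAt_target x₀)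
    (isOpen_extChartAt_source x₁)

theorem extChartAt_mem_overlap {x₀ x₁ z : M} (h₀ : z ∈ (extChartAt 𝓘(ℝ, E) x₀).source)
    (h₁ : z ∈ (extChartAt 𝓘(ℝ, E) x₁).source) :
    extChartAt 𝓘(ℝ, E) x₀ z ∈ overlap (E := E) x₀ x₁ :=
  ⟨(extChartAt 𝓘(ℝ, E) x₀).map_source h₀, by
    rw [mem_preimage, (extChartAt 𝓘(ℝ, E) x₀).left_inv h₀]; exact h₁⟩

theorem exists_of_mem_overlap {x₀ x₁ : M} {x : E} (h : x ∈ overlap (E := E) x₀ x₁) :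
    ∃ z, z ∈ (extChartAt 𝓘(ℝ, E) x₀).source ∧ z ∈ (extChartAt 𝓘(ℝ, E) x₁).source ∧
      x = extChartAt 𝓘(ℝ, E) x₀ z :=
  ⟨_, (extChartAt 𝓘(ℝ, E) x₀).map_target h.1, h.2, ((extChartAt 𝓘(ℝ, E) x₀).right_inv h.1).symm⟩

theorem transition_extChartAt {x₀ x₁ z : M} (h₀ : z ∈ (extChartAt 𝓘(ℝ, E) x₀).source) :
    transition (E := E) x₀ x₁ (extChartAt 𝓘(ℝ, E) x₀ z) = extChartAt 𝓘(ℝ, E) x₁ z := by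
  rw [transition, Function.comp_apply, (extChartAt 𝓘(ℝ, E) x₀).left_inv h₀]

variable [IsManifold 𝓘(ℝ, E) ∞ M]

theorem contDiffOn_transition (x₀ x₁ : M) :
    ContDiffOn ℝ ∞ (transition (E := E) x₀ x₁) (overlap x₀ x₁) :=
  contDiffOn_ext_coord_change (I := 𝓘(ℝ, E)) x₁ x₀

theorem fderiv_transition {x₀ x₁ z : M} (h₀ : z ∈ (extChartAt 𝓘(ℝ, E) x₀).source)
    (h₁ : z ∈ (extChartAt 𝓘(ℝ, E) x₁).source) :
    fderiv ℝ (transition (E := E) x₀ x₁) (extChartAt 𝓘(ℝ, E) x₀ z) =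
      tangentCoordChange 𝓘(ℝ, E) x₀ x₁ z := by
  have := hasFDerivWithinAt_tangentCoordChange (I := 𝓘(ℝ, E)) ⟨h₀, h₁⟩
  rw [modelWithCornersSelf_coe, range_id, hasFDerivWithinAt_univ] at this
  exact this.fderiv

theorem tangentCoordChange_leftInverse {x₀ x₁ z : M} (h₀ : z ∈ (extChartAt 𝓘(ℝ, E) x₀).source)
    (h₁ : z ∈ (extChartAt 𝓘(ℝ, E) x₁).source) (v : E) :
    tangentCoordChange 𝓘(ℝ, E) x₁ x₀ z (tangentCoordChange 𝓘(ℝ, E) x₀ x₁ z v) = v := by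
  rw [tangentCoordChange_comp ⟨⟨h₀, h₁⟩, h₀⟩, tangentCoordChange_self h₀]

theorem tangentCoordChange_injective {x₀ x₁ z : M} (h₀ : z ∈ (extChartAt 𝓘(ℝ, E) x₀).source)
    (h₁ : z ∈ (extChartAt 𝓘(ℝ, E) x₁).source) :
    Function.Injective (tangentCoordChange 𝓘(ℝ, E) x₀ x₁ z) :=
  Function.LeftInverse.injective (tangentCoordChange_leftInverse h₀ h₁)

variable {F : TangentBundle 𝓘(ℝ, E) M → ℝ}

theorem coordSq_extChartAt {x₀ z : M} (h : z ∈ (extChartAt 𝓘(ℝ, E) x₀).source) (y : E) :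
    coordSq F x₀ (extChartAt 𝓘(ℝ, E) x₀ z) y =
      F ⟨z, tangentCoordChange 𝓘(ℝ, E) x₀ z z y⟩ ^ 2 := by
  unfold coordSq
  rw [(extChartAt 𝓘(ℝ, E) x₀).left_inv h]

theorem coordSq_transition {x₀ x₁ : M} {x : E} (h : x ∈ overlap x₀ x₁) (y : E) :
    coordSq F x₀ x y =
      coordSq F x₁ (transition x₀ x₁ x) (fderiv ℝ (transition x₀ x₁) x y) := by
  obtain ⟨z, h₀, h₁, rfl⟩ := exists_of_mem_overlap h
  rw [transition_extChartAt h₀, fderiv_transition h₀ h₁, coordSq_extChartAt h₀,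
    coordSq_extChartAt h₁, tangentCoordChange_comp ⟨⟨h₀, h₁⟩, mem_extChartAt_source z⟩]

/-- The map is the inverse trivialization of the tangent bundle composed with the inverse chart. -/
theorem contMDiffOn_tangent_symm (x₀ : M) :
    ContMDiffOn (𝓘(ℝ, E × E)) (𝓘(ℝ, E).tangent) ∞
      (fun p : E × E => (⟨(extChartAt 𝓘(ℝ, E) x₀).symm p.1,
        tangentCoordChange 𝓘(ℝ, E) x₀ ((extChartAt 𝓘(ℝ, E) x₀).symm p.1)
          ((extChartAt 𝓘(ℝ, E) x₀).symm p.1) p.2⟩ : TangentBundle 𝓘(ℝ, E) M))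
      ((extChartAt 𝓘(ℝ, E) x₀).target ×ˢ univ) := by
  have h1 := (trivializationAt E (TangentSpace 𝓘(ℝ, E)) x₀).contMDiffOn_symm (IB := 𝓘(ℝ, E))
    (n := ∞)
  have h2 : ContMDiffOn (𝓘(ℝ, E × E)) (𝓘(ℝ, E).prod 𝓘(ℝ, E)) ∞
      (fun p : E × E => ((extChartAt 𝓘(ℝ, E) x₀).symm p.1, p.2))
      ((extChartAt 𝓘(ℝ, E) x₀).target ×ˢ univ) := by
    have h3 : ContMDiffOn (𝓘(ℝ, E × E)) 𝓘(ℝ, E) ∞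
        (fun p : E × E => (extChartAt 𝓘(ℝ, E) x₀).symm p.1)
        ((extChartAt 𝓘(ℝ, E) x₀).target ×ˢ univ) :=
      (contMDiffOn_extChartAt_symm x₀).comp contDiff_fst.contMDiff.contMDiffOn fun p hp => hp.1
    exact h3.prodMk contDiff_snd.contMDiff.contMDiffOn
  refine (h1.comp h2 fun p hp => ?_).congr fun p hp => ?_
  · rw [mem_preimage, TangentBundle.trivializationAt_target]
    refine ⟨?_, trivial⟩
    rw [← extChartAt_source 𝓘(ℝ, E)]
    exact (extChartAt 𝓘(ℝ, E) x₀).map_target hp.1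
  · rw [Function.comp_apply, TangentBundle.trivializationAt_eq_localTriv]
    rfl

theorem IsFinslerMetric.isFinslerSq (hF : IsFinslerMetric F) (x₀ : M) :
    IsFinslerSq (coordSq F x₀) (extChartAt 𝓘(ℝ, E) x₀).target := by
  have hz : ∀ x ∈ (extChartAt 𝓘(ℝ, E) x₀).target, ∃ z, z ∈ (extChartAt 𝓘(ℝ, E) x₀).source ∧
      x = extChartAt 𝓘(ℝ, E) x₀ z := fun x hx =>
    ⟨_, (extChartAt 𝓘(ℝ, E) x₀).map_target hx, ((extChartAt 𝓘(ℝ, E) x₀).right_inv hx).symm⟩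
  refine ⟨isOpen_extChartAt_target x₀, ?_, fun x hx y r hr => ?_, fun x hx v u hv hu => ?_⟩
  · rw [← contMDiffOn_iff_contDiffOn]
    have h1 : ContMDiffOn (𝓘(ℝ, E × E)) 𝓘(ℝ, ℝ) ∞ _ (slit (extChartAt 𝓘(ℝ, E) x₀).target) :=
      hF.smooth.comp ((contMDiffOn_tangent_symm x₀).mono (prod_mono le_rfl (subset_univ _)))
      fun p hp => by
        obtain ⟨z, hz, hpz⟩ := hz p.1 hp.1
        have h0 : tangentCoordChange 𝓘(ℝ, E) x₀ z z p.2 ≠ 0 := fun h0 =>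
          hp.2 (tangentCoordChange_injective hz (mem_extChartAt_source z) (by rw [h0, map_zero]))
        change tangentCoordChange 𝓘(ℝ, E) x₀ ((extChartAt 𝓘(ℝ, E) x₀).symm p.1)
          ((extChartAt 𝓘(ℝ, E) x₀).symm p.1) p.2 ≠ 0
        rw [hpz, (extChartAt 𝓘(ℝ, E) x₀).left_inv hz]
        exact h0
    have h2 : ContMDiff 𝓘(ℝ, ℝ) 𝓘(ℝ, ℝ) ∞ fun r : ℝ => r ^ 2 := (contDiff_id.pow 2).contMDiff
    exact h2.comp_contMDiffOn h1
  · obtain ⟨z, hz, rfl⟩ := hz x hx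
    rw [coordSq_extChartAt hz, coordSq_extChartAt hz, map_smul, ← mul_pow]
    congr 1
    exact hF.homogeneous z _ r hr
  · obtain ⟨z, hz, rfl⟩ := hz x hx
    have hinj := tangentCoordChange_injective (E := E) hz (mem_extChartAt_source z)
    have h1 : coordSq F x₀ (extChartAt 𝓘(ℝ, E) x₀ z) = fun y =>
        (fun y : TangentSpace 𝓘(ℝ, E) z => F ⟨z, y⟩ ^ 2)
          ((tangentCoordChange 𝓘(ℝ, E) x₀ z z : E →ₗ[ℝ] E) y) :=
      funext fun y => coordSq_extChartAt hz y
    rw [h1]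
    have h2 := fundTensor_comp_linear (W := E) (W' := TangentSpace 𝓘(ℝ, E) z)
      (fun y : TangentSpace 𝓘(ℝ, E) z => F ⟨z, y⟩ ^ 2)
      (tangentCoordChange 𝓘(ℝ, E) x₀ z z : E →ₗ[ℝ] E) v u u
    refine lt_of_lt_of_eq (hF.strongly_convex z _ _ (fun h => hv (hinj ?_)) fun h => hu (hinj ?_))
      h2.symm
    · rw [map_zero]; exact h
    · rw [map_zero]; exact h

theorem IsFinslerSq.mono {Q : E → E → ℝ} {U V : Set E} (h : IsFinslerSq Q U) (hV : IsOpen V)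
    (hVU : V ⊆ U) : IsFinslerSq Q V where
  isOpen := hV
  smooth := h.smooth.mono (prod_mono hVU le_rfl)
  homogeneous x hx := h.homogeneous x (hVU hx)
  convex x hx := h.convex x (hVU hx)

/-- The fundamental tensor in the chart at `x₀`. -/
def chartTensor (F : TangentBundle 𝓘(ℝ, E) M → ℝ) (x₀ : M) : E × E → E →L[ℝ] E →L[ℝ] ℝ :=
  vertHess (coordSq F x₀)

/-- `F²` in the two charts differs by the tangent map of the transition, which is linear in the
fibre; hence so do its vertical Hessians. -/
theorem IsFinslerMetric.isTensorChange (hF : IsFinslerMetric F) (x₀ x₁ : M) :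
    IsTensorChange (chartTensor F x₀) (chartTensor F x₁) (slit (overlap x₀ x₁))
      (slit (extChartAt 𝓘(ℝ, E) x₁).target) (transition x₀ x₁) (overlap x₀ x₁) := by
  have h0 := (hF.isFinslerSq x₀).mono (isOpen_overlap x₀ x₁) inter_subset_left
  have h1 := hF.isFinslerSq x₁
  have hinj : ∀ x ∈ overlap x₀ x₁, Function.Injective (fderiv ℝ (transition (E := E) x₀ x₁) x) := by
    intro x hx
    obtain ⟨z, h₀, h₁, rfl⟩ := exists_of_mem_overlap hx
    rw [fderiv_transition h₀ h₁]
    exact tangentCoordChange_injective h₀ h₁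
  have hmem : ∀ p ∈ slit (overlap x₀ x₁), (transition x₀ x₁ p.1,
      fderiv ℝ (transition x₀ x₁) p.1 p.2) ∈ slit (extChartAt 𝓘(ℝ, E) x₁).target := by
    intro p hp
    refine ⟨(extChartAt 𝓘(ℝ, E) x₁).map_source hp.1.2, fun h => hp.2 (hinj p.1 hp.1 ?_)⟩
    rw [map_zero]
    exact h
  refine ⟨h0.isFinslerTensor, h1.isFinslerTensor, isOpen_overlap _ _, contDiffOn_transition _ _,
    fun p hp => hp.1, hmem, hinj, fun p hp u w => ?_⟩
  rw [chartTensor, chartTensor, ← h0.fundTensor_eq hp, ← h1.fundTensor_eq (hmem p hp)]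
  rw [show coordSq F x₀ p.1 = fun y => coordSq F x₁ (transition x₀ x₁ p.1)
    ((fderiv ℝ (transition x₀ x₁) p.1 : E →ₗ[ℝ] E) y) from
    funext fun y => coordSq_transition hp.1 y, fundTensor_comp_linear]
  rfl

end Charts

end FinslerIndex

end

noncomputable section

namespace FinslerIndex

section Along

open Set

set_option maxSynthPendingDepth 3

variable {E : Type*} [NormedAddCommGroup E] [NormedSpace ℝ E]
  {M : Type*} [TopologicalSpace M] [ChartedSpace E M]
  {F : TangentBundle 𝓘(ℝ, E) M → ℝ} {c : ℝ → M}

/-! ### Fields along a curve in charts -/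

/-- The times at which the curve `c` is in the chart at `c t₀`. -/
def chartTimes (E : Type*) [NormedAddCommGroup E] [NormedSpace ℝ E] {M : Type*}
    [TopologicalSpace M] [ChartedSpace E M] (c : ℝ → M) (t₀ : ℝ) : Set ℝ :=
  c ⁻¹' (extChartAt 𝓘(ℝ, E) (c t₀)).source

theorem mem_chartTimes_self (t : ℝ) : t ∈ chartTimes E c t := mem_extChartAt_source (c t)

theorem isOpen_chartTimes (hc : Continuous c) (t₀ : ℝ) : IsOpen (chartTimes E c t₀) :=
  (isOpen_extChartAt_source (c t₀)).preimage hc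

theorem coordCurve_change {t₀ t₁ s : ℝ} (h₀ : s ∈ chartTimes E c t₀) :
    coordCurve c t₁ s = transition (E := E) (c t₀) (c t₁) (coordCurve c t₀ s) :=
  (transition_extChartAt h₀).symm

theorem coordCurve_mem_overlap {t₀ t₁ s : ℝ} (h₀ : s ∈ chartTimes E c t₀)
    (h₁ : s ∈ chartTimes E c t₁) : coordCurve c t₀ s ∈ overlap (E := E) (c t₀) (c t₁) :=
  extChartAt_mem_overlap h₀ h₁

variable [IsManifold 𝓘(ℝ, E) ∞ M]

/-- The velocity of `c` as a curve in the tangent bundle, in the chart at `c t₀`. -/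
def tangentCurve (c : ℝ → M) (t₀ s : ℝ) : E × E :=
  (coordCurve c t₀ s, coordField c (velocity c) t₀ s)

theorem coordField_self (V : FieldAlong (E := E) c) (t : ℝ) : coordField c V t t = V t :=
  tangentCoordChange_self (mem_extChartAt_source (c t))

theorem coordField_change {t₀ t₁ s : ℝ} (h₀ : s ∈ chartTimes E c t₀) (h₁ : s ∈ chartTimes E c t₁)
    (V : FieldAlong (E := E) c) : coordField c V t₁ s =
      fderiv ℝ (transition (c t₀) (c t₁)) (coordCurve c t₀ s) (coordField c V t₀ s) := by
  rw [coordCurve, fderiv_transition h₀ h₁]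
  exact (tangentCoordChange_comp ⟨⟨mem_extChartAt_source (c s), h₀⟩, h₁⟩).symm

theorem contDiffOn_coordCurve (hc : ContMDiff 𝓘(ℝ, ℝ) 𝓘(ℝ, E) ∞ c) (t₀ : ℝ) :
    ContDiffOn ℝ ∞ (coordCurve (E := E) c t₀) (chartTimes E c t₀) := by
  rw [← contMDiffOn_iff_contDiffOn]
  exact (contMDiffOn_extChartAt (x := c t₀)).comp hc.contMDiffOn fun s hs => by
    rw [← extChartAt_source 𝓘(ℝ, E)]; exact hs

theorem hasDerivAt_coordCurve (hc : ContMDiff 𝓘(ℝ, ℝ) 𝓘(ℝ, E) ∞ c) {t₀ s : ℝ}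
    (hs : s ∈ chartTimes E c t₀) :
    HasDerivAt (coordCurve (E := E) c t₀) (coordField c (velocity c) t₀ s) s := by
  have h1 : HasDerivAt (coordCurve (E := E) c s) (velocity (E := E) c s) s := by
    obtain ⟨L, hL, h2⟩ : ∃ L : ℝ →L[ℝ] E, L 1 = velocity (E := E) c s ∧
        HasFDerivWithinAt (coordCurve (E := E) c s) L (range 𝓘(ℝ, ℝ)) s :=
      ⟨mfderiv 𝓘(ℝ, ℝ) 𝓘(ℝ, E) c s, rfl, ((hc.mdifferentiable (by simp)) s).hasMFDerivAt.2⟩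
    rw [modelWithCornersSelf_coe, range_id, hasFDerivWithinAt_univ] at h2
    rw [← hL]
    exact h2.hasDerivAt
  have hss := mem_chartTimes_self (E := E) (c := c) s
  have h3 : HasFDerivAt (transition (E := E) (c s) (c t₀)) _ (coordCurve c s s) :=
    (((contDiffOn_transition (c s) (c t₀)).contDiffAt ((isOpen_overlap _ _).mem_nhds
      (coordCurve_mem_overlap hss hs))).differentiableAt (by simp)).hasFDerivAt
  have h4 := h3.comp_hasDerivAt s h1
  rw [coordField_change hss hs, coordField_self]
  refine h4.congr_of_eventuallyEq ?_
  filter_upwards [(isOpen_chartTimes hc.continuous s).mem_nhds hss] with r hr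
  exact coordCurve_change hr

theorem contDiffOn_coordVelocity (hc : ContMDiff 𝓘(ℝ, ℝ) 𝓘(ℝ, E) ∞ c) (t₀ : ℝ) :
    ContDiffOn ℝ ∞ (coordField (E := E) c (velocity c) t₀) (chartTimes E c t₀) :=
  ((contDiffOn_coordCurve hc t₀).deriv_of_isOpen (isOpen_chartTimes hc.continuous t₀)
    (by simp)).congr fun _ hs => (hasDerivAt_coordCurve hc hs).deriv.symm

theorem contDiffOn_tangentCurve (hc : ContMDiff 𝓘(ℝ, ℝ) 𝓘(ℝ, E) ∞ c) (t₀ : ℝ) :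
    ContDiffOn ℝ ∞ (tangentCurve (E := E) c t₀) (chartTimes E c t₀) :=
  (contDiffOn_coordCurve hc t₀).prodMk (contDiffOn_coordVelocity hc t₀)

theorem coordField_ne_zero {V : FieldAlong (E := E) c} {t₀ s : ℝ} (hs : s ∈ chartTimes E c t₀)
    (hV : V s ≠ 0) : coordField c V t₀ s ≠ 0 := fun h =>
  hV (tangentCoordChange_injective (mem_extChartAt_source (c s)) hs (h.trans (map_zero _).symm))

theorem tangentCurve_mem_slit (hr : ∀ t, velocity (E := E) c t ≠ 0) {t₀ t₁ s : ℝ}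
    (h₀ : s ∈ chartTimes E c t₀) (h₁ : s ∈ chartTimes E c t₁) :
    tangentCurve (E := E) c t₀ s ∈ slit (overlap (E := E) (c t₀) (c t₁)) :=
  ⟨coordCurve_mem_overlap h₀ h₁, coordField_ne_zero h₀ (hr s)⟩

theorem tangentCurve_mem (hr : ∀ t, velocity (E := E) c t ≠ 0) {t₀ s : ℝ}
    (h₀ : s ∈ chartTimes E c t₀) :
    tangentCurve (E := E) c t₀ s ∈ slit (extChartAt 𝓘(ℝ, E) (c t₀)).target :=
  ⟨(extChartAt 𝓘(ℝ, E) (c t₀)).map_source h₀, coordField_ne_zero h₀ (hr s)⟩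

theorem tangentCurve_change {t₀ t₁ s : ℝ} (h₀ : s ∈ chartTimes E c t₀)
    (h₁ : s ∈ chartTimes E c t₁) : tangentCurve (E := E) c t₁ s =
      (transition (c t₀) (c t₁) (tangentCurve c t₀ s).1,
        fderiv ℝ (transition (c t₀) (c t₁)) (tangentCurve c t₀ s).1 (tangentCurve c t₀ s).2) :=
  Prod.ext (coordCurve_change h₀) (coordField_change h₀ h₁ _)

theorem hasDerivAt_fderiv_transition (hc : ContMDiff 𝓘(ℝ, ℝ) 𝓘(ℝ, E) ∞ c) {t₀ t₁ s : ℝ}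
    (h₀ : s ∈ chartTimes E c t₀) (h₁ : s ∈ chartTimes E c t₁) :
    HasDerivAt (fun r => fderiv ℝ (transition (E := E) (c t₀) (c t₁)) (coordCurve c t₀ r))
      (fderiv ℝ (fderiv ℝ (transition (c t₀) (c t₁))) (coordCurve c t₀ s)
        (coordField c (velocity c) t₀ s)) s := by
  have h1 : ContDiffAt ℝ ∞ (transition (E := E) (c t₀) (c t₁)) (coordCurve c t₀ s) :=
    (contDiffOn_transition (c t₀) (c t₁)).contDiffAt ((isOpen_overlap _ _).mem_nhds
      (coordCurve_mem_overlap h₀ h₁))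
  have h2 := ((h1.fderiv_right (m := ∞) (by simp)).differentiableAt (by simp)).hasFDerivAt
  exact h2.comp_hasDerivAt s (hasDerivAt_coordCurve hc h₀)

theorem coordField_change_eventuallyEq (hc : Continuous c) {t₀ t₁ s : ℝ}
    (h₀ : s ∈ chartTimes E c t₀) (h₁ : s ∈ chartTimes E c t₁) (V : FieldAlong (E := E) c) :
    coordField c V t₁ =ᶠ[𝓝 s] fun r =>
      fderiv ℝ (transition (c t₀) (c t₁)) (coordCurve c t₀ r) (coordField c V t₀ r) := by
  filter_upwards [(isOpen_chartTimes hc t₀).mem_nhds h₀,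
    (isOpen_chartTimes hc t₁).mem_nhds h₁] with r hr₀ hr₁
  exact coordField_change hr₀ hr₁ V

theorem hasDerivAt_coordField_change (hc : ContMDiff 𝓘(ℝ, ℝ) 𝓘(ℝ, E) ∞ c) {t₀ t₁ s : ℝ}
    (h₀ : s ∈ chartTimes E c t₀) (h₁ : s ∈ chartTimes E c t₁) {V : FieldAlong (E := E) c} {y : E}
    (hV : HasDerivAt (coordField c V t₀) y s) :
    HasDerivAt (coordField c V t₁)
      (fderiv ℝ (fderiv ℝ (transition (c t₀) (c t₁))) (coordCurve c t₀ s)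
          (coordField c (velocity c) t₀ s) (coordField c V t₀ s)
        + fderiv ℝ (transition (c t₀) (c t₁)) (coordCurve c t₀ s) y) s :=
  ((hasDerivAt_fderiv_transition hc h₀ h₁).clm_apply hV).congr_of_eventuallyEq
    (coordField_change_eventuallyEq hc.continuous h₀ h₁ V)

/-- A field along `c` is differentiable at `s`. -/
def DiffAlong (c : ℝ → M) (V : FieldAlong (E := E) c) (s : ℝ) : Prop :=
  DifferentiableAt ℝ (coordField c V s) s

theorem DiffAlong.differentiableAt (hc : IsClosedGeodesic F c) {V : FieldAlong (E := E) c} {t₀ s : ℝ}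
    (hV : DiffAlong c V s) (h₀ : s ∈ chartTimes E c t₀) :
    DifferentiableAt ℝ (coordField c V t₀) s :=
  (hasDerivAt_coordField_change hc.smooth (mem_chartTimes_self s) h₀
    hV.hasDerivAt).differentiableAt

/-! ### The metric along the curve -/

theorem gT_eq (hF : IsFinslerMetric F) (hc : IsClosedGeodesic F c) (V W : FieldAlong (E := E) c)
    {t₀ s : ℝ} (h₀ : s ∈ chartTimes E c t₀) :
    gT F c s (V s) (W s) = chartTensor F (c t₀) (tangentCurve c t₀ s) (coordField c V t₀ s)
      (coordField c W t₀ s) := by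
  have hss := mem_extChartAt_source (I := 𝓘(ℝ, E)) (c s)
  have hp := tangentCurve_mem (E := E) hc.regular h₀
  rw [chartTensor, ← (hF.isFinslerSq (c t₀)).fundTensor_eq hp]
  have h1 : coordSq F (c t₀) (tangentCurve c t₀ s).1 = fun y =>
      (fun y : TangentSpace 𝓘(ℝ, E) (c s) => F ⟨c s, y⟩ ^ 2)
        ((tangentCoordChange 𝓘(ℝ, E) (c t₀) (c s) (c s) : E →ₗ[ℝ] E) y) :=
    funext fun y => coordSq_extChartAt h₀ y
  rw [h1]
  have h2 := fundTensor_comp_linear (W := E) (W' := TangentSpace 𝓘(ℝ, E) (c s))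
    (fun y : TangentSpace 𝓘(ℝ, E) (c s) => F ⟨c s, y⟩ ^ 2)
    (tangentCoordChange 𝓘(ℝ, E) (c t₀) (c s) (c s) : E →ₗ[ℝ] E) (tangentCurve c t₀ s).2
    (coordField c V t₀ s) (coordField c W t₀ s)
  have h3 : ∀ U : FieldAlong (E := E) c, tangentCoordChange 𝓘(ℝ, E) (c t₀) (c s) (c s)
      (coordField c U t₀ s) = U s := fun U => tangentCoordChange_leftInverse hss h₀ (U s)
  refine Eq.trans ?_ h2.symm
  change _ = fundTensor (fun y : TangentSpace 𝓘(ℝ, E) (c s) => F ⟨c s, y⟩ ^ 2)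
    (tangentCoordChange 𝓘(ℝ, E) (c t₀) (c s) (c s) (coordField c (velocity c) t₀ s))
    (tangentCoordChange 𝓘(ℝ, E) (c t₀) (c s) (c s) (coordField c V t₀ s))
    (tangentCoordChange 𝓘(ℝ, E) (c t₀) (c s) (c s) (coordField c W t₀ s))
  rw [h3, h3, h3]
  rfl

variable [FiniteDimensional ℝ E]

/-! ### The covariant derivative and the curvature in charts -/

/-- The connection matrix along `c` in the chart at `c t₀`. -/
def connMatrix (F : TangentBundle 𝓘(ℝ, E) M → ℝ) (c : ℝ → M) (t₀ s : ℝ) : E →L[ℝ] E :=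
  chernSymbol (chartTensor F (c t₀)) (tangentCurve c t₀ s) (coordField c (velocity c) t₀ s)

theorem contDiffOn_connMatrix (hF : IsFinslerMetric F) (hc : IsClosedGeodesic F c) (t₀ : ℝ) :
    ContDiffOn ℝ ∞ (connMatrix F c t₀) (chartTimes E c t₀) :=
  (((hF.isFinslerSq (c t₀)).isFinslerTensor.contDiffOn_chernSymbol.comp
    (contDiffOn_tangentCurve hc.smooth t₀) fun _ hs => tangentCurve_mem hc.regular hs)).clm_apply
      (contDiffOn_coordVelocity hc.smooth t₀)

theorem covDeriv_eq (hF : IsFinslerMetric F) (hc : IsClosedGeodesic F c)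
    (V : FieldAlong (E := E) c) (t : ℝ) :
    covDeriv F c V t = (deriv (coordField c V t) t + connMatrix F c t t (coordField c V t t) : E) := by
  have h := (hF.isFinslerSq (c t)).christoffel_eq
    (tangentCurve_mem (E := E) hc.regular (mem_chartTimes_self t))
  have h' : christoffel (coordSq F (c t)) (coordCurve c t t) (coordField c (velocity c) t t) =
    chernSymbol (chartTensor F (c t)) (tangentCurve c t t) := h
  rw [covDeriv, h']
  rfl

/-- `covDeriv` uses a different chart at each time. In one fixed chart it has the same expression:
the second derivative of the transition map in the product rule cancels the one in the law for the
Christoffel symbols. -/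
theorem coordField_covDeriv (hF : IsFinslerMetric F) (hc : IsClosedGeodesic F c)
    {V : FieldAlong (E := E) c} {t₀ s : ℝ} (h₀ : s ∈ chartTimes E c t₀) {y : E}
    (hV : HasDerivAt (coordField c V t₀) y s) :
    coordField c (covDeriv F c V) t₀ s = y + connMatrix F c t₀ s (coordField c V t₀ s) := by
  have hss := mem_chartTimes_self (E := E) (c := c) s
  have h1 := hasDerivAt_coordField_change hc.smooth h₀ hss hV
  have h2 := (hF.isTensorChange (c t₀) (c s)).chernSymbol_eq
    (tangentCurve_mem_slit hc.regular h₀ hss) (coordField c (velocity c) t₀ s)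
    (coordField c V t₀ s)
  rw [← tangentCurve_change h₀ hss] at h2
  change fderiv ℝ (transition (c t₀) (c s)) (coordCurve c t₀ s)
      (connMatrix F c t₀ s (coordField c V t₀ s)) =
    chernSymbol (chartTensor F (c s)) (tangentCurve c s s)
      (fderiv ℝ (transition (c t₀) (c s)) (coordCurve c t₀ s) (coordField c (velocity c) t₀ s))
      (fderiv ℝ (transition (c t₀) (c s)) (coordCurve c t₀ s) (coordField c V t₀ s)) +
    fderiv ℝ (fderiv ℝ (transition (c t₀) (c s))) (coordCurve c t₀ s)
      (coordField c (velocity c) t₀ s) (coordField c V t₀ s) at h2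
  rw [← coordField_change h₀ hss, ← coordField_change h₀ hss] at h2
  have hinj := (hF.isTensorChange (c t₀) (c s)).injective _ (coordCurve_mem_overlap h₀ hss)
  apply hinj
  rw [← coordField_change h₀ hss, coordField_self, covDeriv_eq hF hc, h1.deriv, map_add, h2,
    connMatrix]
  abel

theorem DiffAlong.hasDerivAt (hF : IsFinslerMetric F) (hc : IsClosedGeodesic F c)
    {V : FieldAlong (E := E) c} {t₀ s : ℝ} (hV : DiffAlong c V s) (h₀ : s ∈ chartTimes E c t₀) :
    HasDerivAt (coordField c V t₀) (coordField c (covDeriv F c V) t₀ s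
      - connMatrix F c t₀ s (coordField c V t₀ s)) s := by
  have h := (hV.differentiableAt hc h₀).hasDerivAt
  rw [coordField_covDeriv hF hc h₀ h, add_sub_cancel_right]
  exact h

theorem curvatureAlong_eq (hF : IsFinslerMetric F) (hc : IsClosedGeodesic F c)
    (V : FieldAlong (E := E) c) (t : ℝ) :
    curvatureAlong F c V t = jacobiOp (chartTensor F (c t)) (tangentCurve c t t) (coordField c V t t) :=
  (hF.isFinslerSq (c t)).curvature_eq (tangentCurve_mem (E := E) hc.regular (mem_chartTimes_self t))
    _ _ _

theorem coordField_curvatureAlong (hF : IsFinslerMetric F) (hc : IsClosedGeodesic F c)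
    (V : FieldAlong (E := E) c) {t₀ s : ℝ} (h₀ : s ∈ chartTimes E c t₀) :
    coordField c (curvatureAlong F c V) t₀ s =
      jacobiOp (chartTensor F (c t₀)) (tangentCurve c t₀ s) (coordField c V t₀ s) := by
  have hss := mem_chartTimes_self (E := E) (c := c) s
  have hinj := (hF.isTensorChange (c t₀) (c s)).injective _ (coordCurve_mem_overlap h₀ hss)
  apply hinj
  have h2 := (hF.isTensorChange (c t₀) (c s)).jacobiOp_eq
    (tangentCurve_mem_slit hc.regular h₀ hss) (coordField c V t₀ s)
  rw [← tangentCurve_change h₀ hss] at h2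
  refine Eq.trans ?_ h2.symm
  rw [← coordField_change h₀ hss, coordField_self, curvatureAlong_eq hF hc, coordField_change h₀ hss]
  rfl

/-- Along a geodesic, the covariant derivative is metric. -/
theorem hasDerivAt_gT (hF : IsFinslerMetric F) (hc : IsClosedGeodesic F c)
    {V W : FieldAlong (E := E) c} {s : ℝ} (hV : DiffAlong c V s) (hW : DiffAlong c W s) :
    HasDerivAt (fun r => gT F c r (V r) (W r))
      (gT F c s (covDeriv F c V s) (W s) + gT F c s (V s) (covDeriv F c W s)) s := by
  have hss := mem_chartTimes_self (E := E) (c := c) s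
  have hp := tangentCurve_mem (E := E) hc.regular hss
  have hT : IsFinslerTensor (chartTensor F (c s)) _ := (hF.isFinslerSq (c s)).isFinslerTensor
  have hnhds := (isOpen_chartTimes (E := E) hc.smooth.continuous s).mem_nhds hss
  have hvel : DiffAlong c (velocity (E := E) c) s :=
    ((contDiffOn_coordVelocity hc.smooth s).contDiffAt hnhds).differentiableAt (by simp)
  have h1 := hvel.hasDerivAt hF hc hss
  have h2 : coordField c (covDeriv F c (velocity c)) s s = 0 := by
    rw [coordField_self]
    exact hc.geodesic s
  rw [h2, zero_sub] at h1
  -- The geodesic equation says that the velocity curve in the tangent bundle is horizontal; the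
  -- metric equation along it carries no Cartan term.
  have h3 : HasDerivAt (tangentCurve (E := E) c s)
      (horizLift (chartTensor F (c s)) (tangentCurve c s s) (tangentCurve c s s).2) s :=
    (hasDerivAt_coordCurve hc.smooth hss).prodMk h1
  have h4 := (hT.differentiableAt hp).hasFDerivAt.comp_hasDerivAt s h3
  have h5 := (h4.clm_apply (hV.hasDerivAt hF hc hss)).clm_apply (hW.hasDerivAt hF hc hss)
  have h6 : (fun r => gT F c r (V r) (W r)) =ᶠ[𝓝 s] fun r =>
      chartTensor F (c s) (tangentCurve c s r) (coordField c V s r) (coordField c W s r) := by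
    filter_upwards [hnhds] with r hr
    exact gT_eq hF hc V W hr
  refine (h5.congr_of_eventuallyEq h6).congr_deriv ?_
  have h7 := hT.fderiv_horizLift hp (tangentCurve c s s).2 (coordField c V s s) (coordField c W s s)
  rw [gT_eq hF hc (covDeriv F c V) W hss, gT_eq hF hc V (covDeriv F c W) hss]
  simp only [add_apply, Function.comp_apply, map_sub, sub_apply]
  change fderiv ℝ (chartTensor F (c s)) (tangentCurve c s s) (horizLift _ _ _) _ _ =
    chartTensor F (c s) (tangentCurve c s s) (connMatrix F c s s (coordField c V s s)) _ +
    chartTensor F (c s) (tangentCurve c s s) _ (connMatrix F c s s (coordField c W s s)) at h7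
  change fderiv ℝ (chartTensor F (c s)) (tangentCurve c s s) (horizLift _ _ _) _ _ + _ + _ = _
  rw [h7]
  ring

end Along

end FinslerIndex

end

noncomputable section

namespace FinslerIndex

section Parallel

open Set

set_option maxSynthPendingDepth 3

variable {E : Type*} [NormedAddCommGroup E] [NormedSpace ℝ E]
  {M : Type*} [TopologicalSpace M] [ChartedSpace E M] [IsManifold 𝓘(ℝ, E) ∞ M]
  {F : TangentBundle 𝓘(ℝ, E) M → ℝ} {c : ℝ → M}

/-! ### Parallel fields -/

/-- The inner product `g_T` at `c t`, as a bilinear map. -/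
def metricAt (F : TangentBundle 𝓘(ℝ, E) M → ℝ) (c : ℝ → M) (t : ℝ) : E →L[ℝ] E →L[ℝ] ℝ :=
  chartTensor F (c t) (tangentCurve c t t)

theorem gT_apply (hF : IsFinslerMetric F) (hc : IsClosedGeodesic F c) (t : ℝ) (u w : E) :
    gT F c t u w = metricAt F c t u w := by
  let U : FieldAlong (E := E) c := fun _ => u
  let W : FieldAlong (E := E) c := fun _ => w
  have h := gT_eq hF hc U W (mem_chartTimes_self t)
  rw [coordField_self U, coordField_self W] at h
  exact h

theorem metricAt_comm (hF : IsFinslerMetric F) (hc : IsClosedGeodesic F c) (t : ℝ) (u w : E) :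
    metricAt F c t u w = metricAt F c t w u :=
  (hF.isFinslerSq (c t)).isFinslerTensor.symm _
    (tangentCurve_mem (E := E) hc.regular (mem_chartTimes_self t)) u w

theorem metricAt_pos (hF : IsFinslerMetric F) (hc : IsClosedGeodesic F c) (t : ℝ) {u : E}
    (hu : u ≠ 0) : 0 < metricAt F c t u u :=
  (hF.isFinslerSq (c t)).isFinslerTensor.pos _
    (tangentCurve_mem (E := E) hc.regular (mem_chartTimes_self t)) u hu

/-- The field `V` is differentiable and parallel at the time `t`. -/
def ParallelAt (F : TangentBundle 𝓘(ℝ, E) M → ℝ) (c : ℝ → M) (V : FieldAlong (E := E) c) (t : ℝ) :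
    Prop :=
  DiffAlong c V t ∧ covDeriv F c V t = 0

theorem ParallelAt.congr {V W : FieldAlong (E := E) c} {t : ℝ} (h : ParallelAt F c V t)
    (hVW : ∀ᶠ s in 𝓝 t, V s = W s) : ParallelAt F c W t := by
  have h1 : coordField c V t =ᶠ[𝓝 t] coordField c W t := by
    filter_upwards [hVW] with s hs
    rw [coordField, coordField, hs]
  refine ⟨h.1.congr_of_eventuallyEq h1.symm, ?_⟩
  rw [← h.2, covDeriv, covDeriv, h1.deriv_eq, h1.eq_of_nhds]

variable [FiniteDimensional ℝ E]

theorem parallelAt_of_hasDerivAt (hF : IsFinslerMetric F) (hc : IsClosedGeodesic F c)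
    {V : FieldAlong (E := E) c} {t₀ s : ℝ} (h₀ : s ∈ chartTimes E c t₀)
    (hV : HasDerivAt (coordField c V t₀) (-connMatrix F c t₀ s (coordField c V t₀ s)) s) :
    ParallelAt F c V s := by
  have h1 := coordField_covDeriv hF hc h₀ hV
  rw [neg_add_cancel] at h1
  exact ⟨(hasDerivAt_coordField_change hc.smooth h₀ (mem_chartTimes_self s) hV).differentiableAt,
    by_contra fun h => coordField_ne_zero h₀ h h1⟩

theorem ParallelAt.hasDerivAt (hF : IsFinslerMetric F) (hc : IsClosedGeodesic F c)
    {V : FieldAlong (E := E) c} {t₀ s : ℝ} (h : ParallelAt F c V s) (h₀ : s ∈ chartTimes E c t₀) :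
    HasDerivAt (coordField c V t₀) (-connMatrix F c t₀ s (coordField c V t₀ s)) s := by
  have h1 := h.1.hasDerivAt hF hc h₀
  have h2 : coordField c (covDeriv F c V) t₀ s = 0 := by
    rw [coordField, h.2]
    exact map_zero _
  rwa [h2, zero_sub] at h1

theorem ParallelAt.sub (hF : IsFinslerMetric F) (hc : IsClosedGeodesic F c)
    {V W : FieldAlong (E := E) c} {s : ℝ} (hV : ParallelAt F c V s) (hW : ParallelAt F c W s) :
    ParallelAt F c (V - W) s := by
  have h0 : coordField c (V - W) s = fun r => coordField c V s r - coordField c W s r :=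
    funext fun r => (tangentCoordChange 𝓘(ℝ, E) (c r) (c s) (c r)).map_sub (V r) (W r)
  have hs := mem_chartTimes_self (E := E) (c := c) s
  refine parallelAt_of_hasDerivAt hF hc hs ?_
  rw [h0]
  refine ((hV.hasDerivAt hF hc hs).sub (hW.hasDerivAt hF hc hs)).congr_deriv ?_
  rw [map_sub]
  abel

theorem hasDerivAt_gT_of_parallelAt (hF : IsFinslerMetric F) (hc : IsClosedGeodesic F c)
    {V W : FieldAlong (E := E) c} {s : ℝ} (hV : ParallelAt F c V s) (hW : ParallelAt F c W s) :
    HasDerivAt (fun r => gT F c r (V r) (W r)) 0 s := by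
  refine (hasDerivAt_gT hF hc hV.1 hW.1).congr_deriv ?_
  rw [hV.2, hW.2]
  have h1 : gT F c s 0 (W s) = 0 := by
    refine (gT_apply hF hc s (0 : E) (W s)).trans ?_
    rw [map_zero]
    rfl
  have h2 : gT F c s (V s) 0 = 0 := by
    refine (gT_apply hF hc s (V s) (0 : E)).trans ?_
    rw [map_zero]
  rw [h1, h2, add_zero]

/-- The squared `g_T`-norm of the difference is constant and vanishes at `s`; no chart is needed. -/
theorem eqOn_of_parallelAt (hF : IsFinslerMetric F) (hc : IsClosedGeodesic F c)
    {V W : FieldAlong (E := E) c} {a b s : ℝ} (hs : s ∈ Ioo a b)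
    (hV : ∀ r ∈ Ioo a b, ParallelAt F c V r) (hW : ∀ r ∈ Ioo a b, ParallelAt F c W r)
    (h : V s = W s) : ∀ r ∈ Ioo a b, V r = W r := by
  intro r hr
  have h0 := fun r hr => (hV r hr).sub hF hc (hW r hr)
  have h1 := linear_ode_unique_Ioo (A := fun _ => (0 : ℝ →L[ℝ] ℝ)) (s := s)
    (f := fun r => gT F c r ((V - W) r) ((V - W) r)) (g := fun _ => 0) continuousOn_const hs
    (fun r hr => hasDerivAt_gT_of_parallelAt hF hc (h0 r hr) (h0 r hr))
    (fun r _ => hasDerivAt_const r 0) (by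
      refine (gT_apply hF hc s ((V - W) s) ((V - W) s)).trans ?_
      have : (V - W) s = 0 := sub_eq_zero.2 h
      rw [this]
      exact map_zero _)
  have h2 : gT F c r ((V - W) r) ((V - W) r) = 0 := h1 hr
  by_contra h3
  have h4 := (gT_apply hF hc r ((V - W) r) ((V - W) r)).symm.trans h2
  exact (metricAt_pos hF hc r (sub_ne_zero.2 h3)).ne' h4

theorem eq_of_parallelAt (hF : IsFinslerMetric F) (hc : IsClosedGeodesic F c)
    {V W : FieldAlong (E := E) c} (hV : ∀ r, ParallelAt F c V r) (hW : ∀ r, ParallelAt F c W r)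
    {s : ℝ} (h : V s = W s) : V = W :=
  funext fun r => eqOn_of_parallelAt hF hc (a := min s r - 1) (b := max s r + 1)
    ⟨by linarith [min_le_left s r], by linarith [le_max_left s r]⟩ (fun r _ => hV r)
    (fun r _ => hW r) h r ⟨by linarith [min_le_right s r], by linarith [le_max_right s r]⟩

/-- In each chart parallelism is a linear differential equation. No chart need cover all of `c`, so
local solutions are continued by `exists_global_solution`. -/
theorem exists_parallel (hF : IsFinslerMetric F) (hc : IsClosedGeodesic F c) (v : E) :
    ∃ V : FieldAlong (E := E) c, V 0 = v ∧ ∀ r, ParallelAt F c V r := by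
  refine exists_global_solution (Y := E) (fun V t => ParallelAt F c V t)
    (fun V W t hV hVW => ParallelAt.congr hV hVW) (fun t₀ => ?_)
    (fun V W a b s hs hV hW h => eqOn_of_parallelAt hF hc hs hV hW h) v
  have hnhds := (isOpen_chartTimes (E := E) hc.smooth.continuous t₀).mem_nhds
    (mem_chartTimes_self t₀)
  have hA : ContinuousOn (fun s => -connMatrix F c t₀ s) (chartTimes E c t₀) :=
    (contDiffOn_connMatrix hF hc t₀).continuousOn.neg
  obtain ⟨δ, hδ, hI, hex⟩ := exists_linear_ode_local hnhds hA
  refine ⟨δ, hδ, fun s hs v => ?_⟩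
  obtain ⟨α, hα, hode⟩ := hex s hs (tangentCoordChange 𝓘(ℝ, E) (c s) (c t₀) (c s) v)
  let V : FieldAlong (E := E) c := fun r => tangentCoordChange 𝓘(ℝ, E) (c t₀) (c r) (c r) (α r)
  have hV : ∀ r ∈ chartTimes E c t₀, coordField c V t₀ r = α r := fun r hr =>
    tangentCoordChange_leftInverse hr (mem_extChartAt_source (c r)) (α r)
  refine ⟨V, ?_, fun r hr => parallelAt_of_hasDerivAt hF hc (hI hr) ?_⟩
  · change tangentCoordChange 𝓘(ℝ, E) (c t₀) (c s) (c s) (α s) = v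
    rw [hα]
    exact tangentCoordChange_leftInverse (mem_extChartAt_source (c s)) (hI hs) v
  · rw [hV r (hI hr)]
    refine (hode r hr).congr_of_eventuallyEq ?_
    filter_upwards [Ioo_mem_nhds hr.1 hr.2] with q hq
    exact hV q (hI hq)

theorem contDiffAt_of_parallelAt (hF : IsFinslerMetric F) (hc : IsClosedGeodesic F c)
    {V : FieldAlong (E := E) c} (hV : ∀ r, ParallelAt F c V r) : IsSmoothAlong c V := by
  intro t₀
  have hnhds := (isOpen_chartTimes (E := E) hc.smooth.continuous t₀).mem_nhds
    (mem_chartTimes_self t₀)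
  exact contDiffAt_linear_ode hnhds (contDiffOn_connMatrix hF hc t₀).neg
    fun r hr => (hV r).hasDerivAt hF hc hr

/-! ### Parallel frames -/

/-- A parallel orthonormal frame along `c`. -/
structure IsParallelFrame (F : TangentBundle 𝓘(ℝ, E) M → ℝ) (c : ℝ → M)
    (e : Fin (Module.finrank ℝ E) → FieldAlong (E := E) c) : Prop where
  parallel : ∀ i t, ParallelAt F c (e i) t
  orthonormal : ∀ t i j, metricAt F c t (e i t) (e j t) = if i = j then 1 else 0

theorem exists_orthonormal (hF : IsFinslerMetric F) (hc : IsClosedGeodesic F c) (t : ℝ) :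
    ∃ b : Fin (Module.finrank ℝ E) → E,
      ∀ i j, metricAt F c t (b i) (b j) = if i = j then 1 else 0 := by
  let B : LinearMap.BilinForm ℝ E := LinearMap.mk₂ ℝ (fun u w => metricAt F c t u w)
    (by intros; simp) (by intros; simp) (by intros; simp) (by intros; simp)
  have hB : LinearMap.IsSymm B := ⟨fun u w => metricAt_comm hF hc t u w⟩
  obtain ⟨v, hv⟩ := LinearMap.BilinForm.exists_orthogonal_basis (B := B) hB
  have hv' : ∀ i j, i ≠ j → metricAt F c t (v i) (v j) = 0 := fun i j hij => hv hij
  have hpos := fun i => metricAt_pos hF hc t (v.ne_zero i)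
  refine ⟨fun i => (Real.sqrt (metricAt F c t (v i) (v i)))⁻¹ • v i, fun i j => ?_⟩
  simp only [map_smul, smul_apply, smul_eq_mul]
  split_ifs with hij
  · subst hij
    have h1 := Real.mul_self_sqrt (hpos i).le
    have h2 := (Real.sqrt_pos.2 (hpos i)).ne'
    rw [← mul_assoc, ← mul_inv, h1]
    exact inv_mul_cancel₀ (hpos i).ne'
  · rw [hv' i j hij, mul_zero, mul_zero]

/-- An orthonormal basis at time `0` is transported; inner products of parallel fields are constant.
-/
theorem exists_parallelFrame (hF : IsFinslerMetric F) (hc : IsClosedGeodesic F c) :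
    ∃ e, IsParallelFrame F c e := by
  obtain ⟨b, hb⟩ := exists_orthonormal hF hc 0
  choose e he hpar using fun i => exists_parallel hF hc (b i)
  refine ⟨e, hpar, fun t i j => ?_⟩
  have h1 := is_const_of_deriv_eq_zero
    (fun r => (hasDerivAt_gT_of_parallelAt hF hc (hpar i r) (hpar j r)).differentiableAt)
    (fun r => (hasDerivAt_gT_of_parallelAt hF hc (hpar i r) (hpar j r)).deriv) t 0
  rw [← hb, ← he i, ← he j]
  exact ((gT_apply hF hc t (e i t) (e j t)).symm.trans h1).trans (gT_apply hF hc 0 (e i 0) (e j 0))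

end Parallel

end FinslerIndex

end

noncomputable section

namespace FinslerIndex

section Frame

open Set

set_option maxSynthPendingDepth 3

variable {E : Type*} [NormedAddCommGroup E] [NormedSpace ℝ E]
  {M : Type*} [TopologicalSpace M] [ChartedSpace E M]
  {F : TangentBundle 𝓘(ℝ, E) M → ℝ} {c : ℝ → M}
  {e : Fin (Module.finrank ℝ E) → FieldAlong (E := E) c}

/-! ### Fields along the curve in a parallel frame -/

/-- The model of the tangent spaces. -/
abbrev FrameSpace (E : Type*) [NormedAddCommGroup E] [NormedSpace ℝ E] : Type :=
  EuclideanSpace ℝ (Fin (Module.finrank ℝ E))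

/-- The components of a frame vector. -/
def frameVec (e : Fin (Module.finrank ℝ E) → FieldAlong (E := E) c) (i : Fin (Module.finrank ℝ E))
    (t : ℝ) : E := e i t

/-- The tangent vector with given components in a frame. -/
def frameAt (e : Fin (Module.finrank ℝ E) → FieldAlong (E := E) c) (t : ℝ) :
    FrameSpace E →L[ℝ] E :=
  ∑ i, (EuclideanSpace.proj i : FrameSpace E →L[ℝ] ℝ).smulRight (frameVec e i t)

theorem frameAt_apply (t : ℝ) (x : FrameSpace E) : frameAt e t x = ∑ i, x i • frameVec e i t := by
  simp [frameAt]

/-- The field along `c` with given components in a frame. -/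
def frameMap (e : Fin (Module.finrank ℝ E) → FieldAlong (E := E) c) :
    (ℝ → FrameSpace E) →ₗ[ℝ] FieldAlong (E := E) c where
  toFun f t := (frameAt e t (f t) : E)
  map_add' f h := funext fun t => map_add (frameAt e t) (f t) (h t)
  map_smul' r f := funext fun t => map_smul (frameAt e t) r (f t)

theorem frameAt_single (t : ℝ) (i : Fin (Module.finrank ℝ E)) :
    frameAt e t (EuclideanSpace.single i 1) = frameVec e i t := by
  simp [frameAt_apply]

variable [IsManifold 𝓘(ℝ, E) ∞ M]

theorem coordField_frameMap (f : ℝ → FrameSpace E) (t₀ s : ℝ) :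
    coordField c (frameMap e f) t₀ s = ∑ i, f s i • coordField c (e i) t₀ s := by
  have h : coordField c (frameMap e f) t₀ s =
    tangentCoordChange 𝓘(ℝ, E) (c s) (c t₀) (c s) (frameAt e s (f s)) := rfl
  rw [h, frameAt_apply, map_sum]
  refine Finset.sum_congr rfl fun i _ => ?_
  rw [map_smul]
  rfl

theorem metricAt_frameAt (he : IsParallelFrame F c e) (t : ℝ) (x y : FrameSpace E) :
    metricAt F c t (frameAt e t x) (frameAt e t y) = inner ℝ x y := by
  have h : ∀ i j, metricAt F c t (frameVec e i t) (frameVec e j t) = if i = j then 1 else 0 :=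
    he.orthonormal t
  simp only [frameAt_apply, map_sum, sum_apply, map_smul, smul_apply,
    smul_eq_mul, h, PiLp.inner_apply]
  simp [mul_comm]

theorem contDiffAt_chartTensor (hF : IsFinslerMetric F) (hc : IsClosedGeodesic F c) (t : ℝ) :
    ContDiffAt ℝ ∞ (fun s => chartTensor F (c t) (tangentCurve (E := E) c t s)) t := by
  have hnhds := (isOpen_chartTimes (E := E) hc.smooth.continuous t).mem_nhds (mem_chartTimes_self t)
  have hp := tangentCurve_mem (E := E) hc.regular (mem_chartTimes_self t)
  exact ((hF.isFinslerSq (c t)).isFinslerTensor.contDiffAt hp).comp t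
    ((contDiffOn_tangentCurve hc.smooth t).contDiffAt hnhds)

theorem coordField_shift (hc : IsClosedGeodesic F c) {V W : FieldAlong (E := E) c}
    (h : ∀ s, components (W s) = components (V (s + 1))) (t s : ℝ) :
    coordField c W t s = coordField c V (t + 1) (s + 1) := by
  -- `c (t + 1)` and `c t` are equal points but not definitionally; generalising them to `x, y` lets
  -- the equations be substituted.
  have key : ∀ (x y : M) (_ : x = c s) (_ : y = c t) (w : E),
      tangentCoordChange 𝓘(ℝ, E) (c s) (c t) (c s) w = tangentCoordChange 𝓘(ℝ, E) x y x w := by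
    rintro x y rfl rfl w
    rfl
  have h1 : (W s : E) = (V (s + 1) : E) := h s
  calc coordField c W t s = tangentCoordChange 𝓘(ℝ, E) (c s) (c t) (c s) (W s : E) := rfl
    _ = tangentCoordChange 𝓘(ℝ, E) (c s) (c t) (c s) (V (s + 1) : E) := by rw [h1]
    _ = _ := key _ _ (hc.periodic s) (hc.periodic t) _

theorem coordCurve_shift (hc : IsClosedGeodesic F c) (t s : ℝ) :
    coordCurve (E := E) c t s = coordCurve c (t + 1) (s + 1) := by
  rw [coordCurve, coordCurve, hc.periodic, hc.periodic]

theorem frameAt_injective (he : IsParallelFrame F c e) (t : ℝ) :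
    Function.Injective (frameAt e t) := by
  rw [injective_iff_map_eq_zero]
  intro x hx
  rw [← inner_self_eq_zero (𝕜 := ℝ), ← metricAt_frameAt he t, hx, map_zero]

theorem frameMap_injective (he : IsParallelFrame F c e) : Function.Injective (frameMap e) :=
  fun _ _ hfh => funext fun t => frameAt_injective he t (congrFun hfh t)

theorem metricAt_frameAt_frame (he : IsParallelFrame F c e) (t : ℝ) (x : FrameSpace E)
    (i : Fin (Module.finrank ℝ E)) : metricAt F c t (frameAt e t x) (frameVec e i t) = x i := by
  rw [← frameAt_single t i, metricAt_frameAt he, EuclideanSpace.inner_single_right]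
  simp

theorem gT_frameMap (hF : IsFinslerMetric F) (hc : IsClosedGeodesic F c)
    (he : IsParallelFrame F c e) (t : ℝ) (x y : FrameSpace E) :
    gT F c t (frameAt e t x) (frameAt e t y) = inner ℝ x y :=
  (gT_apply hF hc t (frameAt e t x) (frameAt e t y)).trans (metricAt_frameAt he t x y)

theorem velocity_shift (hc : IsClosedGeodesic F c) (t : ℝ) :
    components (velocity (E := E) c t) = components (velocity (E := E) c (t + 1)) := by
  have h1 := hasDerivAt_coordCurve hc.smooth (mem_chartTimes_self (E := E) t)
  have h2 := hasDerivAt_coordCurve hc.smooth (mem_chartTimes_self (E := E) (t + 1))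
  rw [coordField_self] at h1 h2
  have h3 : HasDerivAt (fun s => coordCurve (E := E) c (t + 1) (s + 1)) _ t := h2.comp_add_const t 1
  have h4 : (fun s => coordCurve (E := E) c (t + 1) (s + 1)) = coordCurve c t :=
    funext fun s => (coordCurve_shift hc t s).symm
  rw [h4] at h3
  exact h1.unique h3

/-- The components of a field in a frame, computed in a chart. -/
theorem frameMap_component (hF : IsFinslerMetric F) (hc : IsClosedGeodesic F c)
    (he : IsParallelFrame F c e) (f : ℝ → FrameSpace E) {t₀ s : ℝ} (h₀ : s ∈ chartTimes E c t₀)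
    (i : Fin (Module.finrank ℝ E)) :
    f s i = chartTensor F (c t₀) (tangentCurve c t₀ s) (coordField c (frameMap e f) t₀ s)
      (coordField c (e i) t₀ s) := by
  rw [← gT_eq hF hc _ _ h₀]
  exact ((gT_apply hF hc s (frameAt e s (f s)) (e i s)).trans
    (metricAt_frameAt_frame he s (f s) i)).symm

theorem tangentCurve_shift (hc : IsClosedGeodesic F c) (t s : ℝ) :
    tangentCurve (E := E) c t s = tangentCurve c (t + 1) (s + 1) :=
  Prod.ext (coordCurve_shift hc t s) (coordField_shift hc (velocity_shift hc) t s)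

theorem metricAt_shift (hc : IsClosedGeodesic F c) (t : ℝ) :
    metricAt F c (t + 1) = metricAt F c t := by
  rw [metricAt, metricAt, ← tangentCurve_shift hc, hc.periodic]

variable [FiniteDimensional ℝ E]

/-- A frame as an isomorphism of the model space with the tangent space. -/
def frameEquiv (he : IsParallelFrame F c e) (t : ℝ) : FrameSpace E ≃L[ℝ] E :=
  (LinearMap.linearEquivOfInjective (frameAt e t : FrameSpace E →ₗ[ℝ] E) (frameAt_injective he t)
    (by simp)).toContinuousLinearEquiv

theorem frameAt_symm_apply (he : IsParallelFrame F c e) (t : ℝ) (u : E) :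
    frameAt e t ((frameEquiv he t).symm u) = u := (frameEquiv he t).apply_symm_apply u

theorem frameMap_surjective (he : IsParallelFrame F c e) : Function.Surjective (frameMap e) :=
  fun V => ⟨fun t => (frameEquiv he t).symm (V t), funext fun t => frameAt_symm_apply he t (V t)⟩

theorem IsParallelFrame.isSmoothAlong (hF : IsFinslerMetric F) (hc : IsClosedGeodesic F c)
    (he : IsParallelFrame F c e) (i : Fin (Module.finrank ℝ E)) : IsSmoothAlong c (e i) :=
  contDiffAt_of_parallelAt hF hc (he.parallel i)

theorem contDiffAt_jacobiOp (hF : IsFinslerMetric F) (hc : IsClosedGeodesic F c) (t : ℝ) :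
    ContDiffAt ℝ ∞ (fun s => jacobiOp (chartTensor F (c t)) (tangentCurve (E := E) c t s)) t := by
  have hnhds := (isOpen_chartTimes (E := E) hc.smooth.continuous t).mem_nhds (mem_chartTimes_self t)
  have hp := tangentCurve_mem (E := E) hc.regular (mem_chartTimes_self t)
  have hT : IsFinslerTensor (chartTensor F (c t)) _ := (hF.isFinslerSq (c t)).isFinslerTensor
  exact (hT.contDiffOn_jacobiOp.contDiffAt (hT.isOpen.mem_nhds hp)).comp t
    ((contDiffOn_tangentCurve hc.smooth t).contDiffAt hnhds)

/-- The frame is smooth, and by orthonormality each component is the inner product of the field with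
a frame field. -/
theorem isSmoothAlong_frameMap_iff (hF : IsFinslerMetric F) (hc : IsClosedGeodesic F c)
    (he : IsParallelFrame F c e) (f : ℝ → FrameSpace E) :
    IsSmoothAlong c (frameMap e f) ↔ ContDiff ℝ ∞ f := by
  constructor
  · intro h
    rw [contDiff_euclidean]
    intro i
    rw [contDiff_iff_contDiffAt]
    intro t
    refine (((contDiffAt_chartTensor hF hc t).clm_apply (h t)).clm_apply
      (he.isSmoothAlong hF hc i t)).congr_of_eventuallyEq ?_
    filter_upwards [(isOpen_chartTimes (E := E) hc.smooth.continuous t).mem_nhds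
      (mem_chartTimes_self t)] with s hs
    exact frameMap_component hF hc he f hs i
  · intro h t
    have h1 : coordField c (frameMap e f) t = fun s => ∑ i, f s i • coordField c (e i) t s :=
      funext fun s => coordField_frameMap f t s
    rw [h1]
    exact ContDiffAt.sum fun i _ => ((contDiff_euclidean.1 h i).contDiffAt).smul
      (he.isSmoothAlong hF hc i t)

/-- As in the smooth case, using that `H¹` is stable under multiplication by smooth functions. -/
theorem isH1Along_frameMap_iff (hF : IsFinslerMetric F) (hc : IsClosedGeodesic F c)
    (he : IsParallelFrame F c e) (f : ℝ → FrameSpace E) :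
    IsH1Along c (frameMap e f) ↔ HasL2Deriv f (deriv f) := by
  have hcompl : CompleteSpace E := FiniteDimensional.complete ℝ E
  have hiff : IsH1Along c (frameMap e f) ↔ ∀ t, H1At (coordField c (frameMap e f) t) t := Iff.rfl
  rw [hiff]
  constructor
  · intro h
    refine hasL2Deriv_of_h1At fun t => ?_
    have h1 : ∀ i, H1At (fun s => f s i) t := by
      intro i
      let b := Module.finBasis ℝ E
      have h2 : ∀ j, H1At (fun s => b.coord j (coordField c (frameMap e f) t s) *
          chartTensor F (c t) (tangentCurve c t s) (b j) (coordField c (e i) t s)) t := fun j =>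
        ((h t).clm_comp (b.coord j).toContinuousLinearMap).mul_contDiffAt
          ((((contDiffAt_chartTensor hF hc t).clm_apply contDiffAt_const).clm_apply
            (he.isSmoothAlong hF hc i t)).of_le (by simp))
      refine (H1At.sum Finset.univ fun j _ => h2 j).congr ?_
      filter_upwards [(isOpen_chartTimes (E := E) hc.smooth.continuous t).mem_nhds
        (mem_chartTimes_self t)] with s hs
      rw [frameMap_component hF hc he f hs i]
      conv_rhs => rw [← b.sum_repr (coordField c (frameMap e f) t s)]
      simp only [map_sum, sum_apply, map_smul, smul_apply, smul_eq_mul, b.coord_apply]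
    have h3 : ∀ i, H1At (fun s => f s i • (EuclideanSpace.single i (1 : ℝ) : FrameSpace E)) t :=
      fun i => (h1 i).smul_contDiffAt contDiffAt_const
    refine (H1At.sum Finset.univ fun i _ => h3 i).congr (Filter.Eventually.of_forall fun s => ?_)
    ext j
    simp [Pi.single_apply]
  · intro h t
    have h1 : coordField c (frameMap e f) t = fun s => ∑ i, f s i • coordField c (e i) t s :=
      funext fun s => coordField_frameMap f t s
    rw [h1]
    exact H1At.sum Finset.univ fun i _ =>
      ((h.h1At t).clm_comp (EuclideanSpace.proj i : FrameSpace E →L[ℝ] ℝ)).smul_contDiffAt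
        ((he.isSmoothAlong hF hc i t).of_le (by simp))

/-- In the Leibniz rule the derivatives of the parallel frame fields cancel the connection term. -/
theorem covDeriv_frameMap (hF : IsFinslerMetric F) (hc : IsClosedGeodesic F c)
    (he : IsParallelFrame F c e) {f : ℝ → FrameSpace E} {f' : FrameSpace E} {t : ℝ}
    (hf : HasDerivAt f f' t) :
    DiffAlong c (frameMap e f) t ∧ covDeriv F c (frameMap e f) t = frameAt e t f' := by
  have ht := mem_chartTimes_self (E := E) (c := c) t
  have h1 : coordField c (frameMap e f) t = fun s => ∑ i, f s i • coordField c (e i) t s :=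
    funext fun s => coordField_frameMap f t s
  have h2 : HasDerivAt (coordField c (frameMap e f) t)
      (∑ i, (f t i • (-connMatrix F c t t (coordField c (e i) t t)) + f' i • coordField c (e i) t t))
      t := by
    rw [h1]
    refine HasDerivAt.fun_sum fun i _ => ?_
    exact (((EuclideanSpace.proj i : FrameSpace E →L[ℝ] ℝ).hasFDerivAt.comp_hasDerivAt t hf)).smul
      ((he.parallel i t).hasDerivAt hF hc ht)
  refine ⟨h2.differentiableAt, ?_⟩
  have h3 := coordField_covDeriv hF hc ht h2
  rw [coordField_self] at h3
  refine h3.trans ?_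
  have h4 : ∀ i, coordField c (e i) t t = frameVec e i t := fun i => coordField_self (e i) t
  rw [coordField_frameMap, map_sum, ← Finset.sum_add_distrib, frameAt_apply]
  refine Finset.sum_congr rfl fun i _ => ?_
  rw [h4, map_smul, smul_neg]
  abel

/-- The curvature operator in a parallel frame. -/
def frameCurv (he : IsParallelFrame F c e) (t : ℝ) : FrameSpace E →L[ℝ] FrameSpace E :=
  ((frameEquiv he t).symm : E →L[ℝ] FrameSpace E) ∘L
    jacobiOp (chartTensor F (c t)) (tangentCurve c t t) ∘L frameAt e t

theorem curvatureAlong_frameMap (hF : IsFinslerMetric F) (hc : IsClosedGeodesic F c)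
    (he : IsParallelFrame F c e) (f : ℝ → FrameSpace E) (t : ℝ) :
    curvatureAlong F c (frameMap e f) t = frameAt e t (frameCurv he t (f t)) := by
  refine (curvatureAlong_eq hF hc _ t).trans ?_
  rw [coordField_self]
  exact (frameAt_symm_apply he t _).symm

theorem frameCurv_symm (hF : IsFinslerMetric F) (hc : IsClosedGeodesic F c)
    (he : IsParallelFrame F c e) (t : ℝ) (x y : FrameSpace E) :
    inner ℝ (frameCurv he t x) y = inner ℝ x (frameCurv he t y) := by
  have h : ∀ x, frameAt e t (frameCurv he t x) =
      jacobiOp (chartTensor F (c t)) (tangentCurve c t t) (frameAt e t x) := fun x =>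
    frameAt_symm_apply he t _
  rw [← metricAt_frameAt he t, ← metricAt_frameAt he t, h, h]
  exact (hF.isFinslerSq (c t)).isFinslerTensor.chernCurv_symm
    (tangentCurve_mem (E := E) hc.regular (mem_chartTimes_self t)) _ _

/-- `frameCurv` is defined with a chart that varies with `t`. Its smoothness is read off from the
field obtained by applying the curvature to a field with constant components, whose expression in a
fixed chart is smooth. -/
theorem contDiff_frameCurv (hF : IsFinslerMetric F) (hc : IsClosedGeodesic F c)
    (he : IsParallelFrame F c e) : ContDiff ℝ ∞ (frameCurv he) := by
  rw [contDiff_clm_apply_iff]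
  intro x
  rw [← isSmoothAlong_frameMap_iff hF hc he]
  have h1 : frameMap e (fun t => frameCurv he t x) = curvatureAlong F c (frameMap e fun _ => x) :=
    funext fun t => (curvatureAlong_frameMap hF hc he (fun _ => x) t).symm
  have h2 : IsSmoothAlong c (frameMap e fun _ => x) :=
    (isSmoothAlong_frameMap_iff hF hc he _).2 contDiff_const
  rw [h1]
  intro t
  refine ((contDiffAt_jacobiOp hF hc t).clm_apply (h2 t)).congr_of_eventuallyEq ?_
  filter_upwards [(isOpen_chartTimes (E := E) hc.smooth.continuous t).mem_nhds
    (mem_chartTimes_self t)] with s hs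
  exact coordField_curvatureAlong hF hc _ hs

/-! ### Holonomy -/

theorem connMatrix_shift (hc : IsClosedGeodesic F c) (t s : ℝ) :
    connMatrix F c (t + 1) (s + 1) = connMatrix F c t s := by
  rw [connMatrix, connMatrix, ← tangentCurve_shift hc, hc.periodic,
    ← coordField_shift hc (velocity_shift hc)]

theorem ParallelAt.shift (hF : IsFinslerMetric F) (hc : IsClosedGeodesic F c)
    {V W : FieldAlong (E := E) c} (h : ∀ s, components (W s) = components (V (s + 1))) {t : ℝ}
    (hV : ParallelAt F c V (t + 1)) : ParallelAt F c W t := by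
  have h1 := hV.hasDerivAt hF hc (mem_chartTimes_self (t + 1))
  have h2 : HasDerivAt (fun s => coordField c V (t + 1) (s + 1)) _ t := h1.comp_add_const t 1
  have h3 : (fun s => coordField c V (t + 1) (s + 1)) = coordField c W t :=
    funext fun s => (coordField_shift hc h t s).symm
  rw [h3, connMatrix_shift hc, ← coordField_shift hc h] at h2
  exact parallelAt_of_hasDerivAt hF hc (mem_chartTimes_self t) h2

theorem parallelAt_frameMap_const (hF : IsFinslerMetric F) (hc : IsClosedGeodesic F c)
    (he : IsParallelFrame F c e) (x : FrameSpace E) (t : ℝ) :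
    ParallelAt F c (frameMap e fun _ => x) t := by
  obtain ⟨h1, h2⟩ := covDeriv_frameMap hF hc he (hasDerivAt_const t x)
  exact ⟨h1, h2.trans (map_zero _)⟩

/-- The holonomy of the closed geodesic in a parallel frame. -/
theorem exists_holonomy (hF : IsFinslerMetric F) (hc : IsClosedGeodesic F c)
    (he : IsParallelFrame F c e) : ∃ A : FrameSpace E ≃ₗᵢ[ℝ] FrameSpace E,
      ∀ t x, frameAt e (t + 1) (A x) = frameAt e t x := by
  -- The comparison of the frames at `0` and `1`; it is an isometry since `g_T` is the same at both
  -- times. For other `t`, both sides are parallel fields that agree at time `0`.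
  let a : FrameSpace E ≃ₗ[ℝ] FrameSpace E :=
    (frameEquiv he 0).toLinearEquiv.trans (frameEquiv he 1).symm.toLinearEquiv
  have ha : ∀ x, frameAt e 1 (a x) = frameAt e 0 x := fun x => frameAt_symm_apply he 1 _
  have hiso : ∀ x y, inner ℝ (a x) (a y) = inner ℝ x y := by
    intro x y
    rw [← metricAt_frameAt he 1, ha, ha, ← metricAt_frameAt he 0]
    have := metricAt_shift hc 0
    rw [zero_add] at this
    rw [this]
  refine ⟨a.isometryOfInner hiso, fun t x => ?_⟩
  let W : FieldAlong (E := E) c := fun s => (frameAt e (s + 1) (a x) : E)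
  have h1 : W = frameMap e fun _ => x := by
    refine eq_of_parallelAt hF hc (s := 0)
      (fun r => (parallelAt_frameMap_const hF hc he (a x) (r + 1)).shift hF hc fun s => rfl)
      (parallelAt_frameMap_const hF hc he x) ?_
    change frameAt e (0 + 1) (a x) = frameAt e 0 x
    rw [zero_add, ha]
  exact congrFun h1 t

end Frame

end FinslerIndex

end

noncomputable section

namespace FinslerIndex

section Transport

open Set

set_option maxSynthPendingDepth 3

theorem contDiff_of_mem_modelJacobi {X : Type*} [NormedAddCommGroup X] [InnerProductSpace ℝ X]
    [FiniteDimensional ℝ X] {R : ℝ → X →L[ℝ] X} (hR : ContDiff ℝ ∞ R) {J : ℝ → X}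
    (hJ : J ∈ modelJacobi R) : ContDiff ℝ ∞ J ∧ ContDiff ℝ ∞ (deriv J) := by
  have hcompl : CompleteSpace X := FiniteDimensional.complete ℝ X
  have hA : ContDiff ℝ ∞ (jacobiSystem R) := by
    rw [contDiff_clm_apply_iff]
    intro p
    exact contDiff_const.prodMk (hR.clm_apply contDiff_const)
  have h : ContDiff ℝ ∞ fun t => (J t, deriv J t) :=
    contDiff_iff_contDiffAt.2 fun t => contDiffAt_linear_ode Filter.univ_mem hA.contDiffOn
      fun s _ => (hJ.1 s).hasDerivAt.prodMk (hJ.2 s)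
  exact ⟨h.fst, h.snd⟩

variable {E : Type*} [NormedAddCommGroup E] [NormedSpace ℝ E]
  {M : Type*} [TopologicalSpace M] [ChartedSpace E M] [IsManifold 𝓘(ℝ, E) ∞ M]
  {F : TangentBundle 𝓘(ℝ, E) M → ℝ} {c : ℝ → M}
  {e : Fin (Module.finrank ℝ E) → FieldAlong (E := E) c}
  {A : FrameSpace E ≃ₗᵢ[ℝ] FrameSpace E}

/-! ### The spaces of fields in a parallel frame -/

theorem components_frameMap_eq_iff (he : IsParallelFrame F c e)
    (hA : ∀ t x, frameAt e (t + 1) (A x) = frameAt e t x) (f : ℝ → FrameSpace E) (t : ℝ) :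
    components (frameMap e f (t + 1)) = components (frameMap e f t) ↔ f (t + 1) = A (f t) := by
  have h : components (frameMap e f t) = frameAt e (t + 1) (A (f t)) := (hA t (f t)).symm
  rw [h]
  exact (frameAt_injective he (t + 1)).eq_iff

theorem components_frameMap_zero_one_iff (he : IsParallelFrame F c e)
    (hA : ∀ t x, frameAt e (t + 1) (A x) = frameAt e t x) (f : ℝ → FrameSpace E) :
    components (frameMap e f 0) = components (frameMap e f 1) ↔ f 1 = A (f 0) := by
  have h := components_frameMap_eq_iff he hA f 0
  rw [zero_add] at h
  exact eq_comm.trans h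

theorem frameMap_eq_zero_iff (he : IsParallelFrame F c e) (f : ℝ → FrameSpace E) (t : ℝ) :
    frameMap e f t = 0 ↔ f t = 0 :=
  map_eq_zero_iff (frameAt e t) (frameAt_injective he t)

theorem finrank_map_frameMap (he : IsParallelFrame F c e) (S : Submodule ℝ (ℝ → FrameSpace E)) :
    Module.finrank ℝ (S.map (frameMap e)) = Module.finrank ℝ S :=
  (Submodule.equivMapOfInjective _ (frameMap_injective he) S).finrank_eq.symm

variable [FiniteDimensional ℝ E]

theorem covDeriv_frameMap_of_differentiable (hF : IsFinslerMetric F) (hc : IsClosedGeodesic F c)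
    (he : IsParallelFrame F c e) {f : ℝ → FrameSpace E} (hf : ∀ t, DifferentiableAt ℝ f t) :
    covDeriv F c (frameMap e f) = frameMap e (deriv f) :=
  funext fun t => (covDeriv_frameMap hF hc he (hf t).hasDerivAt).2

/-- Solutions in the model are only required to be twice differentiable; since `R` is smooth they
are smooth, as `jacobi` demands. -/
theorem frameMap_mem_jacobi_iff (hF : IsFinslerMetric F) (hc : IsClosedGeodesic F c)
    (he : IsParallelFrame F c e) (J : ℝ → FrameSpace E) :
    frameMap e J ∈ jacobi F c ↔ J ∈ modelJacobi (frameCurv he) := by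
  constructor
  · rintro ⟨h1, h2, h3⟩
    have hJ := (isSmoothAlong_frameMap_iff hF hc he J).1 h1
    have hd : ∀ t, DifferentiableAt ℝ J t := fun t => (hJ.differentiable (by simp)) t
    rw [covDeriv_frameMap_of_differentiable hF hc he hd] at h2 h3
    have hJ' := (isSmoothAlong_frameMap_iff hF hc he _).1 h2
    refine ⟨hd, fun t => ?_⟩
    have h4 := ((hJ'.differentiable (by simp)) t).hasDerivAt
    have h5 := ((covDeriv_frameMap hF hc he h4).2.symm.trans (h3 t)).trans
      (curvatureAlong_frameMap hF hc he J t)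
    rwa [frameAt_injective he t h5] at h4
  · intro hJ
    obtain ⟨h1, h2⟩ := contDiff_of_mem_modelJacobi (contDiff_frameCurv hF hc he) hJ
    refine ⟨(isSmoothAlong_frameMap_iff hF hc he J).2 h1, ?_, fun t => ?_⟩
    · rw [covDeriv_frameMap_of_differentiable hF hc he hJ.1]
      exact (isSmoothAlong_frameMap_iff hF hc he _).2 h2
    · rw [covDeriv_frameMap_of_differentiable hF hc he hJ.1]
      exact (covDeriv_frameMap hF hc he (hJ.2 t)).2.trans
        (curvatureAlong_frameMap hF hc he J t).symm

theorem map_frameMap_eq (he : IsParallelFrame F c e) {S : Submodule ℝ (ℝ → FrameSpace E)}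
    {T : Submodule ℝ (FieldAlong (E := E) c)} (h : ∀ f, frameMap e f ∈ T ↔ f ∈ S) :
    S.map (frameMap e) = T := by
  have : S = T.comap (frameMap e) := Submodule.ext fun f => (h f).symm
  rw [this, Submodule.map_comap_eq_of_surjective (frameMap_surjective he)]

theorem map_twistedH1 (hF : IsFinslerMetric F) (hc : IsClosedGeodesic F c)
    (he : IsParallelFrame F c e) (hA : ∀ t x, frameAt e (t + 1) (A x) = frameAt e t x) :
    (twistedH1 A).map (frameMap e) = tangentLoop c :=
  map_frameMap_eq he fun f => and_congr (isH1Along_frameMap_iff hF hc he f)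
    (forall_congr' fun t => components_frameMap_eq_iff he hA f t)

theorem map_twistedH1Zero (hF : IsFinslerMetric F) (hc : IsClosedGeodesic F c)
    (he : IsParallelFrame F c e) (hA : ∀ t x, frameAt e (t + 1) (A x) = frameAt e t x) :
    (twistedH1Zero A).map (frameMap e) = tangentBased c :=
  map_frameMap_eq he fun f => and_congr (and_congr (isH1Along_frameMap_iff hF hc he f)
    (forall_congr' fun t => components_frameMap_eq_iff he hA f t)) (frameMap_eq_zero_iff he f 0)

theorem map_modelJacobi (hF : IsFinslerMetric F) (hc : IsClosedGeodesic F c)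
    (he : IsParallelFrame F c e) : (modelJacobi (frameCurv he)).map (frameMap e) = jacobi F c :=
  map_frameMap_eq he (frameMap_mem_jacobi_iff hF hc he)

theorem map_modelJacobiClosed (hF : IsFinslerMetric F) (hc : IsClosedGeodesic F c)
    (he : IsParallelFrame F c e) (hA : ∀ t x, frameAt e (t + 1) (A x) = frameAt e t x) :
    (modelJacobiClosed (frameCurv he) A).map (frameMap e) = jacobiClosed F c :=
  map_frameMap_eq he fun J => and_congr (frameMap_mem_jacobi_iff hF hc he J)
    (components_frameMap_zero_one_iff he hA J)

theorem map_modelJacobiZero (hF : IsFinslerMetric F) (hc : IsClosedGeodesic F c)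
    (he : IsParallelFrame F c e) :
    (modelJacobiZero (frameCurv he)).map (frameMap e) = jacobiZero F c :=
  map_frameMap_eq he fun J => and_congr (frameMap_mem_jacobi_iff hF hc he J)
    (and_congr (frameMap_eq_zero_iff he J 0) (frameMap_eq_zero_iff he J 1))

theorem map_modelJacobiPeriodic (hF : IsFinslerMetric F) (hc : IsClosedGeodesic F c)
    (he : IsParallelFrame F c e) (hA : ∀ t x, frameAt e (t + 1) (A x) = frameAt e t x) :
    (modelJacobiPeriodic (frameCurv he) A).map (frameMap e) = jacobiPeriodic F c :=
  map_frameMap_eq he fun J => by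
    have hiff : frameMap e J ∈ jacobiPeriodic F c ↔ frameMap e J ∈ jacobi F c ∧
      components (frameMap e J 0) = components (frameMap e J 1) ∧
      components (covDeriv F c (frameMap e J) 0) = components (covDeriv F c (frameMap e J) 1) :=
      Iff.rfl
    rw [hiff, frameMap_mem_jacobi_iff hF hc he]
    refine and_congr_right fun hJ => ?_
    rw [covDeriv_frameMap_of_differentiable hF hc he hJ.1]
    exact and_congr (components_frameMap_zero_one_iff he hA J)
      (components_frameMap_zero_one_iff he hA (deriv J))

/-! ### The forms in a parallel frame -/

/-- The integrands agree at the points of differentiability, which is almost everywhere; the default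
values taken elsewhere do not affect the integral. -/
theorem indexForm_frameMap (hF : IsFinslerMetric F) (hc : IsClosedGeodesic F c)
    (he : IsParallelFrame F c e) {f h : ℝ → FrameSpace E} (hf : HasL2Deriv f (deriv f))
    (hh : HasL2Deriv h (deriv h)) :
    indexForm F c (frameMap e f) (frameMap e h) = modelForm (frameCurv he) f h := by
  have hcompl : CompleteSpace E := FiniteDimensional.complete ℝ E
  refine intervalIntegral.integral_congr_ae ?_
  filter_upwards [hf.ae_hasDerivAt, hh.ae_hasDerivAt] with t h1 h2 _
  rw [(covDeriv_frameMap hF hc he h1).2, (covDeriv_frameMap hF hc he h2).2,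
    curvatureAlong_frameMap hF hc he]
  exact congrArg₂ (· + ·) (gT_frameMap hF hc he t _ _) (gT_frameMap hF hc he t _ _)

theorem closingForm_frameMap (hF : IsFinslerMetric F) (hc : IsClosedGeodesic F c)
    (he : IsParallelFrame F c e) (hA : ∀ t x, frameAt e (t + 1) (A x) = frameAt e t x)
    {J : ℝ → FrameSpace E} (hJ : J ∈ modelJacobi (frameCurv he)) (K : ℝ → FrameSpace E) :
    closingForm F c (frameMap e J) (frameMap e K) = modelClosingForm A J K := by
  have h1 : components (covDeriv F c (frameMap e J) 1) - components (covDeriv F c (frameMap e J) 0)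
      = frameAt e 0 (A.symm (deriv J 1) - deriv J 0) := by
    rw [covDeriv_frameMap_of_differentiable hF hc he hJ.1, map_sub, ← hA 0, zero_add,
      A.apply_symm_apply]
    rfl
  rw [closingForm, h1]
  exact gT_frameMap hF hc he 0 _ _

theorem loopIndex_eq (hF : IsFinslerMetric F) (hc : IsClosedGeodesic F c)
    (he : IsParallelFrame F c e) (hA : ∀ t x, frameAt e (t + 1) (A x) = frameAt e t x) :
    loopIndex F c = negIndex (twistedH1 A) (modelForm (frameCurv he)) := by
  rw [loopIndex, ← map_twistedH1 hF hc he hA]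
  exact negIndex_map _ (fun f _ h => (map_eq_zero_iff _ (frameMap_injective he)).1 h)
    fun f hf => indexForm_frameMap hF hc he hf.1 hf.1

theorem basedIndex_eq (hF : IsFinslerMetric F) (hc : IsClosedGeodesic F c)
    (he : IsParallelFrame F c e) (hA : ∀ t x, frameAt e (t + 1) (A x) = frameAt e t x) :
    basedIndex F c = negIndex (twistedH1Zero A) (modelForm (frameCurv he)) := by
  rw [basedIndex, ← map_twistedH1Zero hF hc he hA]
  exact negIndex_map _ (fun f _ h => (map_eq_zero_iff _ (frameMap_injective he)).1 h)
    fun f hf => indexForm_frameMap hF hc he hf.1.1 hf.1.1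

theorem closingIndex_eq (hF : IsFinslerMetric F) (hc : IsClosedGeodesic F c)
    (he : IsParallelFrame F c e) (hA : ∀ t x, frameAt e (t + 1) (A x) = frameAt e t x) :
    closingIndex F c = negIndex (modelJacobiClosed (frameCurv he) A) (modelClosingForm A) := by
  rw [closingIndex, ← map_modelJacobiClosed hF hc he hA]
  exact negIndex_map _ (fun f _ h => (map_eq_zero_iff _ (frameMap_injective he)).1 h)
    fun J hJ => closingForm_frameMap hF hc he hA hJ.1 J

end Transport

end FinslerIndex

end

/-! ### The index formula and the bounds on the concavity index. -/

theorem proposition1 {E : Type*} [NormedAddCommGroup E] [NormedSpace ℝ E] [FiniteDimensional ℝ E]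
    {M : Type*} [TopologicalSpace M] [ChartedSpace E M] [IsManifold 𝓘(ℝ, E) ∞ M]
    (F : TangentBundle 𝓘(ℝ, E) M → ℝ) (hF : IsFinslerMetric F)
    (c : ℝ → M) (hc : IsClosedGeodesic F c) :
    -- all the quantities are finite
    FiniteDimensional ℝ (jacobi F c) ∧
    loopIndex F c ≠ ⊤ ∧ basedIndex F c ≠ ⊤ ∧ closingIndex F c ≠ ⊤ ∧
    -- the index formula
    ((loopIndex F c).toNat : ℤ) =
      (basedIndex F c).toNat + Module.finrank ℝ (jacobiZero F c)
        - Module.finrank ℝ (jacobiZero F c ⊓ jacobiPeriodic F c :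
            Submodule ℝ (FieldAlong (E := E) c))
        + (closingIndex F c).toNat ∧
    -- the bounds on the concavity index
    0 ≤ concavityIndex F c ∧ concavityIndex F c ≤ 2 * Module.finrank ℝ E := by
  obtain ⟨e, he⟩ := exists_parallelFrame hF hc
  obtain ⟨A, hA⟩ := exists_holonomy hF hc he
  have hR := (contDiff_frameCurv hF hc he).continuous
  have hn : Module.finrank ℝ (FrameSpace E) = Module.finrank ℝ E := by simp
  have hzero := finrank_map_frameMap he (modelJacobiZero (frameCurv he))
  have hinf := finrank_map_frameMap he
    (modelJacobiZero (frameCurv he) ⊓ modelJacobiPeriodic (frameCurv he) A)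
  rw [Submodule.map_inf _ (frameMap_injective he), map_modelJacobiZero hF hc he,
    map_modelJacobiPeriodic hF hc he hA] at hinf
  rw [map_modelJacobiZero hF hc he] at hzero
  have hformula := negIndex_twistedH1_add_finrank (A := A) hR (frameCurv_symm hF hc he)
  have hle0 := finrank_modelJacobiZero_le hR
  have hcl := negIndex_modelClosingForm_le (frameCurv he) A
  have hloop := negIndex_twistedH1_ne_top A hR
  rw [← loopIndex_eq hF hc he hA] at hformula hloop
  rw [← closingIndex_eq hF hc he hA] at hformula hcl
  rw [← basedIndex_eq hF hc he hA, ← hzero, ← hinf] at hformula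
  rw [← hzero] at hle0
  have hmono : basedIndex F c ≤ loopIndex F c := negIndex_mono fun _ hV => hV.1
  have hbased := ne_top_of_le_ne_top hloop hmono
  have hclosing := ne_top_of_le_ne_top (ENat.natCast_ne_top _) hcl
  have hfin : FiniteDimensional ℝ (jacobi F c) := by
    rw [← map_modelJacobi hF hc he]
    have := finiteDimensional_modelJacobi hR
    infer_instance
  refine ⟨hfin, hloop, hbased, hclosing, ?_⟩
  rw [concavityIndex]
  -- All indices being finite, the subtraction-free formula in `ℕ∞` becomes one of natural numbers.
  -- The upper bound uses `hle0` and `hcl`, each contributing `dim E`, and the lower bound uses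
  -- `hmono`.
  obtain ⟨l, hl⟩ := ENat.ne_top_iff_exists.1 hloop
  obtain ⟨b, hb⟩ := ENat.ne_top_iff_exists.1 hbased
  obtain ⟨k, hk⟩ := ENat.ne_top_iff_exists.1 hclosing
  rw [← hl, ← hb] at hmono
  rw [← hl, ← hb, ← hk] at hformula
  rw [← hk] at hcl
  rw [← hl, ← hb, ← hk]
  simp only [ENat.toNat_natCast]
  norm_cast at hformula hcl hmono
  omega
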